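/- Let $V$ be a complex vector space of dimension $n$ and let $0\le r\le k\le n$. For $E\in\operatorname{Gr}(k,V)$ write $\widehat E\in\bigwedge^kV$ for a Plücker representative. Let $\sigma_2(\operatorname{Gr}(m,W))\subset\mathbb P(\bigwedge^mW)$ be the ordinary secant variety of a Grassmannian (the Zariski closure of the union of the lines spanned by two of its points), and let the restricted chordal variety $\sigma_2^r(\operatorname{Gr}(k,V))\subset\mathbb P(\bigwedge^kV)$ be the Zariski closure of the set of points $[\lambda_1\widehat E_1+\lambda_2\widehat E_2]$ with $E_1,E_2\in\operatorname{Gr}(k,V)$ and $\dim(E_1\cap E_2)\ge r$. Let $$\mathcal I_r=\{(E,[t],[\widehat E\wedge t]) : E\in\operatorname{Gr}(r,V),\ [t]\in\sigma_2(\operatorname{Gr}(k-r,V/E))\}$$ be the incidence variety, with its projection $(E,[t],p)\mapsto p$ to $\mathbb P(\bigwedge^kV)$. Two $k$-planes always meet in dimension at least $2k-n$; put $\rho=\max(r,2k-n)$ (so $\rho=r$ if $n\ge 2k-r$). Set $$\operatorname{v.dim}=\rho(n-\rho)+2(k-\rho)(n-k)+1,\qquad \operatorname{exp.dim}=\min\Big\{\operatorname{v.dim},\tbinom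 nk-1\Big\}$$ for $\sigma_2^r(\operatorname{Gr}(k,V))$, and $\operatorname{v.dim}(\sigma_2(X))=2\dim X+1$ for ordinary secant varieties. 1. The image of the projection of $\mathcal I_r$ is $\sigma_2^r(\operatorname{Gr}(k,V))$, and $\sigma_2^\rho(\operatorname{Gr}(k,V))=\sigma_2^r(\operatorname{Gr}(k,V))$. 2. Suppose $k-r\ge 2$ and $n-k\ge2$. Then the projection $\mathcal I_\rho\to\sigma_2^r(\operatorname{Gr}(k,V))$ is generically finite: its fibers over the points of some dense Zariski open subset of $\sigma_2^r(\operatorname{Gr}(k,V))$ are finite. Hence, for every $E\in\operatorname{Gr}(\rho,V)$, $$\dim\sigma_2^r(\operatorname{Gr}(k,V))=\rho(n-\rho)+\dim\sigma_2(\operatorname{Gr}(k-\rho,V/E)),$$ and the defect $\operatorname{v.dim}-\dim$ of $\sigma_2^r(\operatorname{Gr}(k,V))$ equals the defect $\operatorname{v.dim}-\dim$ of $\sigma_2(\operatorname{Gr}(k-\rho,V/E))$. If this defect is positive, then $n=k+2$ or $k-r=2$. 3. Suppose $k-r\ge2$. If $\sigma_2^r(\operatorname{Gr}(k,V))$ is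 defective, that is, $\dim\sigma_2^r(\operatorname{Gr}(k,V))<\operatorname{exp.dim}$, then $n=k+2$ or $k-r=2$. -/

import Mathlib

open Module Set
open scoped LinearAlgebra.Projectivization

noncomputable section

namespace RestrictedChordal

section Projective

variable {W : Type*} [AddCommGroup W] [Module ℂ W]

/-- A homogeneous polynomial function of degree `d` on `W`: an element of the algebra generated by
the linear forms which is homogeneous of degree `d`. -/
def IsForm (d : ℕ) (f : W → ℂ) : Prop :=
  f ∈ Algebra.adjoin ℂ (range fun φ : Dual ℂ W => (φ : W → ℂ)) ∧
    ∀ (c : ℂ) (w : W), f (c • w) = c ^ d * f w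

/-- The common zero locus in `ℙ W` of a family of functions on `W` (used for families of forms). -/
def zeroLocus (F : Set (W → ℂ)) : Set (ℙ ℂ W) :=
  {p | ∀ f ∈ F, ∀ w ∈ p.submodule, f w = 0}

/-- A subset of `ℙ W` is algebraic if it is the zero locus of a family of forms. -/
def IsAlgebraicSet (Z : Set (ℙ ℂ W)) : Prop :=
  ∃ F : Set (W → ℂ), (∀ f ∈ F, ∃ d, IsForm d f) ∧ Z = zeroLocus F

lemma isForm_one : IsForm 0 (1 : W → ℂ) :=
  ⟨one_mem _, by simp⟩

lemma IsForm.mul {d e : ℕ} {f g : W → ℂ} (hf : IsForm d f) (hg : IsForm e g) :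
    IsForm (d + e) (f * g) :=
  ⟨mul_mem hf.1 hg.1, fun c w => by
    simp only [Pi.mul_apply, hf.2, hg.2]; ring⟩

lemma isAlgebraicSet_empty : IsAlgebraicSet (∅ : Set (ℙ ℂ W)) := by
  refine ⟨{1}, by rintro f rfl; exact ⟨0, isForm_one⟩, ?_⟩
  ext p
  simp only [mem_empty_iff_false, false_iff]
  intro h
  have := h 1 rfl 0 (Submodule.zero_mem _)
  simp at this

lemma isAlgebraicSet_sInter (A : Set (Set (ℙ ℂ W))) (hA : A ⊆ {Z | IsAlgebraicSet Z}) :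
    IsAlgebraicSet (⋂₀ A) := by
  refine ⟨{f | (∃ d, IsForm d f) ∧ ∃ Z ∈ A, ∀ p ∈ Z, ∀ w ∈ p.submodule, f w = 0},
    fun f hf => hf.1, ?_⟩
  ext p
  constructor
  · rintro hp f ⟨-, Z, hZ, hf⟩
    exact hf p (hp Z hZ)
  · intro hp Z hZ
    obtain ⟨F, hF, rfl⟩ := hA hZ
    exact fun f hf => hp f ⟨hF f hf, _, hZ, fun q hq => hq f hf⟩

lemma IsForm.vanish_iff {d : ℕ} {f : W → ℂ} (hf : IsForm d f) (p : ℙ ℂ W) :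
    (∀ w ∈ p.submodule, f w = 0) ↔ f p.rep = 0 := by
  rw [p.submodule_eq]
  constructor
  · exact fun h => h _ (Submodule.mem_span_singleton_self _)
  · intro h w hw
    obtain ⟨c, rfl⟩ := Submodule.mem_span_singleton.1 hw
    rw [hf.2, h, mul_zero]

lemma isAlgebraicSet_union (A B : Set (ℙ ℂ W)) (hA : IsAlgebraicSet A) (hB : IsAlgebraicSet B) :
    IsAlgebraicSet (A ∪ B) := by
  obtain ⟨F, hF, rfl⟩ := hA
  obtain ⟨G, hG, rfl⟩ := hB
  refine ⟨{h | ∃ f ∈ F, ∃ g ∈ G, h = f * g}, ?_, ?_⟩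
  · rintro h ⟨f, hf, g, hg, rfl⟩
    obtain ⟨d, hd⟩ := hF f hf
    obtain ⟨e, he⟩ := hG g hg
    exact ⟨d + e, hd.mul he⟩
  · ext p
    constructor
    · rintro (hp | hp) h ⟨f, hf, g, hg, rfl⟩ w hw
      · simp [hp f hf w hw]
      · simp [hp g hg w hw]
    · intro hp
      by_contra hcon
      simp only [mem_union, not_or, zeroLocus, mem_ofPred_eq, not_forall] at hcon
      obtain ⟨⟨f, hf, hf'⟩, ⟨g, hg, hg'⟩⟩ := hcon
      obtain ⟨d, hd⟩ := hF f hf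
      obtain ⟨e, he⟩ := hG g hg
      have h1 : f p.rep ≠ 0 := fun h => by
        obtain ⟨w, hw, h0⟩ := hf'; exact h0 ((hd.vanish_iff p).2 h w hw)
      have h2 : g p.rep ≠ 0 := fun h => by
        obtain ⟨w, hw, h0⟩ := hg'; exact h0 ((he.vanish_iff p).2 h w hw)
      have := ((hd.mul he).vanish_iff p).1 (hp _ ⟨f, hf, g, hg, rfl⟩)
      exact (mul_ne_zero h1 h2) this

/-- The Zariski topology on the projective space `ℙ W`. -/
instance zariskiTopology : TopologicalSpace (ℙ ℂ W) :=
  TopologicalSpace.ofClosed {Z | IsAlgebraicSet Z} isAlgebraicSet_empty isAlgebraicSet_sInter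
    fun A hA B hB => isAlgebraicSet_union A B hA hB

lemma isClosed_iff_isAlgebraicSet (Z : Set (ℙ ℂ W)) : IsClosed Z ↔ IsAlgebraicSet Z := by
  rw [← isOpen_compl_iff]
  have h : IsOpen Zᶜ ↔ Zᶜᶜ ∈ {Z : Set (ℙ ℂ W) | IsAlgebraicSet Z} := Iff.rfl
  rw [h, compl_compl, mem_ofPred_eq]

/-- The affine cone over a subset of `ℙ W`. -/
def cone (X : Set (ℙ ℂ W)) : Set W :=
  {w | ∃ p ∈ X, w ∈ p.submodule}

/-- The homogeneous coordinate ring of `X ⊆ ℙ W`: the algebra of polynomial functions restricted to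
the affine cone over `X`. -/
def coordRing (X : Set (ℙ ℂ W)) : Subalgebra ℂ (cone X → ℂ) :=
  Algebra.adjoin ℂ (range fun (φ : Dual ℂ W) (w : cone X) => φ (w : W))

/-- The dimension of a projective variety: the transcendence degree over `ℂ` of its homogeneous
coordinate ring (which is the dimension of the affine cone), minus one. -/
def projDim (X : Set (ℙ ℂ W)) : ℤ :=
  (Cardinal.toNat (Algebra.trdeg ℂ (coordRing X)) : ℤ) - 1

/-- The `s`-secant variety of `X ⊆ ℙ W`: the Zariski closure of the union of the linear spans of
`s` points of `X`. -/
def secantVariety (s : ℕ) (X : Set (ℙ ℂ W)) : Set (ℙ ℂ W) :=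
  closure {p | ∃ x : Fin s → ℙ ℂ W, (∀ i, x i ∈ X) ∧ p.submodule ≤ ⨆ i, (x i).submodule}

/-- The virtual dimension of the `s`-secant variety of `X`. -/
def secantVirtualDim (s : ℕ) (X : Set (ℙ ℂ W)) : ℤ :=
  s * projDim X + (s - 1)

end Projective

section Grassmannian

variable {V : Type*} [AddCommGroup V] [Module ℂ V]

/-- The subspace `⋀ᵏE` of `⋀ᵏV`. If `dim E = k`, it is the line spanned by `e₁ ∧ ⋯ ∧ eₖ` for any
basis `e₁, …, eₖ` of `E`. -/
def pluckerLine (k : ℕ) (E : Submodule ℂ V) : Submodule ℂ (⋀[ℂ]^k V) :=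
  LinearMap.range (exteriorPower.map k E.subtype)

variable (V) in
/-- The Grassmannian of `k`-dimensional subspaces of `V` in its Plücker embedding. -/
def grassmannian (k : ℕ) : Set (ℙ ℂ (⋀[ℂ]^k V)) :=
  {p | ∃ E : Submodule ℂ V, finrank ℂ E = k ∧ p.submodule = pluckerLine k E}

variable (V) in
/-- The `r`-restricted `s`-secant variety of `Gr(k, V)`: the Zariski closure of the set of all
points `[λ₁ Ê₁ + ⋯ + λₛ Êₛ]` with `Eᵢ ∈ Gr(k, V)` and `dim (⋂ Eᵢ) ≥ r`. -/
def restrictedSecant (s r k : ℕ) : Set (ℙ ℂ (⋀[ℂ]^k V)) :=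
  closure {p | ∃ E : Fin s → Submodule ℂ V, (∀ i, finrank ℂ (E i) = k) ∧
    r ≤ finrank ℂ (⨅ i, E i : Submodule ℂ V) ∧ p.submodule ≤ ⨆ i, pluckerLine k (E i)}

/-- `p = [Ê ∧ t]` where `[t] = q` is a point of `ℙ (⋀ᵐ(V/E))`: some nonzero `w` on the line `p` is the
product of an element `e` of `⋀ʳE` and a lift `t ∈ ⋀ᵐV` of an element of the line `q`. (The
product depends only on the class of `t` in `⋀ᵐ(V/E)` when `dim E = r`.) -/
def IsWedge {k m : ℕ} (r : ℕ) (E : Submodule ℂ V) (q : ℙ ℂ (⋀[ℂ]^m (V ⧸ E)))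
    (p : ℙ ℂ (⋀[ℂ]^k V)) : Prop :=
  ∃ e ∈ pluckerLine r E, ∃ t : ⋀[ℂ]^m V, exteriorPower.map m E.mkQ t ∈ q.submodule ∧
    ∃ w ∈ p.submodule, w ≠ 0 ∧ (w : ExteriorAlgebra ℂ V) = (e : ExteriorAlgebra ℂ V) * t

variable (V) in
/-- The incidence variety of all `((E, q), p)` with `E ∈ Gr(r, V)`, `q = [t]` a point of
`σₛ(Gr(k - r, V/E))`, and `p = [Ê ∧ t] ∈ ℙ (⋀ᵏV)`. -/
def incidenceVariety (s r k : ℕ) :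
    Set ((Σ E : Submodule ℂ V, ℙ ℂ (⋀[ℂ]^(k - r) (V ⧸ E))) × ℙ ℂ (⋀[ℂ]^k V)) :=
  {x | finrank ℂ x.1.1 = r ∧ x.1.2 ∈ secantVariety s (grassmannian (V ⧸ x.1.1) (k - r)) ∧
    IsWedge r x.1.1 x.1.2 x.2}

/-- The virtual dimension of `σₛʳ(Gr(k, n))`: choose `E ∈ Gr(r, n)`, then `s` points of
`Gr(k - r, n - r)`, then a point in the span of `s` points. -/
def restrictedVirtualDim (s r k n : ℕ) : ℤ :=
  r * (n - r) + s * ((k - r) * (n - k)) + (s - 1)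

/-- The expected dimension of `σₛʳ(Gr(k, n))`. -/
def restrictedExpectedDim (s r k n : ℕ) : ℤ :=
  min (restrictedVirtualDim s r k n) ((n.choose k : ℤ) - 1)

/-- Two `k`-planes in `n`-space always meet in dimension at least `2k - n`, so the size of the
overlap of two general `k`-planes meeting in dimension at least `r` is `max r (2k - n)`. -/
def overlap (r k n : ℕ) : ℕ :=
  max r (2 * k - n)

end Grassmannian

end RestrictedChordal

end

/-!
Write `m = k - r`. A general point of `σ₂ʳ(Gr(k, V))` is `[Ê ∧ t]`, where `E` has dimension `r` and
`t` is a sum of two decomposable `m`-vectors. Having an annihilator of dimension at least `r` is a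
closed condition on `[w]`, and if `E` annihilates `w`, then `w = Ê ∧ t`, where `t` is obtained by
contracting `w` with linear forms dual to a basis of `E`. Contraction is linear and preserves the
cone of sums of two decomposables, so every point of the closure is `[Ê ∧ t]` with `[t]` in the
secant variety of `Gr(m, V/E)`.

If `m ≥ 2` and `n - r ≥ 2 m`, no nonzero vector of `V/E` annihilates a general such `t`, so the
annihilator of `Ê ∧ t` is exactly `E` and the fiber over this point is a single point. The same fact
gives the dimension: writing `V = Kʳ ⊕ U` and letting `E` run through the graphs of linear maps
`X : Kʳ → U`, the equations `v ∧ w = 0` for the vectors `v` of the graph determine the entries of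
`X` as rational functions of the coordinates of `w = Ê ∧ t`. The function field of the restricted
cone is therefore generated over that of the cone over `σ₂(Gr(m, U))` by `r (n - r)` independent
variables.

For `m ≥ 3` the cone over `σ₂(Gr(m, U))` has the dimension expected from its parametrization: at
the sum of `b₁ ∧ ⋯ ∧ bₘ` and `bₘ₊₁ ∧ ⋯ ∧ b₂ₘ`, for a basis `b`, the summands and the vectors
obtained from them by exchanging one factor are tangent vectors and distinct members of the
standard basis of `⋀ᵐU`, and the Jacobian criterion bounds the transcendence degree from below. If
`n ≤ k + 1`, every `k`-vector is decomposable and the variety is the whole projective space.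
-/

noncomputable section

namespace RestrictedChordal

open CliffordAlgebra (contractLeft)
open ExteriorAlgebra (ι ιMulti)

section DecomposableVectors

variable {K : Type*} [Field K] {V : Type*} [AddCommGroup V] [Module K V]
  {U : Type*} [AddCommGroup U] [Module K U]

lemma exists_dual_family {κ : Type*} [DecidableEq κ] {u : κ → V} (hu : LinearIndependent K u) :
    ∃ φ : κ → Dual K V, ∀ i j, φ i (u j) = if i = j then 1 else 0 := by
  obtain ⟨g, hg⟩ := (Finsupp.linearCombination K u).exists_leftInverse_of_injective
    (LinearMap.ker_eq_bot.2 hu)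
  refine ⟨fun i => Finsupp.lapply i ∘ₗ g, fun i j => ?_⟩
  have h : g (u j) = Finsupp.single j 1 := by
    simpa using LinearMap.congr_fun hg (Finsupp.single j 1)
  simp [h, Finsupp.single_apply, eq_comm]

lemma exists_linearIndependent_span_range_eq {E : Submodule K V} [FiniteDimensional K E] {k : ℕ}
    (hE : finrank K E = k) :
    ∃ u : Fin k → V, LinearIndependent K u ∧ Submodule.span K (range u) = E := by
  let b := finBasisOfFinrankEq K E hE
  refine ⟨fun i => b i, b.linearIndependent.map' E.subtype E.ker_subtype, ?_⟩
  have h := congrArg (Submodule.map E.subtype) b.span_eq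
  rwa [Submodule.map_span, Submodule.map_top, Submodule.range_subtype, ← range_comp] at h

lemma exists_linearIndependent_mem {r : ℕ} {S : Submodule K V} [FiniteDimensional K S]
    (hS : r ≤ finrank K S) : ∃ e : Fin r → V, LinearIndependent K e ∧ ∀ i, e i ∈ S := by
  obtain ⟨u, hu, hspan⟩ := exists_linearIndependent_span_range_eq (rfl : finrank K S = _)
  exact ⟨u ∘ Fin.castLE hS, hu.comp _ (Fin.castLE_injective hS),
    fun i => hspan.le (Submodule.subset_span (mem_range_self _))⟩

lemma ιMulti_ne_zero {k : ℕ} {u : Fin k → V} (hu : LinearIndependent K u) : ιMulti K k u ≠ 0 := by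
  obtain ⟨φ, hφ⟩ := exists_dual_family hu
  intro h
  have hdet : (Matrix.of fun i j => φ j (u i)).det = 0 := by
    rw [← exteriorPower.pairingDual_ιMulti_ιMulti,
      show exteriorPower.ιMulti K k u = 0 from Subtype.ext h, map_zero]
  have hone : (Matrix.of fun i j => φ j (u i)) = (1 : Matrix (Fin k) (Fin k) K) := by
    ext i j
    simp [hφ, Matrix.one_apply, eq_comm]
  rw [hone, Matrix.det_one] at hdet
  exact one_ne_zero hdet

lemma ιMulti_ne_zero_iff {k : ℕ} {u : Fin k → V} :
    ιMulti K k u ≠ 0 ↔ LinearIndependent K u :=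
  ⟨fun hu => by_contra fun h => hu ((ιMulti K k).map_linearDependent _ h), ιMulti_ne_zero⟩

/-- The cone of decomposable `k`-vectors `c • v₁ ∧ ⋯ ∧ vₖ`, inside the exterior algebra. For
`K = ℂ` it is the affine cone over the Grassmannian. -/
def decomposables (K : Type*) [Field K] (k : ℕ) (V : Type*) [AddCommGroup V] [Module K V] :
    Set (ExteriorAlgebra K V) :=
  {w | ∃ (c : K) (v : Fin k → V), w = c • ιMulti K k v}

lemma decomposables_subset_exteriorPower (k : ℕ) :
    decomposables K k V ⊆ (⋀[K]^k V : Submodule K (ExteriorAlgebra K V)) := by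
  rintro _ ⟨c, v, rfl⟩
  exact Submodule.smul_mem _ _ (exteriorPower.ιMulti K k v).2

lemma zero_mem_decomposables (k : ℕ) : (0 : ExteriorAlgebra K V) ∈ decomposables K k V :=
  ⟨0, 0, by rw [zero_smul]⟩

lemma ιMulti_mem_decomposables {k : ℕ} (v : Fin k → V) : ιMulti K k v ∈ decomposables K k V :=
  ⟨1, v, (one_smul K _).symm⟩

lemma smul_mem_decomposables {k : ℕ} (c : K) {w : ExteriorAlgebra K V}
    (hw : w ∈ decomposables K k V) : c • w ∈ decomposables K k V := by
  obtain ⟨d, v, rfl⟩ := hw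
  exact ⟨c * d, v, (mul_smul c d _).symm⟩

lemma map_mem_decomposables {k : ℕ} (f : V →ₗ[K] U) {w : ExteriorAlgebra K V}
    (hw : w ∈ decomposables K k V) : ExteriorAlgebra.map f w ∈ decomposables K k U := by
  obtain ⟨d, v, rfl⟩ := hw
  exact ⟨d, f ∘ v, by rw [map_smul, ExteriorAlgebra.map_apply_ιMulti]⟩

lemma ιMulti_mul_mem_decomposables {r m k : ℕ} (hk : k = r + m) (e : Fin r → V)
    {x : ExteriorAlgebra K V} (hx : x ∈ decomposables K m V) :
    ιMulti K r e * x ∈ decomposables K k V := by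
  subst hk
  obtain ⟨c, v, rfl⟩ := hx
  exact ⟨c, Fin.append e v, by rw [mul_smul_comm, ExteriorAlgebra.ιMulti_mul_ιMulti]⟩

end DecomposableVectors

section Products

variable {R : Type*} [CommRing R] {M : Type*} [AddCommGroup M] [Module R M]

/-- Both sides of `v₁ ∧ ⋯ ∧ vₖ = det • u₁ ∧ ⋯ ∧ uₖ` are alternating in the coordinates of the
`vᵢ` with respect to the `uⱼ`. -/
lemma ιMulti_mem_span_singleton {k : ℕ} {u v : Fin k → M}
    (hv : ∀ i, v i ∈ Submodule.span R (range u)) :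
    ιMulti R k v ∈ Submodule.span R {ιMulti R k u} := by
  let f := Fintype.linearCombination R u
  let b := Pi.basisFun R (Fin k)
  have hf : ∀ i, f (b i) = u i := fun i => by simp [f, b]
  have hdet : (ιMulti R k).compLinearMap f =
      (LinearMap.toSpanSingleton R _ (ιMulti R k u)).compAlternatingMap b.det := by
    refine Module.Basis.ext_alternating b fun w hw => ?_
    let σ := Equiv.ofBijective w (Finite.injective_iff_bijective.1 hw)
    change ((ιMulti R k).compLinearMap f) (b ∘ σ) =
      ((LinearMap.toSpanSingleton R _ (ιMulti R k u)).compAlternatingMap b.det) (b ∘ σ)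
    rw [AlternatingMap.map_perm, AlternatingMap.map_perm, LinearMap.compAlternatingMap_apply,
      b.det_self, LinearMap.toSpanSingleton_apply, one_smul]
    exact congrArg (fun v => Equiv.Perm.sign σ • ιMulti R k v) (funext hf)
  have hrange : Submodule.span R (range u) = LinearMap.range f :=
    (Fintype.range_linearCombination R u).symm
  choose a ha using fun i => hrange ▸ hv i
  obtain rfl : f ∘ a = v := funext ha
  exact Submodule.mem_span_singleton.2 ⟨b.det a, (DFunLike.congr_fun hdet a).symm⟩

lemma ιMulti_mul_ι {r : ℕ} (e : Fin r → M) (v : M) :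
    ιMulti R r e * ι R v = (-1 : R) ^ r • (ι R v * ιMulti R r e) := by
  induction r with
  | zero => simp
  | succ r ih =>
    rw [ExteriorAlgebra.ιMulti_succ_apply, mul_assoc, ih, mul_smul_comm, ← mul_assoc,
      eq_neg_of_add_eq_zero_left (ExteriorAlgebra.ι_add_mul_swap (e 0) v), pow_succ, mul_smul,
      neg_mul, mul_assoc, smul_neg, neg_one_smul, smul_neg]

lemma ι_mul_ιMulti_eq_zero {r : ℕ} {e : Fin r → M} {v : M}
    (hv : v ∈ Submodule.span R (range e)) : ι R v * ιMulti R r e = 0 := by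
  induction hv using Submodule.span_induction with
  | mem x hx =>
    obtain ⟨i, rfl⟩ := hx
    rw [ExteriorAlgebra.ιMulti_apply]
    exact ExteriorAlgebra.ι_mul_prod_list e i
  | zero => simp
  | add x y _ _ hx hy => rw [map_add, add_mul, hx, hy, add_zero]
  | smul c x _ hx => rw [map_smul, smul_mul_assoc, hx, smul_zero]

lemma ιMulti_mul_ι_eq_zero {r : ℕ} {e : Fin r → M} {v : M}
    (hv : v ∈ Submodule.span R (range e)) : ιMulti R r e * ι R v = 0 := by
  rw [ιMulti_mul_ι, ι_mul_ιMulti_eq_zero hv, smul_zero]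

lemma ιMulti_mul_map {r : ℕ} {e : Fin r → M} {f : M →ₗ[R] M}
    (hf : ∀ v, f v - v ∈ Submodule.span R (range e)) (x : ExteriorAlgebra R M) :
    ιMulti R r e * ExteriorAlgebra.map f x = ιMulti R r e * x := by
  induction x using CliffordAlgebra.left_induction with
  | algebraMap c => rw [AlgHom.commutes]
  | add x y hx hy => rw [map_add, mul_add, mul_add, hx, hy]
  | ι_mul x v hx =>
    change ιMulti R r e * ExteriorAlgebra.map f (ι R v * x) = ιMulti R r e * (ι R v * x)
    have hv : ιMulti R r e * ι R (f v) = ιMulti R r e * ι R v := by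
      rw [← sub_eq_zero, ← mul_sub, ← map_sub]
      exact ιMulti_mul_ι_eq_zero (hf v)
    rw [map_mul, ExteriorAlgebra.map_apply_ι, ← mul_assoc, hv, ιMulti_mul_ι, ← mul_assoc,
      ιMulti_mul_ι, smul_mul_assoc, smul_mul_assoc, mul_assoc, hx, mul_assoc]

lemma ιMulti_mul_mem_exteriorPower {r m k : ℕ} (hk : k = r + m) (e : Fin r → M)
    {x : ExteriorAlgebra R M} (hx : x ∈ ⋀[R]^m M) : ιMulti R r e * x ∈ ⋀[R]^k M := by
  subst hk
  exact SetLike.GradedMul.mul_mem (exteriorPower.ιMulti R r e).2 hx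

end Products

section Contraction

variable {R : Type*} [CommRing R] {M : Type*} [AddCommGroup M] [Module R M]
  {N : Type*} [AddCommGroup N] [Module R N]

lemma contractLeft_mem_exteriorPower (φ : Dual R M) {k : ℕ} {w : ExteriorAlgebra R M}
    (hw : w ∈ ⋀[R]^(k + 1) M) : contractLeft φ w ∈ ⋀[R]^k M := by
  rw [← ExteriorAlgebra.ιMulti_span_fixedDegree] at hw
  induction hw using Submodule.span_induction with
  | mem x hx =>
    obtain ⟨v, rfl⟩ := hx
    induction k with
    | zero =>
      rw [ExteriorAlgebra.ιMulti_succ_apply, ExteriorAlgebra.ιMulti_zero_apply,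
        CliffordAlgebra.contractLeft_ι_mul, CliffordAlgebra.contractLeft_one, mul_zero, sub_zero]
      exact Submodule.smul_mem _ _ (by simp)
    | succ k ih =>
      rw [ExteriorAlgebra.ιMulti_succ_apply, CliffordAlgebra.contractLeft_ι_mul]
      refine Submodule.sub_mem _ (Submodule.smul_mem _ _ (exteriorPower.ιMulti R _ _).2) ?_
      have h := Submodule.mul_mem_mul (LinearMap.mem_range_self (ι R) (v 0))
        (ih (Matrix.vecTail v))
      rwa [← pow_succ'] at h
  | zero => simp
  | add x y _ _ hx hy => rw [map_add]; exact Submodule.add_mem _ hx hy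
  | smul c x _ hx => rw [map_smul]; exact Submodule.smul_mem _ _ hx

lemma contractLeft_ιMulti_eq_zero {φ : Dual R M} {k : ℕ} {v : Fin k → M}
    (hv : ∀ i, φ (v i) = 0) : contractLeft φ (ιMulti R k v) = 0 := by
  induction k with
  | zero => rw [ExteriorAlgebra.ιMulti_zero_apply, CliffordAlgebra.contractLeft_one]
  | succ k ih =>
    rw [ExteriorAlgebra.ιMulti_succ_apply, CliffordAlgebra.contractLeft_ι_mul, hv, zero_smul,
      zero_sub, ih (v := Matrix.vecTail v) fun i => hv i.succ, mul_zero, neg_zero]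

/-- Iterated contraction of a multivector with the linear forms `φ₁`, then `φ₂`, and so on up to
`φᵣ`: it undoes multiplication by `e₁ ∧ ⋯ ∧ eᵣ` when `φ` is dual to `e`. -/
def contractMulti :
    (r : ℕ) → (Fin r → Dual R M) → ExteriorAlgebra R M →ₗ[R] ExteriorAlgebra R M
  | 0, _ => LinearMap.id
  | r + 1, φ => contractMulti r (Fin.tail φ) ∘ₗ contractLeft (φ 0)

lemma contractMulti_zero (φ : Fin 0 → Dual R M) (x : ExteriorAlgebra R M) :
    contractMulti 0 φ x = x := rfl

lemma contractMulti_succ {r : ℕ} (φ : Fin (r + 1) → Dual R M) (x : ExteriorAlgebra R M) :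
    contractMulti (r + 1) φ x = contractMulti r (Fin.tail φ) (contractLeft (φ 0) x) := rfl

lemma contractMulti_mem_exteriorPower {r m k : ℕ} (hk : k = r + m) (φ : Fin r → Dual R M)
    {w : ExteriorAlgebra R M} (hw : w ∈ ⋀[R]^k M) : contractMulti r φ w ∈ ⋀[R]^m M := by
  induction r generalizing k w with
  | zero => rwa [contractMulti_zero, ← Nat.zero_add m, ← hk]
  | succ r ih =>
    obtain rfl : k = (r + m) + 1 := by omega
    exact ih rfl _ (contractLeft_mem_exteriorPower _ hw)

lemma contractMulti_ι_mul {r : ℕ} {φ : Fin r → Dual R M} {v : M} (hv : ∀ i, φ i v = 0)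
    (x : ExteriorAlgebra R M) :
    contractMulti r φ (ι R v * x) = (-1 : R) ^ r • (ι R v * contractMulti r φ x) := by
  induction r generalizing x with
  | zero => simp only [contractMulti_zero, pow_zero, one_smul]
  | succ r ih =>
    rw [contractMulti_succ, contractMulti_succ, CliffordAlgebra.contractLeft_ι_mul, hv, zero_smul,
      zero_sub, map_neg, ih (φ := Fin.tail φ) fun i => hv i.succ, pow_succ, mul_smul,
      neg_one_smul, smul_neg]

/-- The inductive step is `φ₁(e₁) w = e₁ ∧ (φ₁ ⌋ w)`, the contraction of `e₁ ∧ w = 0`. -/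
lemma eq_ιMulti_mul_contractMulti {r : ℕ} {e : Fin r → M} {φ : Fin r → Dual R M}
    (hφ : ∀ i j, φ i (e j) = if i = j then 1 else 0) {w : ExteriorAlgebra R M}
    (hw : ∀ i, ι R (e i) * w = 0) : w = ιMulti R r e * contractMulti r φ w := by
  induction r generalizing w with
  | zero => rw [ExteriorAlgebra.ιMulti_zero_apply, contractMulti_zero, one_mul]
  | succ r ih =>
    have hcontract : ∀ i, φ 0 (e i) • w = ι R (e i) * contractLeft (φ 0) w := by
      intro i
      rw [← sub_eq_zero, ← CliffordAlgebra.contractLeft_ι_mul, hw, map_zero]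
    have htail : ∀ i : Fin r, ι R (e i.succ) * contractLeft (φ 0) w = 0 := by
      intro i
      rw [← hcontract, hφ, if_neg (Fin.succ_ne_zero i).symm, zero_smul]
    have ih' := ih (e := Matrix.vecTail e) (φ := Fin.tail φ)
      (fun i j => (hφ i.succ j.succ).trans (by simp only [Fin.succ_inj])) htail
    have hhead := hcontract 0
    rw [hφ, if_pos rfl, one_smul] at hhead
    rwa [ExteriorAlgebra.ιMulti_succ_apply, mul_assoc, contractMulti_succ, ← ih']

lemma map_contractMulti_ιMulti_mul {r : ℕ} {e : Fin r → M} {φ : Fin r → Dual R M}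
    (hφ : ∀ i j, φ i (e j) = if i = j then 1 else 0) {f : M →ₗ[R] N} (hf : ∀ i, f (e i) = 0)
    (x : ExteriorAlgebra R M) :
    ExteriorAlgebra.map f (contractMulti r φ (ιMulti R r e * x)) = ExteriorAlgebra.map f x := by
  induction r with
  | zero => rw [ExteriorAlgebra.ιMulti_zero_apply, contractMulti_zero, one_mul]
  | succ r ih =>
    have h0 : ∀ i : Fin r, Fin.tail φ i (e 0) = 0 := fun i =>
      (hφ i.succ 0).trans (if_neg (Fin.succ_ne_zero i))
    rw [ExteriorAlgebra.ιMulti_succ_apply, mul_assoc, contractMulti_succ,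
      CliffordAlgebra.contractLeft_ι_mul, hφ, if_pos rfl, one_smul, map_sub, map_sub,
      contractMulti_ι_mul h0, map_smul, map_mul (ExteriorAlgebra.map f),
      ExteriorAlgebra.map_apply_ι, hf, map_zero, zero_mul, smul_zero, sub_zero]
    exact ih (e := Matrix.vecTail e) (φ := Fin.tail φ)
      (fun i j => (hφ i.succ j.succ).trans (by simp only [Fin.succ_inj])) fun i => hf i.succ

end Contraction

section ContractionOfDecomposables

variable {K : Type*} [Field K] {V : Type*} [AddCommGroup V] [Module K V]

/-- If `φ(v₁) ≠ 0`, then subtracting multiples of `v₁` from the other factors moves them into the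
kernel of `φ` and leaves the product unchanged. -/
lemma contractLeft_ιMulti_mem_decomposables {φ : Dual K V} {k : ℕ} {v : Fin (k + 1) → V}
    (hv : φ (v 0) ≠ 0) : contractLeft φ (ιMulti K (k + 1) v) ∈ decomposables K k V := by
  let f : V →ₗ[K] V := LinearMap.id - φ.smulRight ((φ (v 0))⁻¹ • v 0)
  have hφf : ∀ w, φ (f w) = 0 := fun w => by simp [f, hv]
  have hf : ∀ w, f w - w ∈ Submodule.span K (range fun _ : Fin 1 => v 0) := fun w => by
    rw [range_const, Submodule.mem_span_singleton]
    exact ⟨-(φ w * (φ (v 0))⁻¹), by simp [f, mul_smul]⟩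
  have hmap := ιMulti_mul_map hf (ιMulti K k (Matrix.vecTail v))
  rw [ExteriorAlgebra.map_apply_ιMulti, ExteriorAlgebra.ιMulti_succ_apply,
    ExteriorAlgebra.ιMulti_zero_apply, mul_one] at hmap
  have hker : contractLeft φ (ιMulti K k (f ∘ Matrix.vecTail v)) = 0 :=
    contractLeft_ιMulti_eq_zero fun _ => hφf _
  rw [ExteriorAlgebra.ιMulti_succ_apply, ← hmap, CliffordAlgebra.contractLeft_ι_mul, hker,
    mul_zero, sub_zero]
  exact ⟨_, _, rfl⟩

lemma contractLeft_mem_decomposables (φ : Dual K V) {k : ℕ} {w : ExteriorAlgebra K V}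
    (hw : w ∈ decomposables K (k + 1) V) : contractLeft φ w ∈ decomposables K k V := by
  obtain ⟨c, v, rfl⟩ := hw
  rw [map_smul]
  apply smul_mem_decomposables
  by_cases hφ : ∀ i, φ (v i) = 0
  · rw [contractLeft_ιMulti_eq_zero hφ]
    exact zero_mem_decomposables k
  obtain ⟨i, hi⟩ := not_forall.1 hφ
  have hswap := (ιMulti K (k + 1)).map_perm (v ∘ Equiv.swap 0 i) (Equiv.swap 0 i)
  rw [Function.comp_assoc, ← Equiv.coe_trans, Equiv.swap_swap, Equiv.coe_refl,
    Function.comp_id] at hswap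
  rw [hswap, Units.smul_def, ← Int.cast_smul_eq_zsmul K, map_smul]
  exact smul_mem_decomposables _ (contractLeft_ιMulti_mem_decomposables (by simpa using hi))

lemma contractMulti_mem_decomposables {r m k : ℕ} (hk : k = r + m) (φ : Fin r → Dual K V)
    {w : ExteriorAlgebra K V} (hw : w ∈ decomposables K k V) :
    contractMulti r φ w ∈ decomposables K m V := by
  induction r generalizing k w with
  | zero => rwa [contractMulti_zero, ← Nat.zero_add m, ← hk]
  | succ r ih =>
    obtain rfl : k = (r + m) + 1 := by omega
    exact ih rfl _ (contractLeft_mem_decomposables _ hw)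

end ContractionOfDecomposables

section Cones

variable {K : Type*} [Field K] {V : Type*} [AddCommGroup V] [Module K V]
  {U : Type*} [AddCommGroup U] [Module K U] {s r m k : ℕ}

/-- The sums of `s` decomposable `m`-vectors: for `K = ℂ` the affine cone over the union of the
`s`-secant spaces of `Gr(m, V)`, before taking its closure. -/
def secantCone (K : Type*) [Field K] (s m : ℕ) (V : Type*) [AddCommGroup V] [Module K V] :
    Set (ExteriorAlgebra K V) :=
  {w | ∃ a : Fin s → ExteriorAlgebra K V, (∀ i, a i ∈ decomposables K m V) ∧ w = ∑ i, a i}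

/-- The products of a decomposable `r`-vector with a sum of `s` decomposable `m`-vectors: for
`K = ℂ` the affine cone over the points whose closure is the `r`-restricted `s`-secant variety of
`Gr(r + m, V)`. -/
def restrictedCone (K : Type*) [Field K] (s r m : ℕ) (V : Type*) [AddCommGroup V] [Module K V] :
    Set (ExteriorAlgebra K V) :=
  {w | ∃ e : Fin r → V, ∃ t ∈ secantCone K s m V, w = ιMulti K r e * t}

lemma secantCone_subset_exteriorPower :
    secantCone K s m V ⊆ (⋀[K]^m V : Submodule K (ExteriorAlgebra K V)) := by
  rintro _ ⟨a, ha, rfl⟩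
  exact Submodule.sum_mem _ fun i _ => decomposables_subset_exteriorPower m (ha i)

lemma smul_mem_secantCone (c : K) {w : ExteriorAlgebra K V} (hw : w ∈ secantCone K s m V) :
    c • w ∈ secantCone K s m V := by
  obtain ⟨a, ha, rfl⟩ := hw
  exact ⟨fun i => c • a i, fun i => smul_mem_decomposables c (ha i), Finset.smul_sum⟩

lemma map_mem_secantCone (f : V →ₗ[K] U) {w : ExteriorAlgebra K V}
    (hw : w ∈ secantCone K s m V) : ExteriorAlgebra.map f w ∈ secantCone K s m U := by
  obtain ⟨a, ha, rfl⟩ := hw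
  exact ⟨fun i => ExteriorAlgebra.map f (a i), fun i => map_mem_decomposables f (ha i),
    map_sum _ _ _⟩

lemma contractMulti_mem_secantCone (hk : k = r + m) (φ : Fin r → Dual K V)
    {w : ExteriorAlgebra K V} (hw : w ∈ secantCone K s k V) :
    contractMulti r φ w ∈ secantCone K s m V := by
  obtain ⟨a, ha, rfl⟩ := hw
  exact ⟨fun i => contractMulti r φ (a i), fun i => contractMulti_mem_decomposables hk φ (ha i),
    map_sum _ _ _⟩

lemma smul_mem_restrictedCone (c : K) {w : ExteriorAlgebra K V}
    (hw : w ∈ restrictedCone K s r m V) : c • w ∈ restrictedCone K s r m V := by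
  obtain ⟨e, t, ht, rfl⟩ := hw
  exact ⟨e, c • t, smul_mem_secantCone c ht, by rw [mul_smul_comm]⟩

lemma restrictedCone_subset_secantCone (hk : k = r + m) :
    restrictedCone K s r m V ⊆ secantCone K s k V := by
  rintro _ ⟨e, t, ⟨a, ha, rfl⟩, rfl⟩
  exact ⟨fun i => ιMulti K r e * a i, fun i => ιMulti_mul_mem_decomposables hk e (ha i),
    Finset.mul_sum _ _ _⟩

end Cones

section ProjectivePoints

variable {K : Type*} [Field K] {W : Type*} [AddCommGroup W] [Module K W]

lemma rep_mem_submodule (p : ℙ K W) : p.rep ∈ p.submodule := by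
  rw [p.submodule_eq]
  exact Submodule.mem_span_singleton_self _

lemma mem_submodule_mk {w : W} (hw : w ≠ 0) : w ∈ (Projectivization.mk K w hw).submodule := by
  rw [Projectivization.submodule_mk]
  exact Submodule.mem_span_singleton_self _

lemma rep_mk_mem {S : Set W} (hS : ∀ c : K, ∀ w ∈ S, c • w ∈ S) {w : W} (hw : w ≠ 0)
    (hwS : w ∈ S) : (Projectivization.mk K w hw).rep ∈ S := by
  obtain ⟨a, ha⟩ := Projectivization.exists_smul_eq_mk_rep K w hw
  rw [← ha]
  exact hS a w hwS

lemma submodule_le_iff {p : ℙ K W} {S : Submodule K W} : p.submodule ≤ S ↔ p.rep ∈ S := by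
  rw [p.submodule_eq, Submodule.span_singleton_le_iff_mem]

lemma eq_mk_of_mem_submodule {p : ℙ K W} {w : W} (hw : w ∈ p.submodule) (hw0 : w ≠ 0) :
    p = Projectivization.mk K w hw0 := by
  rw [p.submodule_eq, Submodule.mem_span_singleton] at hw
  rw [← p.mk_rep, eq_comm, Projectivization.mk_eq_mk_iff']
  exact hw

lemma mem_iSup_iff_exists_sum {κ : Type*} [Fintype κ] {S : κ → Submodule K W} {w : W} :
    w ∈ ⨆ i, S i ↔ ∃ a : κ → W, (∀ i, a i ∈ S i) ∧ w = ∑ i, a i := by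
  constructor
  · intro h
    obtain ⟨f, hf, rfl⟩ := (Submodule.mem_iSup_iff_exists_finsupp S w).1 h
    exact ⟨f, hf, Finsupp.sum_fintype _ _ fun _ => rfl⟩
  · rintro ⟨a, ha, rfl⟩
    exact Submodule.sum_mem _ fun i _ => Submodule.mem_iSup_of_mem i (ha i)

lemma exists_ne_zero_of_eq_sum {κ : Type*} [Fintype κ] {w : W} (hw : w ≠ 0) {a : κ → W}
    (h : w = ∑ i, a i) : ∃ j, a j ≠ 0 := by
  by_contra! ha
  exact hw (h.trans (Finset.sum_eq_zero fun i _ => ha i))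

end ProjectivePoints

section Grassmannian

variable {V : Type*} [AddCommGroup V] [Module ℂ V]

lemma ιMulti_mem_pluckerLine {k : ℕ} {E : Submodule ℂ V} {v : Fin k → V} (hv : ∀ i, v i ∈ E) :
    exteriorPower.ιMulti ℂ k v ∈ pluckerLine k E :=
  ⟨exteriorPower.ιMulti ℂ k fun i => ⟨v i, hv i⟩, exteriorPower.map_apply_ιMulti _ _⟩

lemma pluckerLine_span_range {k : ℕ} (u : Fin k → V) :
    pluckerLine k (Submodule.span ℂ (range u)) = ℂ ∙ exteriorPower.ιMulti ℂ k u := by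
  refine le_antisymm ?_ ((Submodule.span_singleton_le_iff_mem _ _).2
    (ιMulti_mem_pluckerLine fun i => Submodule.subset_span (mem_range_self i)))
  rw [pluckerLine, LinearMap.range_eq_map, ← exteriorPower.ιMulti_span, Submodule.map_span,
    Submodule.span_le]
  rintro _ ⟨_, ⟨v, rfl⟩, rfl⟩
  obtain ⟨c, hc⟩ := Submodule.mem_span_singleton.1
    (ιMulti_mem_span_singleton (R := ℂ) (u := u) fun i => (v i).2)
  refine Submodule.mem_span_singleton.2 ⟨c, ?_⟩
  rw [exteriorPower.map_apply_ιMulti]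
  exact Subtype.ext hc

lemma coe_mem_decomposables {k : ℕ} {E : Submodule ℂ V} [FiniteDimensional ℂ E]
    (hE : finrank ℂ E = k) {w : ⋀[ℂ]^k V} (hw : w ∈ pluckerLine k E) :
    (w : ExteriorAlgebra ℂ V) ∈ decomposables ℂ k V := by
  obtain ⟨u, -, rfl⟩ := exists_linearIndependent_span_range_eq hE
  rw [pluckerLine_span_range] at hw
  obtain ⟨c, rfl⟩ := Submodule.mem_span_singleton.1 hw
  exact ⟨c, u, rfl⟩

lemma exists_mem_pluckerLine {k : ℕ} {w : ⋀[ℂ]^k V} (hw0 : w ≠ 0) {c : ℂ} {v : Fin k → V}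
    (hw : (w : ExteriorAlgebra ℂ V) = c • ιMulti ℂ k v) :
    finrank ℂ (Submodule.span ℂ (range v)) = k ∧
      w ∈ pluckerLine k (Submodule.span ℂ (range v)) := by
  obtain rfl : w = c • exteriorPower.ιMulti ℂ k v := Subtype.ext hw
  have hv : LinearIndependent ℂ v :=
    ιMulti_ne_zero_iff.1 fun h => right_ne_zero_of_smul hw0 (Subtype.ext h)
  refine ⟨by rw [finrank_span_eq_card hv, Fintype.card_fin], ?_⟩
  rw [pluckerLine_span_range]
  exact Submodule.smul_mem _ _ (Submodule.mem_span_singleton_self _)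

lemma mk_mem_grassmannian {k : ℕ} {w : ⋀[ℂ]^k V} (hw0 : w ≠ 0)
    (hw : (w : ExteriorAlgebra ℂ V) ∈ decomposables ℂ k V) :
    Projectivization.mk ℂ w hw0 ∈ grassmannian V k := by
  obtain ⟨c, v, hv⟩ := hw
  obtain ⟨hfr, hmem⟩ := exists_mem_pluckerLine hw0 hv
  refine ⟨_, hfr, ?_⟩
  rw [pluckerLine_span_range] at hmem ⊢
  obtain ⟨c, rfl⟩ := Submodule.mem_span_singleton.1 hmem
  rw [Projectivization.submodule_mk, Submodule.span_singleton_smul_eq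
    (IsUnit.mk0 c (left_ne_zero_of_smul hw0))]

lemma exists_submodule_of_ιMulti_mul_ne_zero {r m k : ℕ} (hk : k = r + m) {e : Fin r → V}
    {b : ExteriorAlgebra ℂ V} (hb : b ∈ decomposables ℂ m V) (h0 : ιMulti ℂ r e * b ≠ 0) :
    ∃ F : Submodule ℂ V, finrank ℂ F = k ∧ Submodule.span ℂ (range e) ≤ F ∧
      ∃ x ∈ pluckerLine k F, (x : ExteriorAlgebra ℂ V) = ιMulti ℂ r e * b := by
  subst hk
  obtain ⟨c, v, rfl⟩ := hb
  have heq : ιMulti ℂ r e * c • ιMulti ℂ m v = c • ιMulti ℂ (r + m) (Fin.append e v) := by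
    rw [mul_smul_comm, ExteriorAlgebra.ιMulti_mul_ιMulti]
  rw [heq] at h0 ⊢
  let x := c • exteriorPower.ιMulti ℂ (r + m) (Fin.append e v)
  obtain ⟨hfr, hmem⟩ := exists_mem_pluckerLine (w := x) (fun h => h0 (congrArg Subtype.val h)) rfl
  refine ⟨_, hfr, Submodule.span_mono ?_, x, hmem, rfl⟩
  rintro _ ⟨i, rfl⟩
  exact ⟨Fin.castAdd m i, Fin.append_left e v i⟩

variable [FiniteDimensional ℂ V]

lemma mem_grassmannian_iff {k : ℕ} {p : ℙ ℂ (⋀[ℂ]^k V)} :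
    p ∈ grassmannian V k ↔ (p.rep : ExteriorAlgebra ℂ V) ∈ decomposables ℂ k V := by
  constructor
  · rintro ⟨E, hE, hp⟩
    exact coe_mem_decomposables hE (hp ▸ rep_mem_submodule p)
  · intro hp
    exact p.mk_rep ▸ mk_mem_grassmannian p.rep_nonzero hp

/-- Zero summands of a sum of decomposables are allowed: they lie on the line of any point. -/
lemma exists_submodule_le_iSup_iff {s k : ℕ} {p : ℙ ℂ (⋀[ℂ]^k V)} :
    (∃ x : Fin s → ℙ ℂ (⋀[ℂ]^k V), (∀ i, x i ∈ grassmannian V k) ∧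
      p.submodule ≤ ⨆ i, (x i).submodule) ↔
      (p.rep : ExteriorAlgebra ℂ V) ∈ secantCone ℂ s k V := by
  simp only [submodule_le_iff, mem_iSup_iff_exists_sum]
  constructor
  · rintro ⟨x, hx, a, ha, hp⟩
    refine ⟨fun i => a i, fun i => ?_, by rw [hp, Submodule.coe_sum]⟩
    obtain ⟨E, hE, hxE⟩ := hx i
    exact coe_mem_decomposables hE (hxE ▸ ha i)
  · rintro ⟨a, ha, hp⟩
    lift a to Fin s → ⋀[ℂ]^k V using fun i => decomposables_subset_exteriorPower k (ha i)
    replace hp : p.rep = ∑ i, a i := Subtype.ext (by rw [hp, Submodule.coe_sum])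
    obtain ⟨j, hj⟩ := exists_ne_zero_of_eq_sum p.rep_nonzero hp
    have hline : ∀ i, ∃ y ∈ grassmannian V k, a i ∈ y.submodule := by
      intro i
      by_cases hi : a i = 0
      · exact ⟨_, mk_mem_grassmannian hj (ha j), hi ▸ Submodule.zero_mem _⟩
      · exact ⟨_, mk_mem_grassmannian hi (ha i), mem_submodule_mk hi⟩
    choose x hx hax using hline
    exact ⟨x, hx, a, hax, hp⟩

lemma exists_eq_ιMulti_mul_of_mem_pluckerLine {r m k : ℕ} (hk : k = r + m) {e : Fin r → V}
    (he : LinearIndependent ℂ e) {E : Submodule ℂ V} (hE : finrank ℂ E = k) (heE : ∀ i, e i ∈ E)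
    {w : ⋀[ℂ]^k V} (hw : w ∈ pluckerLine k E) :
    ∃ b ∈ decomposables ℂ m V, (w : ExteriorAlgebra ℂ V) = ιMulti ℂ r e * b := by
  obtain ⟨φ, hφ⟩ := exists_dual_family he
  refine ⟨_, contractMulti_mem_decomposables hk φ (coe_mem_decomposables hE hw),
    eq_ιMulti_mul_contractMulti hφ fun i => ?_⟩
  obtain ⟨u, -, rfl⟩ := exists_linearIndependent_span_range_eq hE
  rw [pluckerLine_span_range] at hw
  obtain ⟨c, rfl⟩ := Submodule.mem_span_singleton.1 hw
  rw [Submodule.coe_smul, mul_smul_comm, exteriorPower.ιMulti_apply_coe,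
    ι_mul_ιMulti_eq_zero (heE i), smul_zero]

lemma exists_submodule_le_iSup_pluckerLine_iff {s r m k : ℕ} (hk : k = r + m)
    {p : ℙ ℂ (⋀[ℂ]^k V)} :
    (∃ E : Fin s → Submodule ℂ V, (∀ i, finrank ℂ (E i) = k) ∧
      r ≤ finrank ℂ (⨅ i, E i : Submodule ℂ V) ∧ p.submodule ≤ ⨆ i, pluckerLine k (E i)) ↔
      (p.rep : ExteriorAlgebra ℂ V) ∈ restrictedCone ℂ s r m V := by
  simp only [submodule_le_iff, mem_iSup_iff_exists_sum]
  constructor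
  · rintro ⟨E, hE, hr, a, ha, hp⟩
    obtain ⟨e, he, heE⟩ := exists_linearIndependent_mem hr
    choose b hb hab using fun i => exists_eq_ιMulti_mul_of_mem_pluckerLine hk he (hE i)
      (fun j => iInf_le E i (heE j)) (ha i)
    refine ⟨e, ∑ i, b i, ⟨b, hb, rfl⟩, ?_⟩
    simp only [hp, Submodule.coe_sum, Finset.mul_sum, hab]
  · rintro ⟨e, _, ⟨a, ha, rfl⟩, hp⟩
    rw [Finset.mul_sum] at hp
    have hp0 : (p.rep : ExteriorAlgebra ℂ V) ≠ 0 := fun h => p.rep_nonzero (Subtype.ext h)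
    obtain ⟨j, hj⟩ := exists_ne_zero_of_eq_sum hp0 hp
    have hplane : ∀ i, ∃ F : Submodule ℂ V, finrank ℂ F = k ∧ Submodule.span ℂ (range e) ≤ F ∧
        ∃ x ∈ pluckerLine k F, (x : ExteriorAlgebra ℂ V) = ιMulti ℂ r e * a i := by
      intro i
      by_cases hi : ιMulti ℂ r e * a i = 0
      · obtain ⟨F, hF, heF, -⟩ := exists_submodule_of_ιMulti_mul_ne_zero hk (ha j) hj
        exact ⟨F, hF, heF, 0, Submodule.zero_mem _, hi.symm⟩
      · exact exists_submodule_of_ιMulti_mul_ne_zero hk (ha i) hi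
    choose F hF heF x hx hxa using hplane
    have he : LinearIndependent ℂ e := ιMulti_ne_zero_iff.1 (left_ne_zero_of_mul hj)
    refine ⟨F, hF, ?_, x, hx, Subtype.ext ?_⟩
    · have hle := Submodule.finrank_mono (le_iInf heF)
      rwa [finrank_span_eq_card he, Fintype.card_fin] at hle
    · simp only [hp, Submodule.coe_sum, hxa]

end Grassmannian

section ZariskiClosure

variable {W : Type*} [AddCommGroup W] [Module ℂ W] {W' : Type*} [AddCommGroup W'] [Module ℂ W']

lemma IsForm.rep_mk_eq_zero_iff {d : ℕ} {f : W → ℂ} (hf : IsForm d f) {w : W} (hw : w ≠ 0) :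
    f (Projectivization.mk ℂ w hw).rep = 0 ↔ f w = 0 := by
  obtain ⟨a, ha⟩ := Projectivization.exists_smul_eq_mk_rep ℂ w hw
  rw [← ha, Units.smul_def, hf.2, mul_eq_zero_iff_left (pow_ne_zero d a.ne_zero)]

lemma mem_closure_iff_isForm {X : Set (ℙ ℂ W)} {p : ℙ ℂ W} :
    p ∈ closure X ↔ ∀ d f, IsForm d f → (∀ x ∈ X, f x.rep = 0) → f p.rep = 0 := by
  constructor
  · intro hp d f hf hX
    have hclosed : IsClosed (zeroLocus ({f} : Set (W → ℂ))) :=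
      (isClosed_iff_isAlgebraicSet _).2 ⟨{f}, by rintro g rfl; exact ⟨d, hf⟩, rfl⟩
    have hsub : X ⊆ zeroLocus ({f} : Set (W → ℂ)) := by
      rintro x hx g rfl
      exact (hf.vanish_iff x).2 (hX x hx)
    exact (hf.vanish_iff p).1 (closure_minimal hsub hclosed hp f rfl)
  · intro h
    obtain ⟨F, hF, hcl⟩ := (isClosed_iff_isAlgebraicSet _).1 (isClosed_closure (s := X))
    rw [hcl]
    intro f hf
    obtain ⟨d, hd⟩ := hF f hf
    rw [hd.vanish_iff]
    exact h d f hd fun x hx => (hd.vanish_iff x).1 ((hcl.le (subset_closure hx)) f hf)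

lemma isForm_dual (φ : Dual ℂ W) : IsForm 1 (φ : W → ℂ) :=
  ⟨Algebra.subset_adjoin (mem_range_self φ), fun c w => by simp⟩

lemma IsForm.comp_linearMap {d : ℕ} {f : W' → ℂ} (hf : IsForm d f) (L : W →ₗ[ℂ] W') :
    IsForm d (f ∘ L) := by
  refine ⟨?_, fun c w => by simp [hf.2]⟩
  have hmem := hf.1
  clear hf
  induction hmem using Algebra.adjoin_induction with
  | mem x hx =>
    obtain ⟨φ, rfl⟩ := hx
    exact Algebra.subset_adjoin ⟨φ ∘ₗ L, rfl⟩
  | algebraMap r => exact Subalgebra.algebraMap_mem _ r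
  | add x y _ _ hx hy => exact add_mem hx hy
  | mul x y _ _ hx hy => exact mul_mem hx hy

/-- `L` is undefined at the points of its kernel, so the equations of `X'` are multiplied by a
linear form which vanishes on `ker L` but not at `p`. -/
lemma mk_mem_closure_of_linearMap (L : W →ₗ[ℂ] W') {X : Set (ℙ ℂ W)} {X' : Set (ℙ ℂ W')}
    (hX : ∀ x ∈ X, ∀ h : L x.rep ≠ 0, Projectivization.mk ℂ (L x.rep) h ∈ X')
    {p : ℙ ℂ W} (hp : p ∈ closure X) (h : L p.rep ≠ 0) :
    Projectivization.mk ℂ (L p.rep) h ∈ closure X' := by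
  rw [mem_closure_iff_isForm] at hp ⊢
  intro d f hf hfX
  rw [hf.rep_mk_eq_zero_iff h]
  obtain ⟨ℓ, hℓ⟩ := Projective.exists_dual_ne_zero ℂ h
  refine (mul_eq_zero.1 (hp _ _ ((hf.mul (isForm_dual ℓ)).comp_linearMap L)
    fun x hx => ?_)).resolve_right hℓ
  change f (L x.rep) * ℓ (L x.rep) = 0
  by_cases hLx : L x.rep = 0
  · rw [hLx, map_zero, mul_zero]
  · rw [(hf.rep_mk_eq_zero_iff hLx).1 (hfX _ (hX x hx hLx)), zero_mul]

lemma det_mem {K : Type*} [CommRing K] {M κ : Type*} [Fintype κ] [DecidableEq κ]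
    {B : Subalgebra K (M → K)} {A : M → Matrix κ κ K} (hA : ∀ i j, (fun x => A x i j) ∈ B) :
    (fun x => (A x).det) ∈ B := by
  have hdet : (fun x => (A x).det) = ∑ σ : Equiv.Perm κ,
      ((Equiv.Perm.sign σ : ℤ) : K) • ∏ i, fun x => A x (σ i) i := by
    ext x
    simp [Matrix.det_apply, Finset.sum_apply, Finset.prod_apply, Units.smul_def]
  rw [hdet]
  exact B.sum_mem fun σ _ => B.smul_mem (B.prod_mem fun i _ => hA _ _) _

lemma isForm_det {κ : Type*} [Fintype κ] [DecidableEq κ] (T : κ → κ → Dual ℂ W) :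
    IsForm (Fintype.card κ) fun w => (Matrix.of fun i j => T i j w).det := by
  constructor
  · exact det_mem fun i j => Algebra.subset_adjoin (mem_range_self (T i j))
  · intro c w
    have hsmul : (Matrix.of fun i j => T i j (c • w)) = c • Matrix.of fun i j => T i j w := by
      ext i j
      simp
    change (Matrix.of fun i j => T i j (c • w)).det = _
    rw [hsmul, Matrix.det_smul]

end ZariskiClosure

section LinearAlgebra

variable {K : Type*} [Field K] {V : Type*} [AddCommGroup V] [Module K V]
  {W : Type*} [AddCommGroup W] [Module K W]

lemma linearIndependent_iff_exists_det_ne_zero {κ : Type*} [Fintype κ] [DecidableEq κ]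
    {x : κ → W} :
    LinearIndependent K x ↔
      ∃ ℓ : κ → Dual K W, (Matrix.of fun i j => ℓ i (x j)).det ≠ 0 := by
  constructor
  · intro h
    obtain ⟨ℓ, hℓ⟩ := exists_dual_family h
    have hone : (Matrix.of fun i j => ℓ i (x j)) = (1 : Matrix κ κ K) := by
      ext i j
      simp [hℓ, Matrix.one_apply]
    exact ⟨ℓ, by simp [hone]⟩
  · rintro ⟨ℓ, hℓ⟩
    rw [Fintype.linearIndependent_iff]
    intro g hg
    have hmul : (Matrix.of fun i j => ℓ i (x j)).mulVec g = 0 := by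
      ext i
      simpa [Matrix.mulVec, dotProduct, mul_comm] using congrArg (ℓ i) hg
    exact congrFun (Matrix.eq_zero_of_mulVec_eq_zero hℓ hmul)

lemma le_finrank_ker_iff [FiniteDimensional K V] (T : V →ₗ[K] W) (s : ℕ) :
    s ≤ finrank K (LinearMap.ker T) ↔
      ∀ v : Fin (finrank K V + 1 - s) → V, ¬ LinearIndependent K (T ∘ v) := by
  have hrank := LinearMap.finrank_range_add_finrank_ker T
  constructor
  · intro hs v hv
    have hrange : LinearIndependent K fun i => T.rangeRestrict (v i) :=
      LinearIndependent.of_comp (LinearMap.range T).subtype hv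
    have hcard := hrange.fintype_card_le_finrank
    rw [Fintype.card_fin] at hcard
    omega
  · intro h
    by_contra! hs
    obtain ⟨x, hx, hxT⟩ := exists_linearIndependent_mem (S := LinearMap.range T)
      (r := finrank K V + 1 - s) (by omega)
    choose v hv using hxT
    exact h v ((funext hv : T ∘ v = x) ▸ hx)

end LinearAlgebra

section Annihilator

variable {K : Type*} [Field K] {V : Type*} [AddCommGroup V] [Module K V]

/-- The space of vectors `v` with `v ∧ w = 0`, which recovers `E` from a general product `Ê ∧ t`. -/
def annihilator (w : ExteriorAlgebra K V) : Submodule K V :=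
  LinearMap.ker (LinearMap.mulRight K w ∘ₗ ι K)

lemma mem_annihilator {w : ExteriorAlgebra K V} {v : V} :
    v ∈ annihilator w ↔ ι K v * w = 0 := Iff.rfl

lemma annihilator_smul {c : K} (hc : c ≠ 0) (w : ExteriorAlgebra K V) :
    annihilator (c • w) = annihilator w := by
  ext v
  rw [mem_annihilator, mem_annihilator, mul_smul_comm, smul_eq_zero_iff_right hc]

lemma annihilator_rep_mk {k : ℕ} {w : ⋀[K]^k V} (hw : w ≠ 0) :
    annihilator ((Projectivization.mk K w hw).rep : ExteriorAlgebra K V) =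
      annihilator (w : ExteriorAlgebra K V) := by
  obtain ⟨a, ha⟩ := Projectivization.exists_smul_eq_mk_rep K w hw
  rw [← ha]
  exact annihilator_smul a.ne_zero _

lemma span_range_le_annihilator {r : ℕ} (e : Fin r → V) (x : ExteriorAlgebra K V) :
    Submodule.span K (range e) ≤ annihilator (ιMulti K r e * x) := fun v hv => by
  rw [mem_annihilator, ← mul_assoc, ι_mul_ιMulti_eq_zero hv, zero_mul]

lemma le_finrank_annihilator [FiniteDimensional K V] {s r m : ℕ} {w : ExteriorAlgebra K V}
    (hw : w ∈ restrictedCone K s r m V) (hw0 : w ≠ 0) : r ≤ finrank K (annihilator w) := by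
  obtain ⟨e, t, -, rfl⟩ := hw
  have he : LinearIndependent K e := ιMulti_ne_zero_iff.1 (left_ne_zero_of_mul hw0)
  have hle := Submodule.finrank_mono (span_range_le_annihilator e t)
  rwa [finrank_span_eq_card he, Fintype.card_fin] at hle

lemma isClosed_setOf_le_finrank_annihilator {V : Type*} [AddCommGroup V] [Module ℂ V]
    [FiniteDimensional ℂ V] (k s : ℕ) :
    IsClosed {p : ℙ ℂ (⋀[ℂ]^k V) |
      s ≤ finrank ℂ (annihilator (p.rep : ExteriorAlgebra ℂ V))} := by
  rw [isClosed_iff_isAlgebraicSet]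
  let N := finrank ℂ V + 1 - s
  let T (v : Fin N → V) (ℓ : Fin N → Dual ℂ (ExteriorAlgebra ℂ V)) (i j : Fin N) :
      Dual ℂ (⋀[ℂ]^k V) :=
    ℓ i ∘ₗ LinearMap.mulLeft ℂ (ι ℂ (v j)) ∘ₗ (⋀[ℂ]^k V).subtype
  refine ⟨{f | ∃ v ℓ, f = fun w => (Matrix.of fun i j => T v ℓ i j w).det}, ?_, ?_⟩
  · rintro f ⟨v, ℓ, rfl⟩
    exact ⟨_, isForm_det _⟩
  · ext p
    rw [mem_ofPred_eq, annihilator, le_finrank_ker_iff]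
    constructor
    · rintro h f ⟨v, ℓ, rfl⟩
      rw [(isForm_det _).vanish_iff]
      by_contra hdet
      exact h v (linearIndependent_iff_exists_det_ne_zero.2 ⟨ℓ, hdet⟩)
    · intro h v hv
      obtain ⟨ℓ, hℓ⟩ := linearIndependent_iff_exists_det_ne_zero.1 hv
      exact hℓ (h _ ⟨v, ℓ, rfl⟩ p.rep (rep_mem_submodule p))

end Annihilator

section WedgeMaps

variable {R : Type*} [CommRing R] {M : Type*} [AddCommGroup M] [Module R M]
  {N : Type*} [AddCommGroup N] [Module R N] {r m k : ℕ}

lemma coe_exteriorPower_map (f : M →ₗ[R] N) (t : ⋀[R]^m M) :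
    (exteriorPower.map m f t : ExteriorAlgebra R N) = ExteriorAlgebra.map f t := by
  have h : (⋀[R]^m N).subtype ∘ₗ exteriorPower.map m f =
      (ExteriorAlgebra.map f).toLinearMap ∘ₗ (⋀[R]^m M).subtype := by
    apply exteriorPower.linearMap_ext
    ext v
    simp
  exact LinearMap.congr_fun h t

lemma map_mem_exteriorPower (f : M →ₗ[R] N) {x : ExteriorAlgebra R M} (hx : x ∈ ⋀[R]^m M) :
    ExteriorAlgebra.map f x ∈ ⋀[R]^m N := by
  rw [← coe_exteriorPower_map f ⟨x, hx⟩]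
  exact Subtype.property _

/-- The linear map `t ↦ e₁ ∧ ⋯ ∧ eᵣ ∧ (⋀ᵐσ)(t)`: when `σ` is a section of `V → V/E` and `e` a basis
of `E`, it realises `t ↦ Ê ∧ t` on `⋀ᵐ(V/E)`. -/
def wedgeMap (hk : k = r + m) (e : Fin r → M) (σ : N →ₗ[R] M) : ⋀[R]^m N →ₗ[R] ⋀[R]^k M :=
  (LinearMap.mulLeft R (ιMulti R r e) ∘ₗ (ExteriorAlgebra.map σ).toLinearMap).restrict
    fun _ hx => ιMulti_mul_mem_exteriorPower hk e (map_mem_exteriorPower σ hx)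

lemma coe_wedgeMap (hk : k = r + m) (e : Fin r → M) (σ : N →ₗ[R] M) (t : ⋀[R]^m N) :
    (wedgeMap hk e σ t : ExteriorAlgebra R M) = ιMulti R r e * ExteriorAlgebra.map σ t := rfl

/-- The linear map `w ↦ (⋀ᵐf)(φᵣ ⌋ ⋯ φ₁ ⌋ w)`, a left inverse of `wedgeMap` for suitable `φ` and
`f`. -/
def contractMap (hk : k = r + m) (φ : Fin r → Dual R M) (f : M →ₗ[R] N) :
    ⋀[R]^k M →ₗ[R] ⋀[R]^m N :=
  ((ExteriorAlgebra.map f).toLinearMap ∘ₗ contractMulti r φ).restrict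
    fun _ hx => map_mem_exteriorPower f (contractMulti_mem_exteriorPower hk φ hx)

lemma coe_contractMap (hk : k = r + m) (φ : Fin r → Dual R M) (f : M →ₗ[R] N) (w : ⋀[R]^k M) :
    (contractMap hk φ f w : ExteriorAlgebra R N) =
      ExteriorAlgebra.map f (contractMulti r φ w) := rfl

end WedgeMaps

section QuotientSections

variable {K : Type*} [Field K] {V : Type*} [AddCommGroup V] [Module K V] {r m k : ℕ}

lemma exists_mkQ_section (E : Submodule K V) :
    ∃ σ : (V ⧸ E) →ₗ[K] V, E.mkQ ∘ₗ σ = LinearMap.id :=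
  E.mkQ.exists_rightInverse_of_surjective (Submodule.range_mkQ E)

lemma section_mkQ_sub_mem {E : Submodule K V} {σ : (V ⧸ E) →ₗ[K] V}
    (hσ : E.mkQ ∘ₗ σ = LinearMap.id) (v : V) : (σ ∘ₗ E.mkQ) v - v ∈ E := by
  rw [← Submodule.Quotient.mk_eq_zero, ← Submodule.mkQ_apply, map_sub, LinearMap.comp_apply,
    ← LinearMap.comp_apply E.mkQ, hσ, LinearMap.id_apply, sub_self]

variable {e : Fin r → V} {σ : (V ⧸ Submodule.span K (range e)) →ₗ[K] V}

lemma ιMulti_mul_map_section (hσ : (Submodule.span K (range e)).mkQ ∘ₗ σ = LinearMap.id)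
    (x : ExteriorAlgebra K V) :
    ιMulti K r e * ExteriorAlgebra.map σ
      (ExteriorAlgebra.map (Submodule.span K (range e)).mkQ x) = ιMulti K r e * x := by
  rw [← AlgHom.comp_apply, ExteriorAlgebra.map_comp_map]
  exact ιMulti_mul_map (section_mkQ_sub_mem hσ) x

lemma map_mkQ_contractMulti_ιMulti_mul_map {φ : Fin r → Dual K V}
    (hφ : ∀ i j, φ i (e j) = if i = j then 1 else 0)
    (hσ : (Submodule.span K (range e)).mkQ ∘ₗ σ = LinearMap.id)
    (x : ExteriorAlgebra K (V ⧸ Submodule.span K (range e))) :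
    ExteriorAlgebra.map (Submodule.span K (range e)).mkQ
      (contractMulti r φ (ιMulti K r e * ExteriorAlgebra.map σ x)) = x := by
  have he : ∀ i, (Submodule.span K (range e)).mkQ (e i) = 0 := fun i =>
    (Submodule.Quotient.mk_eq_zero _).2 (Submodule.subset_span (mem_range_self i))
  rw [map_contractMulti_ιMulti_mul hφ he, ← AlgHom.comp_apply, ExteriorAlgebra.map_comp_map, hσ,
    ExteriorAlgebra.map_id, AlgHom.id_apply]

lemma wedgeMap_injective (hk : k = r + m) (he : LinearIndependent K e)
    (hσ : (Submodule.span K (range e)).mkQ ∘ₗ σ = LinearMap.id) :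
    Function.Injective (wedgeMap (m := m) hk e σ) := by
  obtain ⟨φ, hφ⟩ := exists_dual_family he
  exact Function.LeftInverse.injective (g := contractMap hk φ (Submodule.span K (range e)).mkQ)
    fun t => Subtype.ext (map_mkQ_contractMulti_ιMulti_mul_map hφ hσ _)

end QuotientSections

section Incidence

variable {V : Type*} [AddCommGroup V] [Module ℂ V] {s r m k : ℕ}

lemma isWedge_iff (hk : k = r + m) {e : Fin r → V} (he : LinearIndependent ℂ e)
    {σ : (V ⧸ Submodule.span ℂ (range e)) →ₗ[ℂ] V}
    (hσ : (Submodule.span ℂ (range e)).mkQ ∘ₗ σ = LinearMap.id)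
    {q : ℙ ℂ (⋀[ℂ]^m (V ⧸ Submodule.span ℂ (range e)))} {p : ℙ ℂ (⋀[ℂ]^k V)} :
    IsWedge r (Submodule.span ℂ (range e)) q p ↔
      p = Projectivization.map (wedgeMap hk e σ) (wedgeMap_injective hk he hσ) q := by
  constructor
  · rintro ⟨e', he', t, ht, w, hw, hw0, hwe⟩
    rw [pluckerLine_span_range] at he'
    obtain ⟨c, rfl⟩ := Submodule.mem_span_singleton.1 he'
    have hw_eq : w = c • wedgeMap hk e σ
        (exteriorPower.map m (Submodule.span ℂ (range e)).mkQ t) := by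
      apply Subtype.ext
      rw [hwe, Submodule.coe_smul, Submodule.coe_smul, coe_wedgeMap, coe_exteriorPower_map,
        ιMulti_mul_map_section hσ, smul_mul_assoc]
      rfl
    have ht0 : exteriorPower.map m (Submodule.span ℂ (range e)).mkQ t ≠ 0 := by
      intro h
      rw [hw_eq, h, map_zero, smul_zero] at hw0
      exact hw0 rfl
    rw [eq_mk_of_mem_submodule hw hw0, eq_mk_of_mem_submodule ht ht0, Projectivization.map_mk,
      Projectivization.mk_eq_mk_iff']
    exact ⟨c, hw_eq.symm⟩
  · rintro rfl
    have hq0 : wedgeMap hk e σ q.rep ≠ 0 :=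
      (map_ne_zero_iff _ (wedgeMap_injective hk he hσ)).2 q.rep_nonzero
    refine ⟨_, ιMulti_mem_pluckerLine fun i => Submodule.subset_span (mem_range_self i),
      exteriorPower.map m σ q.rep, ?_, wedgeMap hk e σ q.rep, ?_, hq0, ?_⟩
    · rw [← LinearMap.comp_apply, ← exteriorPower.map_comp, hσ, exteriorPower.map_id]
      exact rep_mem_submodule q
    · have hmap : Projectivization.map _ (wedgeMap_injective hk he hσ) q =
          Projectivization.mk ℂ _ hq0 := by
        conv_lhs => rw [← q.mk_rep, Projectivization.map_mk]
      rw [hmap]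
      exact mem_submodule_mk hq0
    · rw [coe_exteriorPower_map]
      rfl

variable [FiniteDimensional ℂ V]

lemma secantVariety_grassmannian_eq_closure (s k : ℕ) :
    secantVariety s (grassmannian V k) =
      closure {p | (p.rep : ExteriorAlgebra ℂ V) ∈ secantCone ℂ s k V} :=
  congrArg closure (Set.ext fun _ => exists_submodule_le_iSup_iff)

lemma restrictedSecant_eq_closure (hk : k = r + m) :
    restrictedSecant V s r k =
      closure {p | (p.rep : ExteriorAlgebra ℂ V) ∈ restrictedCone ℂ s r m V} :=
  congrArg closure (Set.ext fun _ => exists_submodule_le_iSup_pluckerLine_iff hk)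

lemma le_finrank_annihilator_of_mem_restrictedSecant (hk : k = r + m) {p : ℙ ℂ (⋀[ℂ]^k V)}
    (hp : p ∈ restrictedSecant V s r k) :
    r ≤ finrank ℂ (annihilator (p.rep : ExteriorAlgebra ℂ V)) := by
  rw [restrictedSecant_eq_closure hk] at hp
  refine closure_minimal (fun x hx => ?_) (isClosed_setOf_le_finrank_annihilator k r) hp
  exact le_finrank_annihilator hx fun h => x.rep_nonzero (Subtype.ext h)

lemma mem_restrictedSecant_of_isWedge (hk : k = r + m) {E : Submodule ℂ V}
    (hE : finrank ℂ E = r) {q : ℙ ℂ (⋀[ℂ]^m (V ⧸ E))}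
    (hq : q ∈ secantVariety s (grassmannian (V ⧸ E) m)) {p : ℙ ℂ (⋀[ℂ]^k V)}
    (hp : IsWedge r E q p) : p ∈ restrictedSecant V s r k := by
  obtain ⟨e, he, rfl⟩ := exists_linearIndependent_span_range_eq hE
  obtain ⟨σ, hσ⟩ := exists_mkQ_section (Submodule.span ℂ (range e))
  rw [isWedge_iff hk he hσ, ← q.mk_rep, Projectivization.map_mk] at hp
  rw [secantVariety_grassmannian_eq_closure] at hq
  rw [hp, restrictedSecant_eq_closure hk]
  refine mk_mem_closure_of_linearMap _ (fun x hx h => ?_) hq _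
  exact rep_mk_mem (S := Subtype.val ⁻¹' _) (fun c _ => smul_mem_restrictedCone c) h
    ⟨e, _, map_mem_secantCone σ hx, rfl⟩

/-- `E` is spanned by `r` independent vectors annihilating `p`, and `q` is a contraction of `p`. -/
lemma exists_isWedge_of_mem_restrictedSecant (hk : k = r + m) {p : ℙ ℂ (⋀[ℂ]^k V)}
    (hp : p ∈ restrictedSecant V s r k) :
    ∃ (E : Submodule ℂ V) (q : ℙ ℂ (⋀[ℂ]^m (V ⧸ E))), finrank ℂ E = r ∧
      q ∈ secantVariety s (grassmannian (V ⧸ E) m) ∧ IsWedge r E q p := by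
  obtain ⟨e, he, hann⟩ :=
    exists_linearIndependent_mem (le_finrank_annihilator_of_mem_restrictedSecant hk hp)
  obtain ⟨φ, hφ⟩ := exists_dual_family he
  obtain ⟨σ, hσ⟩ := exists_mkQ_section (Submodule.span ℂ (range e))
  let L := contractMap (m := m) hk φ (Submodule.span ℂ (range e)).mkQ
  have hback : wedgeMap hk e σ (L p.rep) = p.rep := by
    apply Subtype.ext
    rw [coe_wedgeMap, coe_contractMap, ιMulti_mul_map_section hσ,
      ← eq_ιMulti_mul_contractMulti hφ hann]
  have hL : L p.rep ≠ 0 := fun h => p.rep_nonzero (by rw [← hback, h, map_zero])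
  refine ⟨_, Projectivization.mk ℂ _ hL, ?_, ?_, ?_⟩
  · rw [finrank_span_eq_card he, Fintype.card_fin]
  · rw [restrictedSecant_eq_closure hk] at hp
    rw [secantVariety_grassmannian_eq_closure]
    refine mk_mem_closure_of_linearMap L (fun x hx h => ?_) hp hL
    exact rep_mk_mem (S := Subtype.val ⁻¹' _) (fun c _ => smul_mem_secantCone c) h
      (map_mem_secantCone _ (contractMulti_mem_secantCone hk φ
        (restrictedCone_subset_secantCone hk hx)))
  · rw [isWedge_iff hk he hσ, Projectivization.map_mk]
    exact eq_mk_of_mem_submodule (by rw [hback]; exact rep_mem_submodule p) _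

theorem image_incidenceVariety (s : ℕ) (hr : r ≤ k) :
    Prod.snd '' incidenceVariety V s r k = restrictedSecant V s r k := by
  have hk : k = r + (k - r) := by omega
  ext p
  constructor
  · rintro ⟨⟨⟨E, q⟩, p⟩, ⟨hE, hq, hp⟩, rfl⟩
    exact mem_restrictedSecant_of_isWedge hk hE hq hp
  · intro hp
    obtain ⟨E, q, hE, hq, hp⟩ := exists_isWedge_of_mem_restrictedSecant hk hp
    exact ⟨⟨⟨E, q⟩, p⟩, ⟨hE, hq, hp⟩, rfl⟩

theorem restrictedSecant_overlap {n : ℕ} (hn : finrank ℂ V = n) (r k : ℕ) :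
    restrictedSecant V 2 (overlap r k n) k = restrictedSecant V 2 r k := by
  refine congrArg closure (Set.ext fun p => exists_congr fun E => and_congr_right fun hE =>
    and_congr_left fun _ => ?_)
  have hinf : (⨅ i, E i) = E 0 ⊓ E 1 := by
    refine le_antisymm (le_inf (iInf_le _ _) (iInf_le _ _)) (le_iInf fun i => ?_)
    fin_cases i
    exacts [inf_le_left, inf_le_right]
  have hsum := Submodule.finrank_sup_add_finrank_inf_eq (E 0) (E 1)
  have hsup := Submodule.finrank_le (E 0 ⊔ E 1)
  rw [hE, hE] at hsum
  rw [hinf, overlap]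
  omega

end Incidence

section CoordinateAlgebras

variable {K : Type*} [Field K] {W : Type*} [AddCommGroup W] [Module K W]
  {W' : Type*} [AddCommGroup W'] [Module K W'] {M N : Type*}

variable (K W) in
/-- The algebra of polynomial functions on a vector space. -/
def polyFun : Subalgebra K (W → K) :=
  Algebra.adjoin K (range fun φ : Dual K W => (φ : W → K))

variable (K) in
/-- The algebra of functions generated by the coordinates of a map `φ` into a vector space, that is,
of the pullbacks `f ∘ φ` of the polynomial functions `f`. -/
def coordAlg (φ : M → W) : Subalgebra K (M → K) :=
  Algebra.adjoin K (range fun (ℓ : Dual K W) (x : M) => ℓ (φ x))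

/-- The coordinates of `φ` belong to the algebra of functions `B`; for `B = polyFun K M` this says
that `φ` is a polynomial map. -/
def HasCoordsIn (B : Subalgebra K (M → K)) (φ : M → W) : Prop :=
  ∀ ℓ : Dual K W, (fun x => ℓ (φ x)) ∈ B

lemma hasCoordsIn_coordAlg (φ : M → W) : HasCoordsIn (coordAlg K φ) φ :=
  fun ℓ => Algebra.subset_adjoin (mem_range_self ℓ)

lemma hasCoordsIn_polyFun_linearMap (L : W →ₗ[K] W') : HasCoordsIn (polyFun K W) L :=
  fun ℓ => Algebra.subset_adjoin (mem_range_self (ℓ ∘ₗ L))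

namespace HasCoordsIn

variable {B : Subalgebra K (M → K)} {φ ψ : M → W}

lemma const (w : W) : HasCoordsIn B fun _ => w := fun ℓ => B.algebraMap_mem (ℓ w)

lemma add (hφ : HasCoordsIn B φ) (hψ : HasCoordsIn B ψ) : HasCoordsIn B fun x => φ x + ψ x :=
  fun ℓ => by
    simp only [map_add]
    exact B.add_mem (hφ ℓ) (hψ ℓ)

lemma sub (hφ : HasCoordsIn B φ) (hψ : HasCoordsIn B ψ) : HasCoordsIn B fun x => φ x - ψ x :=
  fun ℓ => by
    simp only [map_sub]
    exact B.sub_mem (hφ ℓ) (hψ ℓ)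

lemma sum {κ : Type*} (s : Finset κ) {φ : κ → M → W} (hφ : ∀ i ∈ s, HasCoordsIn B (φ i)) :
    HasCoordsIn B fun x => ∑ i ∈ s, φ i x := fun ℓ => by
  simp only [map_sum]
  rw [← Finset.sum_fn]
  exact B.sum_mem fun i hi => hφ i hi ℓ

lemma smul {f : M → K} (hf : f ∈ B) (hφ : HasCoordsIn B φ) : HasCoordsIn B fun x => f x • φ x :=
  fun ℓ => by
    simp only [map_smul, smul_eq_mul]
    exact B.mul_mem hf (hφ ℓ)

lemma linearMap (hφ : HasCoordsIn B φ) (L : W →ₗ[K] W') : HasCoordsIn B fun x => L (φ x) :=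
  fun ℓ => hφ (ℓ ∘ₗ L)

lemma linearMap_apply [FiniteDimensional K W] {T : M → W →ₗ[K] W'}
    (hT : ∀ w, HasCoordsIn B fun x => T x w) (hφ : HasCoordsIn B φ) :
    HasCoordsIn B fun x => T x (φ x) := by
  have hexpand : (fun x => T x (φ x)) =
      fun x => ∑ i, (finBasis K W).coord i (φ x) • T x (finBasis K W i) := by
    ext x
    conv_lhs => rw [← (finBasis K W).sum_repr (φ x)]
    simp only [map_sum, map_smul, Basis.coord_apply]
  rw [hexpand]
  exact sum _ fun i _ => smul (hφ _) (hT _)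

lemma comp_mem (hφ : HasCoordsIn B φ) {f : W → K} (hf : f ∈ polyFun K W) :
    (fun x => f (φ x)) ∈ B := by
  induction hf using Algebra.adjoin_induction with
  | mem _ hf => obtain ⟨ℓ, rfl⟩ := hf; exact hφ ℓ
  | algebraMap a => exact B.algebraMap_mem a
  | add _ _ _ _ hf hg => exact B.add_mem hf hg
  | mul _ _ _ _ hf hg => exact B.mul_mem hf hg

lemma coordAlg_le (hφ : HasCoordsIn B φ) : coordAlg K φ ≤ B :=
  Algebra.adjoin_le (range_subset_iff.2 hφ)

lemma comp {C : Subalgebra K (N → K)} {θ : N → M} (hθ : ∀ f ∈ B, f ∘ θ ∈ C)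
    (hφ : HasCoordsIn B φ) : HasCoordsIn C fun y => φ (θ y) :=
  fun ℓ => hθ _ (hφ ℓ)

lemma of_coe {S : Submodule K W} {φ : M → S} (hφ : HasCoordsIn B fun x => (φ x : W)) :
    HasCoordsIn B φ := fun ℓ => by
  obtain ⟨ℓ', rfl⟩ := ℓ.exists_extend
  exact hφ ℓ'

lemma ιMulti {V : Type*} [AddCommGroup V] [Module K V] [FiniteDimensional K V] {k : ℕ}
    {v : M → Fin k → V} (hv : ∀ i, HasCoordsIn B fun x => v x i) :
    HasCoordsIn B fun x => ExteriorAlgebra.ιMulti K k (v x) := by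
  induction k with
  | zero => simp only [ExteriorAlgebra.ιMulti_zero_apply]; exact const _
  | succ k ih =>
    simp only [ExteriorAlgebra.ιMulti_succ_apply]
    have htail := ih (v := fun x => Matrix.vecTail (v x)) fun i => hv i.succ
    exact linearMap_apply (T := fun x => LinearMap.mulRight K
      (ExteriorAlgebra.ιMulti K k (Matrix.vecTail (v x))) ∘ₗ ExteriorAlgebra.ι K)
      (fun w => htail.linearMap (LinearMap.mulLeft K (ExteriorAlgebra.ι K w))) (hv 0)

end HasCoordsIn

lemma coordAlg_eq_adjoin_basis {κ : Type*} [Finite κ] (b : Basis κ K W) (φ : M → W) :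
    coordAlg K φ = Algebra.adjoin K (range fun (i : κ) (x : M) => b.coord i (φ x)) := by
  have := Fintype.ofFinite κ
  refine le_antisymm (Algebra.adjoin_le ?_)
    (Algebra.adjoin_mono (range_subset_iff.2 fun i => mem_range_self (b.coord i)))
  rintro _ ⟨ℓ, rfl⟩
  have hℓ : (fun x => ℓ (φ x)) = ∑ i, ℓ (b i) • fun x => b.coord i (φ x) := by
    ext x
    conv_lhs => rw [← b.sum_repr (φ x)]
    simp only [map_sum, map_smul, Finset.sum_apply, Pi.smul_apply, smul_eq_mul, Basis.coord_apply,
      mul_comm]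
  change (fun x => ℓ (φ x)) ∈ _
  rw [hℓ]
  exact Subalgebra.sum_mem _ fun i _ =>
    Subalgebra.smul_mem _ (Algebra.subset_adjoin (mem_range_self i)) _

lemma fg_coordAlg [FiniteDimensional K W] (φ : M → W) : (coordAlg K φ).FG := by
  rw [coordAlg_eq_adjoin_basis (finBasis K W)]
  exact Subalgebra.fg_def.2 ⟨_, finite_range _, rfl⟩

lemma trdeg_coordAlg_lt_aleph0 [FiniteDimensional K W] (φ : M → W) :
    Algebra.trdeg K (coordAlg K φ) < Cardinal.aleph0 :=
  have := (coordAlg K φ).fg_iff_finiteType.1 (fg_coordAlg φ)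
  trdeg_lt_aleph0_of_finiteType

end CoordinateAlgebras

section Pullback

universe u

variable {K : Type*} [Field K] {W : Type*} [AddCommGroup W] [Module K W]

/-- The pullback `f ↦ f ∘ φ` of polynomial functions, whose kernel is the ideal of the image of
`φ`. -/
def pullback {M : Type*} (φ : M → W) : polyFun K W →ₐ[K] coordAlg K φ :=
  AlgHom.codRestrict ((AlgHom.pi fun x => Pi.evalAlgHom K _ (φ x)).comp (polyFun K W).val) _
    fun f => (hasCoordsIn_coordAlg φ).comp_mem f.2

lemma coe_pullback {M : Type*} (φ : M → W) (f : polyFun K W) :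
    (pullback φ f : M → K) = fun x => f.1 (φ x) := rfl

lemma pullback_surjective {M : Type*} (φ : M → W) : Function.Surjective (pullback (K := K) φ) := by
  rintro ⟨f, hf⟩
  induction hf using Algebra.adjoin_induction with
  | mem _ hf =>
    obtain ⟨ℓ, rfl⟩ := hf
    exact ⟨⟨ℓ, Algebra.subset_adjoin (mem_range_self ℓ)⟩, rfl⟩
  | algebraMap a => exact ⟨algebraMap K _ a, rfl⟩
  | add f g _ _ hf hg =>
    obtain ⟨a, ha⟩ := hf
    obtain ⟨b, hb⟩ := hg
    exact ⟨a + b, by rw [map_add, ha, hb]; rfl⟩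
  | mul f g _ _ hf hg =>
    obtain ⟨a, ha⟩ := hf
    obtain ⟨b, hb⟩ := hg
    exact ⟨a * b, by rw [map_mul, ha, hb]; rfl⟩

lemma trdeg_coordAlg_congr {M N : Type u} (φ : M → W) (ψ : N → W)
    (h : ∀ f ∈ polyFun K W, (∀ x, f (φ x) = 0) ↔ ∀ y, f (ψ y) = 0) :
    Algebra.trdeg K (coordAlg K φ) = Algebra.trdeg K (coordAlg K ψ) := by
  have hker : RingHom.ker (pullback (K := K) φ) = RingHom.ker (pullback (K := K) ψ) := by
    ext ⟨f, hf⟩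
    simp only [RingHom.mem_ker, Subtype.ext_iff, coe_pullback, funext_iff]
    exact h f hf
  exact (((Ideal.quotientKerAlgEquivOfSurjective (pullback_surjective φ)).symm.trans
    (Ideal.quotientEquivAlgOfEq K hker)).trans
    (Ideal.quotientKerAlgEquivOfSurjective (pullback_surjective ψ))).trdeg_eq

end Pullback

section PolynomialFunctions

variable {K : Type*} [Field K] {W : Type*} [AddCommGroup W] [Module K W]

lemma exists_polynomial_on_line {f : W → K} (hf : f ∈ polyFun K W) (x u : W) :
    ∃ P : Polynomial K, ∀ s : K, f (x + s • u) = P.eval s := by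
  induction hf using Algebra.adjoin_induction with
  | mem g hg =>
    obtain ⟨φ, rfl⟩ := hg
    exact ⟨Polynomial.C (φ x) + Polynomial.X * Polynomial.C (φ u), fun s => by
      simp [mul_comm (φ u)]⟩
  | algebraMap a => exact ⟨Polynomial.C a, fun s => by simp⟩
  | add g h _ _ hg hh =>
    obtain ⟨P, hP⟩ := hg
    obtain ⟨Q, hQ⟩ := hh
    exact ⟨P + Q, fun s => by simp [hP, hQ]⟩
  | mul g h _ _ hg hh =>
    obtain ⟨P, hP⟩ := hg
    obtain ⟨Q, hQ⟩ := hh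
    exact ⟨P * Q, fun s => by simp [hP, hQ]⟩

variable [Infinite K]

lemma eq_zero_of_eq_zero_on_ne_zero {f g : W → K} (hf : f ∈ polyFun K W) (hg : g ∈ polyFun K W)
    (h : ∀ x, g x ≠ 0 → f x = 0) {x₀ : W} (hx₀ : g x₀ ≠ 0) (x : W) : f x = 0 := by
  obtain ⟨P, hP⟩ := exists_polynomial_on_line hf x (x₀ - x)
  obtain ⟨Q, hQ⟩ := exists_polynomial_on_line hg x (x₀ - x)
  have hPQ : P * Q = 0 := by
    refine Polynomial.funext fun s => ?_
    rw [Polynomial.eval_mul, ← hP, ← hQ, Polynomial.eval_zero, mul_eq_zero, or_iff_not_imp_right]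
    exact h _
  have hQ0 : Q ≠ 0 := by
    rintro rfl
    exact hx₀ (by simpa using hQ 1)
  have hP0 := (mul_eq_zero.1 hPQ).resolve_right hQ0
  simpa [hP0] using hP 0

lemma isDomain_of_le_polyFun {B : Subalgebra K (W → K)} (hB : B ≤ polyFun K W) : IsDomain B := by
  have : NoZeroDivisors B := ⟨fun {f g} hfg => or_iff_not_imp_right.2 fun hg => by
    obtain ⟨x₀, hx₀⟩ : ∃ x, g.1 x ≠ 0 := by
      by_contra! h
      exact hg (Subtype.ext (funext h))
    refine Subtype.ext (funext fun x => ?_)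
    refine eq_zero_of_eq_zero_on_ne_zero (hB f.2) (hB g.2) (fun y hy => ?_) hx₀ x
    exact (mul_eq_zero.1 (congrFun (congrArg Subtype.val hfg) y)).resolve_right hy⟩
  exact NoZeroDivisors.to_isDomain B

end PolynomialFunctions

section Forms

universe u

variable {W : Type*} [AddCommGroup W] [Module ℂ W]

lemma isForm_zero (d : ℕ) : IsForm d (0 : W → ℂ) := ⟨zero_mem _, by simp⟩

lemma IsForm.add {d : ℕ} {f g : W → ℂ} (hf : IsForm d f) (hg : IsForm d g) : IsForm d (f + g) :=
  ⟨add_mem hf.1 hg.1, fun c w => by simp only [Pi.add_apply, hf.2, hg.2, mul_add]⟩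

lemma isForm_sum {d : ℕ} {κ : Type*} (s : Finset κ) {f : κ → W → ℂ}
    (hf : ∀ i ∈ s, IsForm d (f i)) : IsForm d (∑ i ∈ s, f i) :=
  Finset.sum_induction _ (IsForm d) (fun _ _ => IsForm.add) (isForm_zero d) hf

lemma exists_homogeneous_components {f : W → ℂ} (hf : f ∈ polyFun ℂ W) :
    ∃ P : Polynomial (W → ℂ), (∀ d, IsForm d (P.coeff d)) ∧ P.eval 1 = f := by
  induction hf using Algebra.adjoin_induction with
  | mem x hx =>
    obtain ⟨φ, rfl⟩ := hx
    refine ⟨Polynomial.monomial 1 (φ : W → ℂ), fun d => ?_, by simp⟩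
    rw [Polynomial.coeff_monomial]
    split_ifs with h
    · exact h ▸ isForm_dual φ
    · exact isForm_zero d
  | algebraMap a =>
    refine ⟨Polynomial.C (algebraMap ℂ (W → ℂ) a), fun d => ?_, by simp⟩
    rw [Polynomial.coeff_C]
    split_ifs with h
    · exact ⟨Subalgebra.algebraMap_mem _ a, by simp [h]⟩
    · exact isForm_zero d
  | add x y _ _ hx hy =>
    obtain ⟨P, hP, rfl⟩ := hx
    obtain ⟨Q, hQ, rfl⟩ := hy
    exact ⟨P + Q, fun d => by rw [Polynomial.coeff_add]; exact (hP d).add (hQ d), by simp⟩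
  | mul x y _ _ hx hy =>
    obtain ⟨P, hP, rfl⟩ := hx
    obtain ⟨Q, hQ, rfl⟩ := hy
    refine ⟨P * Q, fun d => ?_, by simp⟩
    rw [Polynomial.coeff_mul]
    refine isForm_sum _ fun i hi => ?_
    rw [← Finset.HasAntidiagonal.mem_antidiagonal.1 hi]
    exact (hP _).mul (hQ _)

lemma eq_zero_of_forall_isForm {M : Type*} {φ : M → W} (hφ : ∀ (c : ℂ) x, ∃ y, φ y = c • φ x)
    {f : W → ℂ} (hf : f ∈ polyFun ℂ W) (hfφ : ∀ x, f (φ x) = 0) {w : W}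
    (hw : ∀ d g, IsForm d g → (∀ x, g (φ x) = 0) → g w = 0) : f w = 0 := by
  obtain ⟨P, hP, rfl⟩ := exists_homogeneous_components hf
  have heval (v : W) : (P.eval 1) v = P.sum fun _ g => g v := by
    simp [Polynomial.eval_eq_sum, Polynomial.sum, Finset.sum_apply]
  rw [heval]
  refine Finset.sum_eq_zero fun d _ => hw d _ (hP d) fun x => ?_
  -- On the line through `φ x`, the components of `P.eval 1` are the coefficients of a polynomial.
  have hline : P.map (Pi.evalRingHom (fun _ => ℂ) (φ x)) = 0 := by
    refine Polynomial.funext fun c => ?_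
    obtain ⟨y, hy⟩ := hφ c x
    rw [Polynomial.eval_map, Polynomial.eval₂_eq_sum, Polynomial.eval_zero, ← hfφ y, heval, hy]
    refine Finset.sum_congr rfl fun e _ => ?_
    change (P.coeff e) (φ x) * c ^ e = (P.coeff e) (c • φ x)
    rw [(hP e).2, mul_comm]
  simpa only [Pi.evalRingHom_apply, Polynomial.coeff_map, Polynomial.coeff_zero] using
    congrArg (fun Q => Polynomial.coeff Q d) hline

lemma trdeg_coordRing {M W : Type u} [AddCommGroup W] [Module ℂ W] {X : Set (ℙ ℂ W)} {φ : M → W}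
    (hX : ∀ x, φ x ∈ cone X) (hφ : ∀ (c : ℂ) x, ∃ y, φ y = c • φ x)
    (hdense : ∀ d g, IsForm d g → (∀ x, g (φ x) = 0) → ∀ p ∈ X, g p.rep = 0) :
    Algebra.trdeg ℂ (coordRing X) = Algebra.trdeg ℂ (coordAlg ℂ φ) := by
  refine trdeg_coordAlg_congr (Subtype.val : cone X → W) φ fun f hf => ⟨fun h x => ?_, fun h => ?_⟩
  · exact h ⟨φ x, hX x⟩
  · rintro ⟨w, p, hp, hw⟩
    refine eq_zero_of_forall_isForm hφ hf h fun d g hg h0 => ?_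
    exact (hg.vanish_iff p).2 (hdense d g hg h0 p hp) w hw

end Forms

section GeneralSums

variable {K : Type*} [Field K] {V : Type*} [AddCommGroup V] [Module K V] {m : ℕ}

lemma mem_span_range_of_ι_mul_ιMulti_eq_zero {u : Fin m → V} (hu : LinearIndependent K u) {v : V}
    (h : ι K v * ιMulti K m u = 0) : v ∈ Submodule.span K (range u) := by
  by_contra hv
  refine ιMulti_ne_zero (linearIndependent_finCons.2 ⟨hu, hv⟩) ?_
  rwa [ExteriorAlgebra.ιMulti_succ_apply]

lemma mem_span_insert_of_mem_annihilator {c d : Fin m → V} (h : LinearIndependent K (Sum.elim c d))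
    {v : V} (hv : v ∈ annihilator (ιMulti K m c + ιMulti K m d)) (j : Fin m) :
    v ∈ Submodule.span K (insert (d j) (range c)) := by
  have hj : LinearIndependent K (Fin.cons (d j) c : Fin (m + 1) → V) := by
    refine linearIndependent_finCons.2 ⟨h.comp Sum.inl Sum.inl_injective, ?_⟩
    simpa [← range_comp] using h.notMem_span_image (s := range Sum.inl) (x := Sum.inr j) (by simp)
  rw [← Fin.range_cons]
  refine mem_span_range_of_ι_mul_ιMulti_eq_zero hj ?_
  have hd : ι K (d j) * ιMulti K m d = 0 :=
    ι_mul_ιMulti_eq_zero (Submodule.subset_span (mem_range_self j))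
  have hprod : ιMulti K (m + 1) (Fin.cons (d j) c) =
      ι K (d j) * (ιMulti K m c + ιMulti K m d) := by
    rw [mul_add, hd, add_zero, ExteriorAlgebra.ιMulti_succ_apply]
    rfl
  rw [hprod, ← mul_assoc, eq_neg_of_add_eq_zero_left (ExteriorAlgebra.ι_add_mul_swap v (d j)),
    neg_mul, mul_assoc, mem_annihilator.1 hv, mul_zero, neg_zero]

lemma eq_zero_of_forall_mem_span_image {κ : Type*} [Nonempty κ] {u : κ → V}
    (hu : LinearIndependent K u) {v : V}
    (hv : ∀ l, ∃ s : Set κ, l ∉ s ∧ v ∈ Submodule.span K (u '' s)) : v = 0 := by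
  simp only [Finsupp.mem_span_image_iff_linearCombination] at hv
  obtain ⟨-, -, f, -, rfl⟩ := hv (Classical.arbitrary κ)
  have hf : f = 0 := by
    ext l
    obtain ⟨s, hls, g, hg, hgf⟩ := hv l
    rw [← hu hgf]
    exact (Finsupp.mem_supported' K g).1 hg l hls
  rw [hf, map_zero]

/-- A vector annihilating `c₁ ∧ ⋯ ∧ cₘ + d₁ ∧ ⋯ ∧ dₘ` lies in each `⟨c, dⱼ⟩` and in each `⟨d, cᵢ⟩`,
and these subspaces have zero intersection. -/
lemma annihilator_ιMulti_add_ιMulti (hm : 2 ≤ m) {c d : Fin m → V}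
    (h : LinearIndependent K (Sum.elim c d)) : annihilator (ιMulti K m c + ιMulti K m d) = ⊥ := by
  have : Nontrivial (Fin m) := Fin.nontrivial_iff_two_le.2 hm
  refine eq_bot_iff.2 fun v hv => eq_zero_of_forall_mem_span_image h ?_
  have hswap : LinearIndependent K (Sum.elim d c) := by
    rw [← Sum.elim_swap]
    exact h.comp _ Sum.swap_leftInverse.injective
  have hc (j : Fin m) :
      v ∈ Submodule.span K (Sum.elim c d '' insert (Sum.inr j) (range Sum.inl)) := by
    rw [image_insert_eq, ← range_comp, Sum.elim_comp_inl, Sum.elim_inr]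
    exact mem_span_insert_of_mem_annihilator h hv j
  have hd (i : Fin m) :
      v ∈ Submodule.span K (Sum.elim c d '' insert (Sum.inl i) (range Sum.inr)) := by
    rw [image_insert_eq, ← range_comp, Sum.elim_comp_inr, Sum.elim_inl]
    rw [add_comm] at hv
    exact mem_span_insert_of_mem_annihilator hswap hv i
  rintro (i | j)
  · obtain ⟨i', hi'⟩ := exists_ne i
    exact ⟨_, by simp [hi'.symm], hd i'⟩
  · obtain ⟨j', hj'⟩ := exists_ne j
    exact ⟨_, by simp [hj'.symm], hc j'⟩

end GeneralSums

section Parametrization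

variable {K : Type*} [Field K] {V : Type*} [AddCommGroup V] [Module K V]

variable (K V) in
/-- The parametrization of `secantCone K s m V` by the coefficients and the factors of the `s`
decomposable vectors. -/
def secantMap (s m : ℕ) (y : Fin s → K × (Fin m → V)) : ExteriorAlgebra K V :=
  ∑ i, (y i).1 • ιMulti K m (y i).2

lemma secantMap_mem_secantCone {s m : ℕ} (y : Fin s → K × (Fin m → V)) :
    secantMap K V s m y ∈ secantCone K s m V :=
  ⟨_, fun i => ⟨(y i).1, (y i).2, rfl⟩, rfl⟩

lemma exists_secantMap_eq {s m : ℕ} {w : ExteriorAlgebra K V} (hw : w ∈ secantCone K s m V) :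
    ∃ y, secantMap K V s m y = w := by
  obtain ⟨a, ha, rfl⟩ := hw
  choose c v hv using ha
  exact ⟨fun i => (c i, v i), Finset.sum_congr rfl fun i _ => (hv i).symm⟩

lemma smul_secantMap {s m : ℕ} (c : K) (y : Fin s → K × (Fin m → V)) :
    secantMap K V s m (fun i => (c * (y i).1, (y i).2)) = c • secantMap K V s m y := by
  simp only [secantMap, Finset.smul_sum, mul_smul]

/-- The parametrization of `restrictedCone K s r m V` by the common factors and by `secantMap`. -/
def restrictedMap {r m k : ℕ} (s : ℕ) (hk : k = r + m)
    (x : (Fin r → V) × (Fin s → K × (Fin m → V))) : ⋀[K]^k V :=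
  ⟨ιMulti K r x.1 * secantMap K V s m x.2, ιMulti_mul_mem_exteriorPower hk _
    (secantCone_subset_exteriorPower (secantMap_mem_secantCone x.2))⟩

lemma restrictedMap_mem_restrictedCone {s r m k : ℕ} (hk : k = r + m)
    (x : (Fin r → V) × (Fin s → K × (Fin m → V))) :
    (restrictedMap s hk x : ExteriorAlgebra K V) ∈ restrictedCone K s r m V :=
  ⟨x.1, _, secantMap_mem_secantCone x.2, rfl⟩

lemma exists_restrictedMap_eq {s r m k : ℕ} (hk : k = r + m) {w : ExteriorAlgebra K V}
    (hw : w ∈ restrictedCone K s r m V) :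
    ∃ x : (Fin r → V) × (Fin s → K × (Fin m → V)),
      (restrictedMap s hk x : ExteriorAlgebra K V) = w := by
  obtain ⟨e, t, ht, rfl⟩ := hw
  obtain ⟨y, rfl⟩ := exists_secantMap_eq ht
  exact ⟨(e, y), rfl⟩

variable [FiniteDimensional K V]

lemma hasCoordsIn_polyFun_secantMap (s m : ℕ) :
    HasCoordsIn (polyFun K (Fin s → K × (Fin m → V))) (secantMap K V s m) := by
  unfold secantMap
  refine HasCoordsIn.sum _ fun i _ => HasCoordsIn.smul ?_ (HasCoordsIn.ιMulti fun j => ?_)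
  · exact Algebra.subset_adjoin ⟨LinearMap.fst K K (Fin m → V) ∘ₗ LinearMap.proj i, rfl⟩
  · exact hasCoordsIn_polyFun_linearMap (W := Fin s → K × (Fin m → V))
      (LinearMap.proj (φ := fun _ => V) j ∘ₗ LinearMap.snd K K (Fin m → V) ∘ₗ
        LinearMap.proj (φ := fun _ => K × (Fin m → V)) i)

lemma hasCoordsIn_polyFun_ιMulti_mul_secantMap (s r m : ℕ) :
    HasCoordsIn (polyFun K ((Fin r → V) × (Fin s → K × (Fin m → V))))
      fun x => ιMulti K r x.1 * secantMap K V s m x.2 := by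
  simp only [secantMap, Finset.mul_sum, mul_smul_comm, ExteriorAlgebra.ιMulti_mul_ιMulti]
  refine HasCoordsIn.sum _ fun i _ => HasCoordsIn.smul ?_ (HasCoordsIn.ιMulti fun j => ?_)
  · exact Algebra.subset_adjoin ⟨LinearMap.fst K K (Fin m → V) ∘ₗ LinearMap.proj i ∘ₗ
      LinearMap.snd K (Fin r → V) (Fin s → K × (Fin m → V)), rfl⟩
  · refine Fin.addCases (fun j => ?_) (fun j => ?_) j
    · simp only [Fin.append_left]
      exact hasCoordsIn_polyFun_linearMap (LinearMap.proj j ∘ₗ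
        LinearMap.fst K (Fin r → V) (Fin s → K × (Fin m → V)))
    · simp only [Fin.append_right]
      exact hasCoordsIn_polyFun_linearMap (LinearMap.proj j ∘ₗ LinearMap.snd K K (Fin m → V) ∘ₗ
        LinearMap.proj i ∘ₗ LinearMap.snd K (Fin r → V) (Fin s → K × (Fin m → V)))

lemma hasCoordsIn_polyFun_restrictedMap {r m k : ℕ} (s : ℕ) (hk : k = r + m) :
    HasCoordsIn (polyFun K ((Fin r → V) × (Fin s → K × (Fin m → V)))) (restrictedMap s hk) :=
  HasCoordsIn.of_coe (hasCoordsIn_polyFun_ιMulti_mul_secantMap s r m)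

lemma exists_annihilator_secantMap_eq_bot {m : ℕ} (hm : 2 ≤ m) (hV : 2 * m ≤ finrank K V) :
    ∃ y, annihilator (secantMap K V 2 m y) = ⊥ := by
  obtain ⟨u, hu, -⟩ := exists_linearIndependent_mem (K := K) (S := (⊤ : Submodule K V))
    (r := m + m) (by rw [finrank_top]; omega)
  refine ⟨![(1, u ∘ Fin.castAdd m), (1, u ∘ Fin.natAdd m)], ?_⟩
  have hsum : Sum.elim (u ∘ Fin.castAdd m) (u ∘ Fin.natAdd m) = u ∘ finSumFinEquiv := by
    ext (i | j) <;> simp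
  simpa [secantMap] using
    annihilator_ιMulti_add_ιMulti hm (hsum ▸ hu.comp _ finSumFinEquiv.injective)

end Parametrization

section Divisors

variable {K : Type*} [Field K] {V : Type*} [AddCommGroup V] [Module K V]

lemma ne_zero_of_annihilator_eq_bot [Nontrivial V] {w : ExteriorAlgebra K V}
    (hw : annihilator w = ⊥) : w ≠ 0 := by
  rintro rfl
  obtain ⟨v, hv⟩ := exists_ne (0 : V)
  exact hv ((Submodule.mem_bot K).1 (hw ▸ mem_annihilator.2 (mul_zero _)))

lemma annihilator_ιMulti_mul_map_le_ker {U : Type*} [AddCommGroup U] [Module K U] {r : ℕ}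
    {e : Fin r → V} (he : LinearIndependent K e) {π : V →ₗ[K] U} (hπ : ∀ i, π (e i) = 0)
    {σ : U →ₗ[K] V} (hσ : π ∘ₗ σ = LinearMap.id) {t : ExteriorAlgebra K U}
    (ht : annihilator t = ⊥) :
    annihilator (ιMulti K r e * ExteriorAlgebra.map σ t) ≤ LinearMap.ker π := by
  intro v hv
  obtain ⟨φ, hφ⟩ := exists_dual_family he
  have hprod : ιMulti K r e * (ι K v * ExteriorAlgebra.map σ t) = 0 := by
    rw [← mul_assoc, ιMulti_mul_ι, smul_mul_assoc, mul_assoc, mem_annihilator.1 hv, smul_zero]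
  have hvt : π v ∈ annihilator t := by
    have h := map_contractMulti_ιMulti_mul hφ hπ (ι K v * ExteriorAlgebra.map σ t)
    rwa [hprod, map_zero, map_zero, map_mul, ExteriorAlgebra.map_apply_ι, ← AlgHom.comp_apply,
      ExteriorAlgebra.map_comp_map, hσ, ExteriorAlgebra.map_id, AlgHom.id_apply, eq_comm,
      ← mem_annihilator] at h
  rwa [ht, Submodule.mem_bot] at hvt

end Divisors

section Fibers

variable {V : Type*} [AddCommGroup V] [Module ℂ V] {s r m k : ℕ}

lemma isWedge_right_unique (hk : k = r + m) {p : ℙ ℂ (⋀[ℂ]^k V)} {E : Submodule ℂ V}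
    [FiniteDimensional ℂ E] (hE : finrank ℂ E = r) {q q' : ℙ ℂ (⋀[ℂ]^m (V ⧸ E))}
    (hq : IsWedge r E q p) (hq' : IsWedge r E q' p) : q = q' := by
  obtain ⟨e, he, rfl⟩ := exists_linearIndependent_span_range_eq hE
  obtain ⟨σ, hσ⟩ := exists_mkQ_section (Submodule.span ℂ (range e))
  rw [isWedge_iff hk he hσ] at hq hq'
  exact Projectivization.map_injective _ _ (hq.symm.trans hq')

variable [FiniteDimensional ℂ V]

lemma eq_annihilator_of_isWedge (hk : k = r + m) {p : ℙ ℂ (⋀[ℂ]^k V)}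
    (hp : finrank ℂ (annihilator (p.rep : ExteriorAlgebra ℂ V)) ≤ r) {E : Submodule ℂ V}
    {q : ℙ ℂ (⋀[ℂ]^m (V ⧸ E))} (hE : finrank ℂ E = r) (hq : IsWedge r E q p) :
    E = annihilator (p.rep : ExteriorAlgebra ℂ V) := by
  refine Submodule.eq_of_le_of_finrank_le ?_ (hp.trans hE.ge)
  obtain ⟨e, he, rfl⟩ := exists_linearIndependent_span_range_eq hE
  obtain ⟨σ, hσ⟩ := exists_mkQ_section (Submodule.span ℂ (range e))
  rw [isWedge_iff hk he hσ, ← q.mk_rep, Projectivization.map_mk] at hq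
  rw [hq, annihilator_rep_mk, coe_wedgeMap]
  exact span_range_le_annihilator e _

lemma finite_incidenceVariety_fiber (hr : r ≤ k) {p : ℙ ℂ (⋀[ℂ]^k V)}
    (hp : finrank ℂ (annihilator (p.rep : ExteriorAlgebra ℂ V)) ≤ r) :
    (incidenceVariety V s r k ∩ Prod.snd ⁻¹' {p}).Finite := by
  have hk : k = r + (k - r) := by omega
  apply Set.Subsingleton.finite
  rintro ⟨⟨E, q⟩, p₁⟩ ⟨⟨hE, -, hq⟩, hp₁⟩ ⟨⟨E', q'⟩, p₂⟩ ⟨⟨hE', -, hq'⟩, hp₂⟩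
  obtain rfl : p₁ = p := hp₁
  obtain rfl : p₂ = p₁ := hp₂
  obtain rfl : E = E' :=
    (eq_annihilator_of_isWedge hk hp hE hq).trans (eq_annihilator_of_isWedge hk hp hE' hq').symm
  obtain rfl : q = q' := isWedge_right_unique hk hE hq hq'
  rfl

/-- `X \ Z` contains all `[Ψ x]` outside the zero locus of one nonzero polynomial function. -/
lemma mk_mem_closure_diff {M : Type*} [AddCommGroup M] [Module ℂ M] {W : Type*} [AddCommGroup W]
    [Module ℂ W] {Ψ : M → W} (hΨ : HasCoordsIn (polyFun ℂ M) Ψ) {X Z : Set (ℙ ℂ W)}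
    (hZ : IsClosed Z) (hX : ∀ x (hx : Ψ x ≠ 0), Projectivization.mk ℂ (Ψ x) hx ∈ X) {x₀ : M}
    (hx₀ : Ψ x₀ ≠ 0) (hx₀Z : Projectivization.mk ℂ (Ψ x₀) hx₀ ∉ Z) {x : M} (hx : Ψ x ≠ 0) :
    Projectivization.mk ℂ (Ψ x) hx ∈ closure (X \ Z) := by
  obtain ⟨F, hF, rfl⟩ := (isClosed_iff_isAlgebraicSet _).1 hZ
  obtain ⟨G, hG, hGx₀⟩ : ∃ G ∈ F, G (Ψ x₀) ≠ 0 := by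
    by_contra! hcon
    refine hx₀Z fun G hG => ?_
    obtain ⟨d, hd⟩ := hF G hG
    exact (hd.vanish_iff _).2 ((hd.rep_mk_eq_zero_iff hx₀).2 (hcon G hG))
  obtain ⟨d, hd⟩ := hF G hG
  obtain ⟨ℓ, hℓ⟩ := Projective.exists_dual_ne_zero ℂ hx₀
  rw [mem_closure_iff_isForm]
  intro e f hf hfX
  rw [hf.rep_mk_eq_zero_iff]
  refine eq_zero_of_eq_zero_on_ne_zero (hΨ.comp_mem hf.1) (hΨ.comp_mem (hd.mul (isForm_dual ℓ)).1)
    (fun y hy => ?_) (mul_ne_zero hGx₀ hℓ) x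
  have hy0 : Ψ y ≠ 0 := fun h => right_ne_zero_of_mul hy (by rw [h, map_zero])
  refine (hf.rep_mk_eq_zero_iff hy0).1 (hfX _ ⟨hX y hy0, fun hyZ => left_ne_zero_of_mul hy ?_⟩)
  exact hyZ G hG _ (mem_submodule_mk hy0)

lemma restrictedSecant_subset_closure_diff (hk : k = r + m) {w : ExteriorAlgebra ℂ V}
    (hw : w ∈ restrictedCone ℂ s r m V) (hw0 : w ≠ 0) (hann : finrank ℂ (annihilator w) ≤ r) :
    restrictedSecant V s r k ⊆ closure (restrictedSecant V s r k \
      {p | r + 1 ≤ finrank ℂ (annihilator (p.rep : ExteriorAlgebra ℂ V))}) := by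
  have hX : ∀ x (hx : restrictedMap s hk x ≠ 0),
      Projectivization.mk ℂ (restrictedMap s hk x) hx ∈ restrictedSecant V s r k := fun x hx => by
    rw [restrictedSecant_eq_closure hk]
    exact subset_closure (rep_mk_mem (S := Subtype.val ⁻¹' _)
      (fun c _ => smul_mem_restrictedCone c) hx (restrictedMap_mem_restrictedCone hk x))
  obtain ⟨x₀, rfl⟩ := exists_restrictedMap_eq hk hw
  have hx₀ : restrictedMap s hk x₀ ≠ 0 := fun h => hw0 (congrArg Subtype.val h)
  conv_lhs => rw [restrictedSecant_eq_closure hk]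
  refine closure_minimal (fun p hp => ?_) isClosed_closure
  obtain ⟨x, hx⟩ := exists_restrictedMap_eq hk hp
  have hxp : Projectivization.mk ℂ (restrictedMap s hk x)
      (Subtype.coe_injective hx ▸ p.rep_nonzero) = p := by
    simp only [Subtype.coe_injective hx, p.mk_rep]
  rw [← hxp]
  refine mk_mem_closure_diff (hasCoordsIn_polyFun_restrictedMap s hk)
    (isClosed_setOf_le_finrank_annihilator k (r + 1)) hX hx₀ (fun h => ?_) _
  rw [mem_ofPred_eq, annihilator_rep_mk] at h
  omega

lemma exists_mem_restrictedCone_finrank_annihilator_le {E : Submodule ℂ V}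
    (hE : finrank ℂ E = r) {t : ExteriorAlgebra ℂ (V ⧸ E)} (ht : t ∈ secantCone ℂ s m (V ⧸ E))
    (ht0 : t ≠ 0) (hann : annihilator t = ⊥) :
    ∃ w ∈ restrictedCone ℂ s r m V, w ≠ 0 ∧ finrank ℂ (annihilator w) ≤ r := by
  obtain ⟨e, he, rfl⟩ := exists_linearIndependent_span_range_eq hE
  obtain ⟨σ, hσ⟩ := exists_mkQ_section (Submodule.span ℂ (range e))
  obtain ⟨φ, hφ⟩ := exists_dual_family he
  refine ⟨_, ⟨e, _, map_mem_secantCone σ ht, rfl⟩, fun h => ht0 ?_, ?_⟩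
  · rw [← map_mkQ_contractMulti_ιMulti_mul_map hφ hσ t, h, map_zero, map_zero]
  · have hle := annihilator_ιMulti_mul_map_le_ker he (fun i => (Submodule.Quotient.mk_eq_zero _).2
      (Submodule.subset_span (mem_range_self i))) hσ hann
    exact (Submodule.finrank_mono (hle.trans (Submodule.ker_mkQ _).le)).trans hE.le

end Fibers

section TranscendenceDegree

lemma trdeg_eq_of_sup_adjoin_eq {K F : Type*} [Field K] [CommRing F] [Algebra K F]
    {A B : Subalgebra K F} [IsDomain B] {S : Set F} (hB : A ⊔ Algebra.adjoin K S = B)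
    (hS : ∀ x ∈ S, ∃ g ∈ A, g ≠ 0 ∧ g * x ∈ A) : Algebra.trdeg K A = Algebra.trdeg K B := by
  have hAB : A ≤ B := hB ▸ le_sup_left
  let : Algebra A B := (Subalgebra.inclusion hAB).toAlgebra
  have : IsScalarTower K A B := .of_algebraMap_eq' rfl
  have hinj : Function.Injective (algebraMap A B) := Subalgebra.inclusion_injective hAB
  have : FaithfulSMul A B := (faithfulSMul_iff_algebraMap_injective A B).2 hinj
  have : IsDomain A := hinj.isDomain (algebraMap A B)
  have hadjoin : B = Algebra.adjoin K (A ∪ S) := by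
    rw [Algebra.adjoin_union, Algebra.adjoin_eq, hB]
  have hS' : ∀ x ∈ S, ∀ hx : x ∈ B, IsAlgebraic A (⟨x, hx⟩ : B) := fun x hxS hx => by
    obtain ⟨g, hg, hg0, hgx⟩ := hS x hxS
    have hg0' : (⟨g, hAB hg⟩ : B) ≠ 0 := fun h => hg0 (congrArg Subtype.val h)
    exact IsAlgebraic.of_mul (mem_nonZeroDivisors_of_ne_zero hg0')
      (isAlgebraic_algebraMap (⟨g, hg⟩ : A)) (isAlgebraic_algebraMap (⟨g * x, hgx⟩ : A))
  have halg : Algebra.IsAlgebraic A B := by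
    refine ⟨fun ⟨x, hx⟩ => ?_⟩
    have hx' := hadjoin ▸ hx
    induction hx' using Algebra.adjoin_induction with
    | mem x hxAS =>
      exact hxAS.elim (fun hxA => isAlgebraic_algebraMap (⟨x, hxA⟩ : A)) fun hxS => hS' x hxS hx
    | algebraMap c => exact isAlgebraic_algebraMap (algebraMap K A c)
    | add y z hy hz ihy ihz => exact (ihy (hadjoin ▸ hy)).add (ihz (hadjoin ▸ hz))
    | mul y z hy hz ihy ihz => exact (ihy (hadjoin ▸ hy)).mul (ihz (hadjoin ▸ hz))
  rw [← trdeg_add_eq K A (A := B), trdeg_eq_zero_iff.2 halg, add_zero]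

lemma trdeg_mvPolynomial {K : Type*} [Field K] (κ : Type) [Finite κ] (R : Type*) [CommRing R]
    [IsDomain R] [Algebra K R] :
    Algebra.trdeg K (MvPolynomial κ R) = Nat.card κ + Algebra.trdeg K R := by
  rw [← trdeg_add_eq K R (A := MvPolynomial κ R), MvPolynomial.trdeg_of_isDomain, add_comm,
    ← Nat.cast_card, Cardinal.lift_natCast]

universe u v

variable {K : Type v} [Field K] (κ : Type) {N : Type u} (R : Subalgebra K (N → K))

/-- Polynomials with coefficients in the algebra `R` of functions on `N`, as functions on
`(κ → K) × N`. -/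
def mvPolynomialToFun : MvPolynomial κ R →ₐ[K] ((κ → K) × N → K) :=
  MvPolynomial.aevalTower
    ((AlgHom.pi fun x => Pi.evalAlgHom K (fun _ : N => K) x.2).comp R.val)
    fun i x => x.1 i

variable {κ R}

lemma mvPolynomialToFun_C (f : R) :
    mvPolynomialToFun κ R (MvPolynomial.C f) = fun x => f.1 x.2 :=
  MvPolynomial.aevalTower_C _ _ _

lemma mvPolynomialToFun_X (i : κ) : mvPolynomialToFun κ R (MvPolynomial.X i) = fun x => x.1 i :=
  MvPolynomial.aevalTower_X _ _ _

lemma mvPolynomialToFun_apply (P : MvPolynomial κ R) (x : κ → K) (y : N) :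
    mvPolynomialToFun κ R P (x, y) =
      MvPolynomial.eval x (P.map ((Pi.evalRingHom (fun _ => K) y).comp R.val.toRingHom)) := by
  induction P using MvPolynomial.induction_on with
  | C f =>
    rw [mvPolynomialToFun_C, MvPolynomial.map_C, MvPolynomial.eval_C]
    rfl
  | add p q hp hq => rw [map_add, Pi.add_apply, hp, hq, map_add, map_add]
  | mul_X p i hp =>
    rw [map_mul, Pi.mul_apply, hp, mvPolynomialToFun_X, map_mul, map_mul, MvPolynomial.map_X,
      MvPolynomial.eval_X]

variable (κ R)

lemma range_mvPolynomialToFun :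
    (mvPolynomialToFun κ R).range =
      R.map (AlgHom.pi fun x => Pi.evalAlgHom K (fun _ : N => K) x.2) ⊔
        Algebra.adjoin K (range fun (i : κ) (x : (κ → K) × N) => x.1 i) := by
  apply le_antisymm
  · rintro _ ⟨P, rfl⟩
    induction P using MvPolynomial.induction_on with
    | C f =>
      have hf := mvPolynomialToFun_C (κ := κ) f
      exact SetLike.le_def.1 le_sup_left ⟨f, f.2, hf.symm⟩
    | add p q hp hq => exact (map_add (mvPolynomialToFun κ R) p q).symm ▸ add_mem hp hq
    | mul_X p i hp =>
      refine (map_mul (mvPolynomialToFun κ R) p _).symm ▸ mul_mem hp ?_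
      rw [mvPolynomialToFun_X]
      exact SetLike.le_def.1 le_sup_right (Algebra.subset_adjoin (mem_range_self i))
  · refine sup_le ?_ (Algebra.adjoin_le ?_)
    · rintro _ ⟨f, hf, rfl⟩
      exact ⟨MvPolynomial.C ⟨f, hf⟩, mvPolynomialToFun_C ⟨f, hf⟩⟩
    · rintro _ ⟨i, rfl⟩
      exact ⟨MvPolynomial.X i, mvPolynomialToFun_X i⟩

variable [Infinite K]

lemma mvPolynomialToFun_injective : Function.Injective (mvPolynomialToFun κ R) := by
  rw [injective_iff_map_eq_zero]
  intro P hP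
  ext d y
  have h0 : P.map ((Pi.evalRingHom (fun _ => K) y).comp R.val.toRingHom) = 0 := by
    apply MvPolynomial.funext
    intro x
    rw [← mvPolynomialToFun_apply, hP, map_zero]
    rfl
  have hcoeff := congrArg (MvPolynomial.coeff d) h0
  rw [MvPolynomial.coeff_map] at hcoeff
  exact hcoeff

variable [IsDomain R]

lemma isDomain_range_mvPolynomialToFun : IsDomain (mvPolynomialToFun κ R).range :=
  (AlgEquiv.ofInjective _ (mvPolynomialToFun_injective κ R)).symm.injective.isDomain
    (AlgEquiv.ofInjective _ (mvPolynomialToFun_injective κ R)).symm.toRingHom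

lemma trdeg_range_mvPolynomialToFun [Finite κ] :
    Algebra.trdeg K (mvPolynomialToFun κ R).range = Nat.card κ + Algebra.trdeg K R := by
  rw [← trdeg_mvPolynomial]
  exact (AlgEquiv.ofInjective _ (mvPolynomialToFun_injective κ R)).trdeg_eq.symm

end TranscendenceDegree

section CramersRule

variable {K : Type*} [Field K] {M W κ : Type*} [AddCommGroup W] [Module K W] [Fintype κ]

lemma exists_mul_mem_of_sum_smul_eq {A : Subalgebra K (M → K)} {c : κ → M → W} {b : M → W}
    (hc : ∀ j, HasCoordsIn A (c j)) (hb : HasCoordsIn A b) {X : κ → M → K}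
    (hX : ∀ x, ∑ j, X j x • c j x = b x) {x₀ : M} (hx₀ : LinearIndependent K fun j => c j x₀) :
    ∃ g ∈ A, g ≠ 0 ∧ ∀ j, g * X j ∈ A := by
  classical
  obtain ⟨ℓ, hℓ⟩ := linearIndependent_iff_exists_det_ne_zero.1 hx₀
  let C : M → Matrix κ κ K := fun x => Matrix.of fun i j => ℓ i (c j x)
  refine ⟨fun x => (C x).det, det_mem fun i j => hc j (ℓ i), fun h => hℓ (congrFun h x₀),
    fun j => ?_⟩
  have hCX : ∀ x, (C x).mulVec (fun j => X j x) = fun i => ℓ i (b x) := fun x => by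
    ext i
    simp [C, Matrix.mulVec, dotProduct, ← hX x, mul_comm]
  have hcramer : (fun x => (C x).det) * X j =
      fun x => ((C x).updateCol j fun i => ℓ i (b x)).det := by
    ext x
    rw [← Matrix.cramer_apply, Matrix.cramer_eq_adjugate_mulVec, ← hCX, Matrix.mulVec_mulVec,
      Matrix.adjugate_mul, Matrix.smul_mulVec, Matrix.one_mulVec]
    rfl
  rw [hcramer]
  refine det_mem fun i j' => ?_
  by_cases hj : j' = j
  · subst hj
    simpa only [Matrix.updateCol_self] using hb (ℓ i)
  · simp only [Matrix.updateCol_ne hj]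
    exact hc j' (ℓ i)

end CramersRule

section PolynomialCoordinates

variable {K : Type*} [Field K] {V U : Type*} [AddCommGroup V] [Module K V] [AddCommGroup U]
  [Module K U] [FiniteDimensional K U] {M : Type*} {B : Subalgebra K (M → K)} {g : M → V →ₗ[K] U}

lemma HasCoordsIn.exteriorMap (hg : ∀ v, HasCoordsIn B fun x => g x v) {k : ℕ}
    {w : ExteriorAlgebra K V} (hw : w ∈ ⋀[K]^k V) :
    HasCoordsIn B fun x => ExteriorAlgebra.map (g x) w := by
  rw [← ExteriorAlgebra.ιMulti_span_fixedDegree] at hw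
  induction hw using Submodule.span_induction with
  | mem w hw =>
    obtain ⟨v, rfl⟩ := hw
    simp only [ExteriorAlgebra.map_apply_ιMulti]
    exact HasCoordsIn.ιMulti fun i => hg (v i)
  | zero => simp only [map_zero]; exact HasCoordsIn.const 0
  | add w w' _ _ h h' => simp only [map_add]; exact h.add h'
  | smul c w _ h => simp only [map_smul]; exact h.linearMap (c • LinearMap.id)

lemma HasCoordsIn.exteriorMap_apply [FiniteDimensional K V]
    (hg : ∀ v, HasCoordsIn B fun x => g x v) {k : ℕ} {φ : M → ⋀[K]^k V} (hφ : HasCoordsIn B φ) :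
    HasCoordsIn B fun x => ExteriorAlgebra.map (g x) (φ x : ExteriorAlgebra K V) :=
  HasCoordsIn.linearMap_apply
    (T := fun x => (ExteriorAlgebra.map (g x)).toLinearMap ∘ₗ (⋀[K]^k V).subtype)
    (fun w => HasCoordsIn.exteriorMap hg w.2) hφ

end PolynomialCoordinates

section Graphs

variable {K : Type*} [Field K] {V U : Type*} [AddCommGroup V] [Module K V] [AddCommGroup U]
  [Module K U] {r d m k : ℕ} {N : Type*}

/-- In a decomposition `V = K ^ r ⊕ U`, the standard basis of the graph of the linear map
`K ^ r → U` with matrix `X`. These graphs form a chart of the Grassmannian of `r`-planes. -/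
def graphFrame (L : ((Fin r → K) × U) ≃ₗ[K] V) (b : Basis (Fin d) K U) (X : Fin r × Fin d → K)
    (i : Fin r) : V :=
  L (Pi.single i 1, ∑ j, X (i, j) • b j)

/-- The projection of `V = K ^ r ⊕ U` to `U` along the graph of the linear map with matrix `X`. -/
def graphProj (L : ((Fin r → K) × U) ≃ₗ[K] V) (b : Basis (Fin d) K U) (X : Fin r × Fin d → K) :
    V →ₗ[K] U :=
  (LinearMap.snd K (Fin r → K) U -
    ∑ i, (LinearMap.proj i ∘ₗ LinearMap.fst K (Fin r → K) U).smulRight (∑ j, X (i, j) • b j)) ∘ₗ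
      L.symm.toLinearMap

/-- Wedging the graphs over `K ^ r` with a family `t` in an exterior power of `U`: a chart of the
`k`-vectors that are divisible by a decomposable `r`-vector, with quotient in the family. -/
def graphMap (hk : k = r + m) (L : ((Fin r → K) × U) ≃ₗ[K] V) (b : Basis (Fin d) K U)
    (t : N → ⋀[K]^m U) (x : (Fin r × Fin d → K) × N) : ⋀[K]^k V :=
  ⟨ιMulti K r (graphFrame L b x.1) *
      ExteriorAlgebra.map (L.toLinearMap ∘ₗ LinearMap.inr K (Fin r → K) U) (t x.2),
    ιMulti_mul_mem_exteriorPower hk _ (map_mem_exteriorPower _ (t x.2).2)⟩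

variable (L : ((Fin r → K) × U) ≃ₗ[K] V) (b : Basis (Fin d) K U)

lemma coe_graphMap (hk : k = r + m) (t : N → ⋀[K]^m U) (x : (Fin r × Fin d → K) × N) :
    (graphMap hk L b t x : ExteriorAlgebra K V) = ιMulti K r (graphFrame L b x.1) *
      ExteriorAlgebra.map (L.toLinearMap ∘ₗ LinearMap.inr K (Fin r → K) U) (t x.2) := rfl

lemma graphFrame_eq_add (X : Fin r × Fin d → K) (i : Fin r) :
    graphFrame L b X i = L (Pi.single i 1, 0) + ∑ j, X (i, j) • L (0, b j) := by
  simp only [← map_smul, ← map_sum, ← map_add, graphFrame, Prod.smul_mk, smul_zero]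
  congr 1
  ext <;> simp [Prod.fst_sum, Prod.snd_sum]

lemma graphProj_apply (X : Fin r × Fin d → K) (a : Fin r → K) (u : U) :
    graphProj L b X (L (a, u)) = u - ∑ i, a i • ∑ j, X (i, j) • b j := by
  simp [graphProj, LinearMap.sum_apply]

lemma graphProj_graphFrame (X : Fin r × Fin d → K) (i : Fin r) :
    graphProj L b X (graphFrame L b X i) = 0 := by
  simp [graphFrame, graphProj_apply, Pi.single_apply]

lemma graphProj_comp_inr (X : Fin r × Fin d → K) :
    graphProj L b X ∘ₗ L.toLinearMap ∘ₗ LinearMap.inr K (Fin r → K) U = LinearMap.id := by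
  ext u
  simp [graphProj_apply]

lemma proj_graphFrame (X : Fin r × Fin d → K) (i j : Fin r) :
    (LinearMap.proj i ∘ₗ LinearMap.fst K (Fin r → K) U ∘ₗ L.symm.toLinearMap) (graphFrame L b X j) =
      if i = j then 1 else 0 := by
  simp [graphFrame, Pi.single_apply]

lemma linearIndependent_of_fst {v : Fin r → V} (hv : ∀ i, (L.symm (v i)).1 = Pi.single i 1) :
    LinearIndependent K v := by
  refine LinearIndependent.of_comp (LinearMap.fst K (Fin r → K) U ∘ₗ L.symm.toLinearMap) ?_
  convert (Pi.basisFun K (Fin r)).linearIndependent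
  ext1 i
  simpa using hv i

lemma linearIndependent_graphFrame (X : Fin r × Fin d → K) :
    LinearIndependent K (graphFrame L b X) :=
  linearIndependent_of_fst L fun i => by simp [graphFrame]

lemma graphProj_section_sub_mem (X : Fin r × Fin d → K) (v : V) :
    (L.toLinearMap ∘ₗ LinearMap.inr K (Fin r → K) U ∘ₗ graphProj L b X) v - v ∈
      Submodule.span K (range (graphFrame L b X)) := by
  obtain ⟨⟨a, u⟩, rfl⟩ := L.surjective v
  have h : (L.toLinearMap ∘ₗ LinearMap.inr K (Fin r → K) U ∘ₗ graphProj L b X) (L (a, u)) -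
      L (a, u) = -∑ i, a i • graphFrame L b X i := by
    simp only [graphFrame, ← map_smul, ← map_sum, ← map_neg, LinearMap.comp_apply,
      LinearEquiv.coe_coe, graphProj_apply, ← map_sub, LinearMap.inr_apply]
    congr 1
    ext i
    · simp [Prod.fst_sum, Finset.sum_apply, Pi.single_apply]
    · simp [Prod.snd_sum]
  rw [h]
  exact neg_mem (Submodule.sum_mem _ fun i _ =>
    Submodule.smul_mem _ _ (Submodule.subset_span (mem_range_self i)))

lemma map_graphProj_contractMulti_graphMap (hk : k = r + m) (t : N → ⋀[K]^m U)
    (x : (Fin r × Fin d → K) × N) :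
    ExteriorAlgebra.map (graphProj L b x.1) (contractMulti r
      (fun i => LinearMap.proj i ∘ₗ LinearMap.fst K (Fin r → K) U ∘ₗ L.symm.toLinearMap)
      (graphMap hk L b t x)) = t x.2 := by
  rw [coe_graphMap, map_contractMulti_ιMulti_mul (proj_graphFrame L b x.1)
    (graphProj_graphFrame L b x.1), ← AlgHom.comp_apply, ExteriorAlgebra.map_comp_map,
    graphProj_comp_inr, ExteriorAlgebra.map_id, AlgHom.id_apply]

section Coordinates

variable {A : Subalgebra K ((Fin r × Fin d → K) × N → K)}

lemma hasCoordsIn_matrixVector (hA : ∀ i, (fun x => x.1 i) ∈ A) (i : Fin r) :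
    HasCoordsIn A fun x => ∑ j, x.1 (i, j) • b j :=
  HasCoordsIn.sum _ fun j _ => HasCoordsIn.smul (hA (i, j)) (HasCoordsIn.const (b j))

variable [FiniteDimensional K V] [FiniteDimensional K U]

lemma hasCoordsIn_graphMap (hA : ∀ i, (fun x => x.1 i) ∈ A) (hk : k = r + m)
    {t : N → ⋀[K]^m U} (ht : HasCoordsIn A fun x => t x.2) :
    HasCoordsIn A (graphMap hk L b t) := by
  let T : (Fin r × Fin d → K) × N → ⋀[K]^m U →ₗ[K] ExteriorAlgebra K V := fun x =>
    LinearMap.mulLeft K (ιMulti K r (graphFrame L b x.1)) ∘ₗ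
      (ExteriorAlgebra.map (L.toLinearMap ∘ₗ LinearMap.inr K (Fin r → K) U)).toLinearMap ∘ₗ
      (⋀[K]^m U).subtype
  have hT : (fun x => (graphMap hk L b t x : ExteriorAlgebra K V)) = fun x => T x (t x.2) := rfl
  refine HasCoordsIn.of_coe ?_
  rw [hT]
  refine HasCoordsIn.linearMap_apply (fun w => ?_) ht
  refine HasCoordsIn.linearMap (HasCoordsIn.ιMulti fun i => ?_) (LinearMap.mulRight K
    (ExteriorAlgebra.map (L.toLinearMap ∘ₗ LinearMap.inr K (Fin r → K) U)
      (w : ExteriorAlgebra K U)))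
  simp only [graphFrame_eq_add]
  exact (HasCoordsIn.const _).add (HasCoordsIn.sum _ fun j _ =>
    HasCoordsIn.smul (hA (i, j)) (HasCoordsIn.const _))

lemma hasCoordsIn_of_graphMap (hA : ∀ i, (fun x => x.1 i) ∈ A) (hk : k = r + m)
    {t : N → ⋀[K]^m U} (ht : HasCoordsIn A (graphMap hk L b t)) :
    HasCoordsIn A fun x => t x.2 := by
  let φ : Fin r → Dual K V := fun i =>
    LinearMap.proj i ∘ₗ LinearMap.fst K (Fin r → K) U ∘ₗ L.symm.toLinearMap
  have hproj : ∀ v, HasCoordsIn A fun x => graphProj L b x.1 v := fun v => by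
    obtain ⟨⟨a, u⟩, rfl⟩ := L.surjective v
    simp only [graphProj_apply]
    exact (HasCoordsIn.const u).sub (HasCoordsIn.sum _ fun i _ =>
      (hasCoordsIn_matrixVector b hA i).linearMap (a i • LinearMap.id))
  have hcontract : HasCoordsIn A fun x => (⟨contractMulti r φ (graphMap hk L b t x),
      contractMulti_mem_exteriorPower hk φ (Subtype.property _)⟩ : ⋀[K]^m V) :=
    HasCoordsIn.of_coe (ht.linearMap (contractMulti r φ ∘ₗ (⋀[K]^k V).subtype))
  have h := HasCoordsIn.exteriorMap_apply hproj hcontract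
  simp only [φ, map_graphProj_contractMulti_graphMap] at h
  exact h.of_coe

end Coordinates

lemma linearIndependent_ι_mul_graphMap (hk : k = r + m) {t : N → ⋀[K]^m U}
    {x : (Fin r × Fin d → K) × N} (ht : annihilator (t x.2 : ExteriorAlgebra K U) = ⊥) :
    LinearIndependent K fun j =>
      ι K (L (0, b j)) * (graphMap hk L b t x : ExteriorAlgebra K V) := by
  rw [Fintype.linearIndependent_iff]
  intro c hc
  have hmem : L (0, ∑ j, c j • b j) ∈
      annihilator (graphMap hk L b t x : ExteriorAlgebra K V) := by
    have hsum : L (0, ∑ j, c j • b j) = ∑ j, c j • L (0, b j) := by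
      rw [← LinearMap.inr_apply (R := K) (M := Fin r → K), map_sum, map_sum]
      simp only [map_smul, LinearMap.inr_apply]
    rw [mem_annihilator, hsum, ← hc, map_sum, Finset.sum_mul]
    simp only [map_smul, smul_mul_assoc]
  have hker := annihilator_ιMulti_mul_map_le_ker (linearIndependent_graphFrame L b x.1)
    (graphProj_graphFrame L b x.1) (graphProj_comp_inr L b x.1) ht hmem
  have hzero : ∑ j, c j • b j = 0 := by simpa [graphProj_apply] using hker
  exact Fintype.linearIndependent_iff.1 b.linearIndependent c hzero

/-- The vectors of the graph annihilate the `k`-vector, and this determines the matrix. -/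
lemma exists_mul_fst_mem_coordAlg_graphMap (hk : k = r + m) {t : N → ⋀[K]^m U} {y₀ : N}
    (hy₀ : annihilator (t y₀ : ExteriorAlgebra K U) = ⊥) (q : Fin r × Fin d) :
    ∃ g ∈ coordAlg K (graphMap hk L b t), g ≠ 0 ∧
      (g * fun x => x.1 q) ∈ coordAlg K (graphMap hk L b t) := by
  have hcoords (v : V) : HasCoordsIn (coordAlg K (graphMap hk L b t)) fun x =>
      ι K v * (graphMap hk L b t x : ExteriorAlgebra K V) :=
    (hasCoordsIn_coordAlg _).linearMap (LinearMap.mulLeft K (ι K v) ∘ₗ (⋀[K]^k V).subtype)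
  have hsystem : ∀ x, ∑ j, x.1 (q.1, j) •
      (ι K (L (0, b j)) * (graphMap hk L b t x : ExteriorAlgebra K V)) =
        ι K (-L (Pi.single q.1 1, 0)) * (graphMap hk L b t x : ExteriorAlgebra K V) := fun x => by
    have hzero : ι K (graphFrame L b x.1 q.1) *
        (graphMap hk L b t x : ExteriorAlgebra K V) = 0 := by
      rw [coe_graphMap, ← mul_assoc,
        ι_mul_ιMulti_eq_zero (Submodule.subset_span (mem_range_self _)), zero_mul]
    rw [graphFrame_eq_add, map_add, add_mul, add_eq_zero_iff_eq_neg'] at hzero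
    rw [map_neg, neg_mul, ← hzero, map_sum, Finset.sum_mul]
    simp only [map_smul, smul_mul_assoc]
  obtain ⟨g, hg, hg0, hgX⟩ := exists_mul_mem_of_sum_smul_eq (fun j => hcoords _) (hcoords _)
    (X := fun j x => x.1 (q.1, j)) hsystem
    (linearIndependent_ι_mul_graphMap L b hk (x := (0, y₀)) hy₀)
  exact ⟨g, hg, hg0, hgX q.2⟩

end Graphs

section GraphDimension

universe u v

variable {K : Type v} [Field K] {V U : Type*} [AddCommGroup V] [Module K V]
  [FiniteDimensional K V] [AddCommGroup U] [Module K U] [FiniteDimensional K U] {r d m k : ℕ}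
  {N : Type u} (L : ((Fin r → K) × U) ≃ₗ[K] V) (b : Basis (Fin d) K U)

lemma coordAlg_graphMap_sup_adjoin (hk : k = r + m) (t : N → ⋀[K]^m U) :
    coordAlg K (graphMap hk L b t) ⊔
        Algebra.adjoin K (range fun (i : Fin r × Fin d) (x : (Fin r × Fin d → K) × N) => x.1 i) =
      (mvPolynomialToFun (Fin r × Fin d) (coordAlg K t)).range := by
  apply le_antisymm
  · have hcoords (f) (hf : f ∈ coordAlg K t) :
        f ∘ Prod.snd ∈ (mvPolynomialToFun (Fin r × Fin d) (coordAlg K t)).range :=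
      ⟨_, mvPolynomialToFun_C ⟨f, hf⟩⟩
    have hmatrix (i) : (fun x : (Fin r × Fin d → K) × N => x.1 i) ∈
        (mvPolynomialToFun (Fin r × Fin d) (coordAlg K t)).range := ⟨_, mvPolynomialToFun_X i⟩
    exact sup_le (hasCoordsIn_graphMap L b hmatrix hk
      ((hasCoordsIn_coordAlg t).comp hcoords)).coordAlg_le
      (Algebra.adjoin_le (range_subset_iff.2 hmatrix))
  · rw [range_mvPolynomialToFun]
    refine sup_le ?_ le_sup_right
    rw [coordAlg, AlgHom.map_adjoin, ← range_comp]
    exact Algebra.adjoin_le (range_subset_iff.2 (hasCoordsIn_of_graphMap L b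
      (fun i => SetLike.le_def.1 le_sup_right (Algebra.subset_adjoin (mem_range_self i))) hk
      fun ℓ => SetLike.le_def.1 le_sup_left (hasCoordsIn_coordAlg _ ℓ)))

variable [Infinite K]

theorem trdeg_coordAlg_graphMap (hk : k = r + m) {t : N → ⋀[K]^m U} [IsDomain (coordAlg K t)]
    {y₀ : N} (hy₀ : annihilator (t y₀ : ExteriorAlgebra K U) = ⊥) :
    Algebra.trdeg K (coordAlg K (graphMap hk L b t)) =
      ((r * d : ℕ) : Cardinal) + Algebra.trdeg K (coordAlg K t) := by
  have := isDomain_range_mvPolynomialToFun (Fin r × Fin d) (coordAlg K t)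
  rw [trdeg_eq_of_sup_adjoin_eq (coordAlg_graphMap_sup_adjoin L b hk t),
    trdeg_range_mvPolynomialToFun]
  · simp
  · rintro _ ⟨q, rfl⟩
    exact exists_mul_fst_mem_coordAlg_graphMap L b hk hy₀ q

end GraphDimension

section DimensionOfCones

universe u

lemma trdeg_polyFun {K : Type*} [Field K] [Infinite K] {W : Type*} [AddCommGroup W] [Module K W]
    [FiniteDimensional K W] : Algebra.trdeg K (polyFun K W) = finrank K W := by
  let b := finBasis K W
  let θ : MvPolynomial (Fin (finrank K W)) K →ₐ[K] W → K :=
    MvPolynomial.aeval fun i w => b.coord i w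
  have heval (P) (w : W) : θ P w = MvPolynomial.eval (fun i => b.coord i w) P :=
    congrArg (· P) (MvPolynomial.comp_aeval (fun i w => b.coord i w) (Pi.evalAlgHom K _ w))
  have hinj : Function.Injective θ := by
    refine (injective_iff_map_eq_zero θ).2 fun P hP => MvPolynomial.funext fun x => ?_
    have hx : (fun i => b.coord i (b.equivFun.symm x)) = x := by
      ext i
      rw [b.coord_apply, ← b.equivFun_apply, LinearEquiv.apply_symm_apply]
    rw [← hx, ← heval, hP, Pi.zero_apply, map_zero]
  have hrange : θ.range = polyFun K W :=
    (Algebra.adjoin_range_eq_range_aeval K fun i w => b.coord i w).symm.trans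
      (coordAlg_eq_adjoin_basis b id).symm
  have h := (AlgEquiv.ofInjective θ hinj).lift_trdeg_eq
  rw [hrange, MvPolynomial.trdeg_of_isDomain] at h
  simpa using h.symm

lemma trdeg_coordAlg_of_surjective {K : Type*} [Field K] [Infinite K] {M W : Type u}
    [AddCommGroup W] [Module K W] [FiniteDimensional K W] {φ : M → W}
    (hφ : Function.Surjective φ) : Algebra.trdeg K (coordAlg K φ) = finrank K W := by
  rw [← trdeg_polyFun]
  exact trdeg_coordAlg_congr φ (id : W → W) fun f _ =>
    (hφ.forall (p := fun w => f w = 0)).symm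

lemma trdeg_coordRing_of_dense {M W : Type u} [AddCommGroup W] [Module ℂ W] {S : Set W}
    (hS : ∀ (c : ℂ), ∀ w ∈ S, c • w ∈ S) {X : Set (ℙ ℂ W)} (hSX : ∀ p : ℙ ℂ W, p.rep ∈ S → p ∈ X)
    (hXS : X ⊆ closure {p | p.rep ∈ S}) {φ : M → W} (hφS : ∀ x, φ x ∈ S)
    (hφ : ∀ (c : ℂ) x, ∃ y, φ y = c • φ x) {x₀ : M} (hx₀ : φ x₀ ≠ 0)
    (hdense : ∀ f ∈ polyFun ℂ W, (∀ x, f (φ x) = 0) → ∀ w ∈ S, f w = 0) :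
    Algebra.trdeg ℂ (coordRing X) = Algebra.trdeg ℂ (coordAlg ℂ φ) := by
  have hmk : ∀ w, w ≠ 0 → w ∈ S → w ∈ cone X := fun w hw hwS =>
    ⟨Projectivization.mk ℂ w hw, hSX _ (rep_mk_mem hS hw hwS), mem_submodule_mk hw⟩
  refine trdeg_coordRing (fun x => ?_) hφ fun d g hg h p hp => ?_
  · by_cases h : φ x = 0
    · obtain ⟨p, hp, -⟩ := hmk _ hx₀ (hφS x₀)
      exact ⟨p, hp, h ▸ zero_mem _⟩
    · exact hmk _ h (hφS x)
  · exact (mem_closure_iff_isForm).1 (hXS hp) d g hg fun q hq => hdense g hg.1 h _ hq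

end DimensionOfCones

section GraphChart

variable {K : Type*} [Field K] {V U : Type*} [AddCommGroup V] [Module K V] [AddCommGroup U]
  [Module K U] {r d m k s : ℕ}

variable (K V) in
/-- The map `secantMap K V s m` with values in `⋀ᵐV`. -/
def gradedSecantMap (s m : ℕ) (y : Fin s → K × (Fin m → V)) : ⋀[K]^m V :=
  ⟨secantMap K V s m y, secantCone_subset_exteriorPower (secantMap_mem_secantCone y)⟩

lemma coe_gradedSecantMap (y : Fin s → K × (Fin m → V)) :
    (gradedSecantMap K V s m y : ExteriorAlgebra K V) = secantMap K V s m y := rfl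

lemma smul_gradedSecantMap (c : K) (y : Fin s → K × (Fin m → V)) :
    gradedSecantMap K V s m (fun i => (c * (y i).1, (y i).2)) = c • gradedSecantMap K V s m y :=
  Subtype.ext (smul_secantMap c y)

lemma hasCoordsIn_polyFun_gradedSecantMap [FiniteDimensional K V] (s m : ℕ) :
    HasCoordsIn (polyFun K (Fin s → K × (Fin m → V))) (gradedSecantMap K V s m) :=
  (hasCoordsIn_polyFun_secantMap s m).of_coe

lemma gradedSecantMap_one_zero_surjective : Function.Surjective (gradedSecantMap K V 1 0) := by
  intro w
  have hw : (w : ExteriorAlgebra K V) ∈ LinearMap.range (ι K) ^ 0 := w.2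
  rw [pow_zero, Submodule.mem_one] at hw
  obtain ⟨c, hc⟩ := hw
  refine ⟨fun _ => (c, 0), Subtype.ext ?_⟩
  simp [coe_gradedSecantMap, secantMap, ← hc, Algebra.algebraMap_eq_smul_one]

variable (L : ((Fin r → K) × U) ≃ₗ[K] V) (b : Basis (Fin d) K U)

lemma smul_graphMap (hk : k = r + m) (c : K) (X : Fin r × Fin d → K)
    (y : Fin s → K × (Fin m → U)) :
    graphMap hk L b (gradedSecantMap K U s m) (X, fun i => (c * (y i).1, (y i).2)) =
      c • graphMap hk L b (gradedSecantMap K U s m) (X, y) := by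
  refine Subtype.ext ?_
  rw [Submodule.coe_smul, coe_graphMap, coe_graphMap, smul_gradedSecantMap, Submodule.coe_smul,
    map_smul, mul_smul_comm]

lemma graphMap_mem_restrictedCone (hk : k = r + m)
    (x : (Fin r × Fin d → K) × (Fin s → K × (Fin m → U))) :
    (graphMap hk L b (gradedSecantMap K U s m) x : ExteriorAlgebra K V) ∈
      restrictedCone K s r m V :=
  ⟨_, _, map_mem_secantCone _ (secantMap_mem_secantCone x.2), rfl⟩

lemma graphMap_ne_zero (hk : k = r + m) {N : Type*} {t : N → ⋀[K]^m U} {y : N} (hy : t y ≠ 0)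
    (X : Fin r × Fin d → K) : graphMap hk L b t (X, y) ≠ 0 := fun h => hy <| Subtype.ext <| by
  rw [← map_graphProj_contractMulti_graphMap L b hk t (X, y), h, Submodule.coe_zero, map_zero,
    map_zero, Submodule.coe_zero]

lemma exists_forall_mem_span_graphFrame {ε : Fin r → V}
    (hε : LinearIndependent K fun j => (L.symm (ε j)).1) :
    ∃ X, ∀ j, ε j ∈ Submodule.span K (range (graphFrame L b X)) := by
  let B : Basis (Fin r) K (Fin r → K) :=
    Basis.mk hε (hε.span_eq_top_of_card_eq_finrank' (by simp)).ge
  let g : (Fin r → K) →ₗ[K] U := B.constr K fun j => (L.symm (ε j)).2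
  let X : Fin r × Fin d → K := fun q => b.repr (g (Pi.single q.1 1)) q.2
  have hg (j : Fin r) : g (L.symm (ε j)).1 = (L.symm (ε j)).2 := by
    simpa [B, g] using B.constr_basis K (fun j => (L.symm (ε j)).2) j
  have hframe (i : Fin r) :
      graphFrame L b X i = (L.toLinearMap ∘ₗ LinearMap.id.prod g) (Pi.single i 1) := by
    simp [graphFrame, X, b.sum_repr]
  refine ⟨X, fun j => ?_⟩
  have hεj : ε j = (L.toLinearMap ∘ₗ LinearMap.id.prod g) (L.symm (ε j)).1 := by
    simp [hg]
  rw [hεj, ← (Pi.basisFun K (Fin r)).sum_repr (L.symm (ε j)).1, map_sum]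
  refine Submodule.sum_mem _ fun i _ => ?_
  rw [map_smul, Pi.basisFun_apply, ← hframe]
  exact Submodule.smul_mem _ _ (Submodule.subset_span (mem_range_self i))

lemma exists_coe_graphMap_eq (hk : k = r + m) {ε : Fin r → V}
    (hε : LinearIndependent K fun j => (L.symm (ε j)).1) (y : Fin s → K × (Fin m → V)) :
    ∃ x, (graphMap hk L b (gradedSecantMap K U s m) x : ExteriorAlgebra K V) =
      ιMulti K r ε * secantMap K V s m y := by
  obtain ⟨X, hX⟩ := exists_forall_mem_span_graphFrame L b hε
  obtain ⟨c, hc⟩ := Submodule.mem_span_singleton.1 (ιMulti_mem_span_singleton hX)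
  obtain ⟨z, hz⟩ := exists_secantMap_eq (smul_mem_secantCone c
    (map_mem_secantCone (graphProj L b X) (secantMap_mem_secantCone y)))
  refine ⟨(X, z), ?_⟩
  rw [coe_graphMap, coe_gradedSecantMap, hz, map_smul, mul_smul_comm, ← hc, smul_mul_assoc,
    ← AlgHom.comp_apply, ExteriorAlgebra.map_comp_map]
  exact congrArg (c • ·) (ιMulti_mul_map (graphProj_section_sub_mem L b X) _)

lemma eq_zero_on_restrictedCone [Infinite K] [FiniteDimensional K V] (hk : k = r + m)
    {f : ⋀[K]^k V → K} (hf : f ∈ polyFun K (⋀[K]^k V))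
    (h0 : ∀ x, f (graphMap hk L b (gradedSecantMap K U s m) x) = 0) {w : ⋀[K]^k V}
    (hw : (w : ExteriorAlgebra K V) ∈ restrictedCone K s r m V) : f w = 0 := by
  obtain ⟨x, hx⟩ := exists_restrictedMap_eq hk hw
  let A (x : (Fin r → V) × (Fin s → K × (Fin m → V))) : Matrix (Fin r) (Fin r) K :=
    Matrix.of fun j => (L.symm (x.1 j)).1
  have hA : (fun x => (A x).det) ∈ polyFun K ((Fin r → V) × (Fin s → K × (Fin m → V))) :=
    det_mem fun i j => Algebra.subset_adjoin ⟨LinearMap.proj j ∘ₗ LinearMap.fst K (Fin r → K) U ∘ₗ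
      L.symm.toLinearMap ∘ₗ LinearMap.proj i ∘ₗ LinearMap.fst K _ _, rfl⟩
  have hA1 : (A (fun i => L (Pi.single i 1, 0), 0)).det ≠ 0 := by
    have : A (fun i => L (Pi.single i 1, 0), 0) = 1 := by
      ext i j
      simp [A, Matrix.one_apply, Pi.single_apply, eq_comm]
    rw [this, Matrix.det_one]
    exact one_ne_zero
  rw [← Subtype.ext hx]
  refine eq_zero_of_eq_zero_on_ne_zero ((hasCoordsIn_polyFun_restrictedMap s hk).comp_mem hf) hA
    (fun x hx => ?_) hA1 x
  obtain ⟨z, hz⟩ := exists_coe_graphMap_eq L b hk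
    (Matrix.linearIndependent_rows_of_det_ne_zero hx) x.2
  rw [← h0 z]
  exact congrArg f (Subtype.ext hz.symm)

end GraphChart

section Dimension

universe u

variable {V U : Type u} [AddCommGroup V] [Module ℂ V] [FiniteDimensional ℂ V] [AddCommGroup U]
  [Module ℂ U] [FiniteDimensional ℂ U] {s r m k : ℕ}

lemma exists_submodule_finrank_eq {K V : Type*} [DivisionRing K] [AddCommGroup V] [Module K V]
    {r : ℕ} (hr : r ≤ finrank K V) : ∃ E : Submodule K V, finrank K E = r :=
  have ⟨u, hu⟩ := exists_linearIndependent_of_le_finrank hr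
  ⟨Submodule.span K (range u), by rw [finrank_span_eq_card hu, Fintype.card_fin]⟩

lemma trdeg_coordRing_of_restrictedCone_dense (hk : k = r + m)
    (hU : r + finrank ℂ U = finrank ℂ V) {y : Fin s → ℂ × (Fin m → U)}
    (hy : annihilator (secantMap ℂ U s m y) = ⊥) (hy0 : secantMap ℂ U s m y ≠ 0)
    {X : Set (ℙ ℂ (⋀[ℂ]^k V))}
    (hX : ∀ p : ℙ ℂ (⋀[ℂ]^k V), (p.rep : ExteriorAlgebra ℂ V) ∈ restrictedCone ℂ s r m V → p ∈ X)
    (hX' : X ⊆ closure {p | (p.rep : ExteriorAlgebra ℂ V) ∈ restrictedCone ℂ s r m V}) :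
    Algebra.trdeg ℂ (coordRing X) = ((r * finrank ℂ U : ℕ) : Cardinal) +
      Algebra.trdeg ℂ (coordAlg ℂ (gradedSecantMap ℂ U s m)) := by
  let L : ((Fin r → ℂ) × U) ≃ₗ[ℂ] V := LinearEquiv.ofFinrankEq _ _ (by simpa using hU)
  let b := finBasis ℂ U
  have : IsDomain (coordAlg ℂ (gradedSecantMap ℂ U s m)) :=
    isDomain_of_le_polyFun (hasCoordsIn_polyFun_gradedSecantMap s m).coordAlg_le
  rw [← trdeg_coordAlg_graphMap L b hk (t := gradedSecantMap ℂ U s m) hy]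
  exact trdeg_coordRing_of_dense
    (S := Subtype.val ⁻¹' restrictedCone ℂ s r m V) (fun c _ => smul_mem_restrictedCone c) hX hX'
    (graphMap_mem_restrictedCone L b hk) (fun c x => ⟨_, smul_graphMap L b hk c x.1 x.2⟩)
    (graphMap_ne_zero L b hk (y := y) (fun h => hy0 (congrArg Subtype.val h)) 0)
    fun f hf h0 w => eq_zero_on_restrictedCone L b hk hf h0

lemma trdeg_coordRing_secantVariety {y : Fin s → ℂ × (Fin m → V)} (hy : secantMap ℂ V s m y ≠ 0) :
    Algebra.trdeg ℂ (coordRing (secantVariety s (grassmannian V m))) =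
      Algebra.trdeg ℂ (coordAlg ℂ (gradedSecantMap ℂ V s m)) := by
  rw [secantVariety_grassmannian_eq_closure]
  refine trdeg_coordRing_of_dense (S := Subtype.val ⁻¹' secantCone ℂ s m V)
    (fun c _ => smul_mem_secantCone c) (fun p hp => subset_closure hp) le_rfl
    secantMap_mem_secantCone (fun c x => ⟨_, smul_gradedSecantMap c x⟩)
    (fun h => hy (congrArg Subtype.val h)) fun f _ h0 w hw => ?_
  obtain ⟨y, hy⟩ := exists_secantMap_eq hw
  rw [← h0 y]
  exact congrArg f (Subtype.ext hy.symm)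

lemma projDim_restrictedSecant (hk : k = r + m) (hU : r + finrank ℂ U = finrank ℂ V)
    {y : Fin s → ℂ × (Fin m → U)} (hy : annihilator (secantMap ℂ U s m y) = ⊥)
    (hy0 : secantMap ℂ U s m y ≠ 0) :
    projDim (restrictedSecant V s r k) =
      (r * finrank ℂ U : ℕ) + projDim (secantVariety s (grassmannian U m)) := by
  have hX := restrictedSecant_eq_closure (V := V) (s := s) hk
  rw [projDim, projDim, trdeg_coordRing_secantVariety hy0,
    trdeg_coordRing_of_restrictedCone_dense hk hU hy hy0 (fun p hp => hX ▸ subset_closure hp) hX.le,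
    Cardinal.toNat_add Cardinal.natCast_lt_aleph0 (trdeg_coordAlg_lt_aleph0 _),
    Cardinal.toNat_natCast]
  push_cast
  ring

lemma mem_restrictedCone_one_zero_iff {K V : Type*} [Field K] [AddCommGroup V] [Module K V]
    {w : ExteriorAlgebra K V} : w ∈ restrictedCone K 1 m 0 V ↔ w ∈ decomposables K m V := by
  constructor
  · rintro ⟨v, t, ⟨a, ha, rfl⟩, rfl⟩
    obtain ⟨c, u, hu⟩ := ha 0
    exact ⟨c, v, by simp [hu]⟩
  · rintro ⟨c, v, rfl⟩
    exact ⟨v, c • 1, ⟨fun _ => c • 1, fun _ => ⟨c, 0, by simp⟩, by simp⟩, by simp⟩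

lemma annihilator_one {K V : Type*} [Field K] [AddCommGroup V] [Module K V] :
    annihilator (1 : ExteriorAlgebra K V) = ⊥ := by
  ext v
  rw [mem_annihilator, mul_one, ExteriorAlgebra.ι_eq_zero_iff, Submodule.mem_bot]

lemma projDim_grassmannian (hm : m ≤ finrank ℂ V) :
    projDim (grassmannian V m) = (m * (finrank ℂ V - m) : ℕ) := by
  obtain ⟨E, hE⟩ := exists_submodule_finrank_eq hm
  have hquot := E.finrank_quotient_add_finrank
  rw [hE] at hquot
  have hone : secantMap ℂ (V ⧸ E) 1 0 (fun _ => (1, 0)) = 1 := by simp [secantMap]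
  have hcone (p : ℙ ℂ (⋀[ℂ]^m V)) : p ∈ grassmannian V m ↔
      (p.rep : ExteriorAlgebra ℂ V) ∈ restrictedCone ℂ 1 m 0 V :=
    mem_grassmannian_iff.trans mem_restrictedCone_one_zero_iff.symm
  rw [projDim, trdeg_coordRing_of_restrictedCone_dense (add_zero m).symm
      (by rwa [add_comm] at hquot) (hone.symm ▸ annihilator_one) (hone.symm ▸ one_ne_zero)
      (fun p => (hcone p).2)
      fun p hp => subset_closure ((hcone p).1 hp),
    trdeg_coordAlg_of_surjective gradedSecantMap_one_zero_surjective, exteriorPower.finrank_eq,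
    Nat.choose_zero_right, ← Nat.cast_add, Cardinal.toNat_natCast, ← hquot, Nat.add_sub_cancel]
  push_cast
  ring

end Dimension

section JacobianCriterion

variable {R : Type*} [CommRing R] {κ : Type*} {P : MvPolynomial κ R} {d : ℕ}

lemma aeval_X_mul_of_isHomogeneous (hP : P.IsHomogeneous d) (q : κ → Polynomial R) :
    MvPolynomial.aeval (fun i => Polynomial.X * q i) P =
      Polynomial.X ^ d * MvPolynomial.aeval q P := by
  simp only [MvPolynomial.aeval_def, MvPolynomial.eval₂_eq, Finset.mul_sum]
  refine Finset.sum_congr rfl fun a ha => ?_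
  have hd : ∑ i ∈ a.support, a i = d := by
    simpa [Finsupp.weight_apply, Finsupp.sum] using hP (MvPolynomial.mem_support_iff.1 ha)
  simp only [mul_pow, Finset.prod_mul_distrib, Finset.prod_pow_eq_pow_sum, hd]
  ring

lemma X_pow_succ_dvd_aeval_X_mul_sub (hP : ∀ e < d, P.homogeneousComponent e = 0)
    (q : κ → Polynomial R) :
    Polynomial.X ^ (d + 1) ∣ MvPolynomial.aeval (fun i => Polynomial.X * q i) P -
      Polynomial.X ^ d * MvPolynomial.aeval q (P.homogeneousComponent d) := by
  have hsum : MvPolynomial.aeval (fun i => Polynomial.X * q i) P =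
      ∑ e ∈ Finset.range (max d P.totalDegree + 1),
        Polynomial.X ^ e * MvPolynomial.aeval q (P.homogeneousComponent e) := by
    conv_lhs => rw [← MvPolynomial.sum_homogeneousComponent P]
    rw [map_sum, ← Finset.sum_subset (Finset.range_mono (Nat.succ_le_succ (le_max_right _ _)))]
    · exact Finset.sum_congr rfl fun e _ =>
        aeval_X_mul_of_isHomogeneous (MvPolynomial.homogeneousComponent_isHomogeneous _ P) q
    · intro e _ he
      rw [MvPolynomial.homogeneousComponent_eq_zero _ _ (by simpa using he), map_zero, mul_zero]
  rw [hsum, ← Finset.add_sum_erase _ _ (Finset.mem_range.2 (Nat.lt_succ_of_le (le_max_left _ _))),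
    add_sub_cancel_left]
  refine Finset.dvd_sum fun e he => ?_
  rcases lt_or_gt_of_ne (Finset.ne_of_mem_erase he) with h | h
  · simp [hP e h]
  · exact (pow_dvd_pow _ h).mul_right _

lemma eval_aeval_polynomial (P : MvPolynomial κ R) (q : κ → Polynomial R) (s : R) :
    (MvPolynomial.aeval q P).eval s = MvPolynomial.eval (fun i => (q i).eval s) P := by
  simpa [MvPolynomial.aeval_eq_eval, Polynomial.coe_aeval_eq_eval] using
    MvPolynomial.comp_aeval_apply q (Polynomial.aeval s) P

variable {K : Type*} [Field K] {M : Type*} [AddCommGroup M] [Module K M] {x : M}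

/-- `D` is the differential at `x` of the function `f`, whose restriction to every line through `x`
is a polynomial. -/
def IsDifferentialAt (f : M → K) (D : Dual K M) (x : M) : Prop :=
  ∀ u, ∃ q : Polynomial K, q.eval 0 = D u ∧ ∀ s : K, f (x + s • u) = f x + s * q.eval s

lemma exists_isDifferentialAt {f : M → K} (hf : f ∈ polyFun K M) (x : M) :
    ∃ D, IsDifferentialAt f D x := by
  induction hf using Algebra.adjoin_induction with
  | mem _ hf =>
    obtain ⟨ℓ, rfl⟩ := hf
    exact ⟨ℓ, fun u => ⟨Polynomial.C (ℓ u), by simp, fun s => by simp⟩⟩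
  | algebraMap a => exact ⟨0, fun u => ⟨0, by simp, fun s => by simp⟩⟩
  | add g h _ _ hg hh =>
    obtain ⟨D, hD⟩ := hg
    obtain ⟨D', hD'⟩ := hh
    refine ⟨D + D', fun u => ?_⟩
    obtain ⟨p, hp, hp'⟩ := hD u
    obtain ⟨q, hq, hq'⟩ := hD' u
    exact ⟨p + q, by simp [hp, hq], fun s => by simp [hp', hq']; ring⟩
  | mul g h _ _ hg hh =>
    obtain ⟨D, hD⟩ := hg
    obtain ⟨D', hD'⟩ := hh
    refine ⟨g x • D' + h x • D, fun u => ?_⟩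
    obtain ⟨p, hp, hp'⟩ := hD u
    obtain ⟨q, hq, hq'⟩ := hD' u
    exact ⟨Polynomial.C (g x) * q + Polynomial.C (h x) * p + Polynomial.X * p * q,
      by simp [hp, hq], fun s => by simp [hp', hq']; ring⟩

variable [Infinite K]

lemma IsDifferentialAt.apply_eq {f : M → K} {D : Dual K M} (hD : IsDifferentialAt f D x) {u : M}
    {c : K} (hu : ∀ s : K, f (x + s • u) = f x + s * c) : D u = c := by
  obtain ⟨q, hq, hq'⟩ := hD u
  have hline : Polynomial.X * q = Polynomial.X * Polynomial.C c := Polynomial.funext fun s => by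
    rw [Polynomial.eval_mul, Polynomial.eval_mul, Polynomial.eval_X, Polynomial.eval_C]
    exact add_left_cancel ((hq' s).symm.trans (hu s))
  rw [← hq, mul_left_cancel₀ Polynomial.X_ne_zero hline, Polynomial.eval_C]

/-- Along the curves `s ↦ s • q s` the lowest nonzero homogeneous component of `P` dominates. -/
lemma eq_zero_of_aeval_X_mul {P : MvPolynomial κ K}
    (h : ∀ z : κ → K, ∃ q : κ → Polynomial K, (∀ i, (q i).eval 0 = z i) ∧
      MvPolynomial.aeval (fun i => Polynomial.X * q i) P = 0) : P = 0 := by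
  have hzero (d : ℕ) : P.homogeneousComponent d = 0 := by
    induction d using Nat.strong_induction_on with
    | _ d ih =>
      refine MvPolynomial.funext fun z => ?_
      obtain ⟨q, hq, hqP⟩ := h z
      have hdvd := X_pow_succ_dvd_aeval_X_mul_sub ih q
      rw [hqP, zero_sub, dvd_neg, pow_succ,
        mul_dvd_mul_iff_left (pow_ne_zero _ Polynomial.X_ne_zero), Polynomial.X_dvd_iff,
        Polynomial.coeff_zero_eq_eval_zero, eval_aeval_polynomial] at hdvd
      simpa only [hq, map_zero] using hdvd
  rw [← MvPolynomial.sum_homogeneousComponent P, Finset.sum_eq_zero fun d _ => hzero d]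

lemma algebraicIndependent_of_isDifferentialAt {f : κ → M → K} {D : κ → Dual K M}
    (hD : ∀ i, IsDifferentialAt (f i) (D i) x) (hx : ∀ i, f i x = 0)
    (hsurj : ∀ z : κ → K, ∃ v, ∀ i, D i v = z i) : AlgebraicIndependent K f := by
  refine algebraicIndependent_iff.2 fun P hP => eq_zero_of_aeval_X_mul fun z => ?_
  obtain ⟨v, hv⟩ := hsurj z
  choose q hq hq' using fun i => hD i v
  refine ⟨q, fun i => (hq i).trans (hv i), Polynomial.funext fun s => ?_⟩
  have heval := MvPolynomial.comp_aeval_apply f (Pi.evalAlgHom K (fun _ : M => K) (x + s • v)) P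
  rw [hP, map_zero] at heval
  rw [eval_aeval_polynomial, Polynomial.eval_zero, heval]
  simp [hq', hx, MvPolynomial.aeval_eq_eval]

end JacobianCriterion

section TangentRank

variable {K : Type*} [Field K] [Infinite K] {M W : Type*} [AddCommGroup M] [Module K M]
  [AddCommGroup W] [Module K W]

lemma card_le_trdeg_coordAlg {φ : M → W} (hφ : HasCoordsIn (polyFun K M) φ) {κ : Type*} [Fintype κ]
    {x : M} {u : κ → M} {v : κ → W} (huv : ∀ j (s : K), φ (x + s • u j) = φ x + s • v j)
    (hv : LinearIndependent K v) :
    (Fintype.card κ : Cardinal) ≤ Algebra.trdeg K (coordAlg K φ) := by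
  classical
  obtain ⟨ℓ, hℓ⟩ := exists_dual_family hv
  let f (i : κ) : coordAlg K φ :=
    ⟨fun y => ℓ i (φ y), hasCoordsIn_coordAlg φ (ℓ i)⟩ - algebraMap K _ (ℓ i (φ x))
  have hf (i : κ) (y : M) : (f i : M → K) y = ℓ i (φ y) - ℓ i (φ x) := rfl
  choose D hD using fun i => exists_isDifferentialAt (hφ.coordAlg_le (f i).2) x
  have hDu (i j : κ) : D i (u j) = if i = j then 1 else 0 := (hD i).apply_eq fun s => by
    simp only [hf, huv, map_add, map_smul, hℓ, smul_eq_mul]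
    ring
  have hind : AlgebraicIndependent K ((coordAlg K φ).val ∘ f) :=
    algebraicIndependent_of_isDifferentialAt hD (fun i => sub_self _) fun z =>
      ⟨∑ j, z j • u j, fun i => by simp [hDu]⟩
  simpa using (hind.of_comp (coordAlg K φ).val).lift_cardinalMk_le_trdeg

end TangentRank

section ExteriorBasis

variable {K : Type*} [Field K] {W : Type*} [AddCommGroup W] [Module K W] {κ γ : Type*} {m : ℕ}

lemma linearIndependent_ιMulti_of_injective_range (b : Basis κ K W) {f : γ → Fin m → κ}
    (hf : ∀ i, Function.Injective (f i)) (hrange : Function.Injective fun i => range (f i)) :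
    LinearIndependent K fun i => exteriorPower.ιMulti K m (b ∘ f i) := by
  classical
  let ℓ (i : γ) : Dual K (⋀[K]^m W) :=
    exteriorPower.pairingDual K W m (exteriorPower.ιMulti K m fun a => b.coord (f i a))
  have hℓ (i j : γ) : ℓ i (exteriorPower.ιMulti K m (b ∘ f j)) =
      (Matrix.of fun a c => if f j a = f i c then (1 : K) else 0).det := by
    simp [ℓ, exteriorPower.pairingDual_ιMulti_ιMulti, Finsupp.single_apply]
  have hself (i : γ) : ℓ i (exteriorPower.ιMulti K m (b ∘ f i)) = 1 := by
    rw [hℓ, ← Matrix.det_one (n := Fin m)]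
    congr 1
    ext a c
    simp [(hf i).eq_iff, Matrix.one_apply]
  have hne {i j : γ} (hij : j ≠ i) : ℓ i (exteriorPower.ιMulti K m (b ∘ f j)) = 0 := by
    obtain ⟨c, hc⟩ : ∃ c, f i c ∉ range (f j) := by
      by_contra! h
      refine hij (hrange (Set.eq_of_subset_of_ncard_le (range_subset_iff.2 h) ?_)).symm
      rw [ncard_range_of_injective (hf i), ncard_range_of_injective (hf j)]
    rw [hℓ]
    exact Matrix.det_eq_zero_of_column_eq_zero c fun a => if_neg fun h => hc ⟨a, h⟩
  refine linearIndependent_iff'.2 fun t g hg i hi => ?_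
  have hi' := congrArg (ℓ i) hg
  rw [map_sum, map_zero, Finset.sum_eq_single_of_mem i hi fun j _ hij => by
    rw [map_smul, hne hij, smul_zero]] at hi'
  simpa [hself] using hi'

end ExteriorBasis

section TangentSpace

variable {K : Type*} [Field K] {W : Type*} [AddCommGroup W] [Module K W] {κ : Type*} {s m : ℕ}

lemma gradedSecantMap_eq_sum (y : Fin s → K × (Fin m → W)) :
    gradedSecantMap K W s m y = ∑ i, (y i).1 • exteriorPower.ιMulti K m (y i).2 :=
  Subtype.ext (by simp [coe_gradedSecantMap, secantMap])

lemma gradedSecantMap_add_single (y : Fin s → K × (Fin m → W)) (c : Fin s)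
    (z : K × (Fin m → W)) : gradedSecantMap K W s m (y + Pi.single c z) =
      gradedSecantMap K W s m y + ((y c + z).1 • exteriorPower.ιMulti K m (y c + z).2 -
        (y c).1 • exteriorPower.ιMulti K m (y c).2) := by
  rw [← sub_eq_iff_eq_add', gradedSecantMap_eq_sum, gradedSecantMap_eq_sum,
    ← Finset.sum_sub_distrib, Finset.sum_eq_single_of_mem c (Finset.mem_univ c)]
  · rw [Pi.add_apply, Pi.single_eq_same]
  · intro i _ hi
    rw [Pi.add_apply, Pi.single_eq_of_ne hi, add_zero, sub_self]

lemma gradedSecantMap_add_smul_single_one (y : Fin s → K × (Fin m → W)) (c : Fin s) (a : K) :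
    gradedSecantMap K W s m (y + a • Pi.single (M := fun _ => K × (Fin m → W)) c (1, 0)) =
      gradedSecantMap K W s m y + a • exteriorPower.ιMulti K m (y c).2 := by
  rw [← Pi.single_smul, gradedSecantMap_add_single]
  simp [add_smul]

lemma gradedSecantMap_add_smul_single_single (y : Fin s → K × (Fin m → W)) {c : Fin s}
    (hy : (y c).1 = 1) (p : Fin m) (w : W) (a : K) :
    gradedSecantMap K W s m
        (y + a • Pi.single (M := fun _ => K × (Fin m → W)) c (0, Pi.single p w)) =
      gradedSecantMap K W s m y + a • exteriorPower.ιMulti K m (Function.update (y c).2 p w) := by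
  have hupdate : (y c).2 + a • Pi.single (M := fun _ => W) p w =
      Function.update (y c).2 p ((y c).2 p + a • w) := by
    ext i
    rcases eq_or_ne i p with rfl | hi
    · simp
    · simp [hi]
  rw [← Pi.single_smul, gradedSecantMap_add_single]
  simp [hy, hupdate, AlternatingMap.map_update_add, AlternatingMap.map_update_smul]

/-- The index frames of the tangent space of the `s`-th secant cone at the sum of the products
`b (A c 1) ∧ ⋯ ∧ b (A c m)`: the frames `A c` and those arising from them by exchanging one
index. -/
def tangentFrame (A : Fin s → Fin m → κ) :
    (Σ c : Fin s, Option (Fin m × ↥(range (A c))ᶜ)) → Fin m → κ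
  | ⟨c, none⟩ => A c
  | ⟨c, some (p, x)⟩ => Function.update (A c) p x

lemma mem_range_update_iff {a : Fin m → κ} {p : Fin m} {x k : κ} :
    k ∈ range (Function.update a p x) ↔ k = x ∨ ∃ i ≠ p, a i = k := by
  constructor
  · rintro ⟨i, rfl⟩
    rcases eq_or_ne i p with rfl | hi
    · exact Or.inl (Function.update_self ..)
    · exact Or.inr ⟨i, hi, (Function.update_of_ne hi ..).symm⟩
  · rintro (rfl | ⟨i, hi, rfl⟩)
    · exact ⟨p, Function.update_self ..⟩
    · exact ⟨i, Function.update_of_ne hi ..⟩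

lemma injective_update_of_notMem_range {a : Fin m → κ} (ha : Function.Injective a) (p : Fin m)
    {x : κ} (hx : x ∉ range a) : Function.Injective (Function.update a p x) := by
  intro i j hij
  by_cases hi : i = p <;> by_cases hj : j = p <;> simp_all [ha.eq_iff]

variable {A : Fin s → Fin m → κ}

lemma injective_of_injective_uncurry (hA : Function.Injective (Function.uncurry A)) (c : Fin s) :
    Function.Injective (A c) :=
  hA.comp (Prod.mk_right_injective c)

lemma tangentFrame_injective (hA : Function.Injective (Function.uncurry A)) :
    ∀ j, Function.Injective (tangentFrame A j)
  | ⟨c, none⟩ => injective_of_injective_uncurry hA c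
  | ⟨c, some (p, x)⟩ => injective_update_of_notMem_range (injective_of_injective_uncurry hA c) p x.2

lemma exists_ne_mem_range_tangentFrame (hm : 3 ≤ m)
    (j : Σ c : Fin s, Option (Fin m × ↥(range (A c))ᶜ)) :
    ∃ i i', i ≠ i' ∧ A j.1 i ∈ range (tangentFrame A j) ∧ A j.1 i' ∈ range (tangentFrame A j) := by
  obtain ⟨c, _ | ⟨p, x⟩⟩ := j
  · exact ⟨⟨0, by omega⟩, ⟨1, by omega⟩, by simp, mem_range_self _, mem_range_self _⟩
  · have hcard : 1 < (Finset.univ.erase p).card := by simp; omega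
    obtain ⟨i, hi, i', hi', hne⟩ := Finset.one_lt_card.1 hcard
    exact ⟨i, i', hne, mem_range_update_iff.2 (Or.inr ⟨i, Finset.ne_of_mem_erase hi, rfl⟩),
      mem_range_update_iff.2 (Or.inr ⟨i', Finset.ne_of_mem_erase hi', rfl⟩)⟩

/-- For `3 ≤ m` a frame shares at least two indices with the `A c` it arises from, and at most one
with every other one. -/
lemma fst_eq_of_range_tangentFrame_eq (hA : Function.Injective (Function.uncurry A))
    (hm : 3 ≤ m) {j j'} (h : range (tangentFrame A j) = range (tangentFrame A j')) :
    j.1 = j'.1 := by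
  obtain ⟨i, i', hne, hi, hi'⟩ := exists_ne_mem_range_tangentFrame hm j
  have hAj {i k} (hik : A j'.1 k = A j.1 i) : j.1 = j'.1 :=
    (congrArg Prod.fst (hA (a₁ := (j'.1, k)) (a₂ := (j.1, i)) hik)).symm
  rw [h] at hi hi'
  obtain ⟨c, _ | ⟨p, x⟩⟩ := j'
  · exact hAj hi.choose_spec
  · rcases mem_range_update_iff.1 hi, mem_range_update_iff.1 hi' with
      ⟨hx | ⟨k, -, hk⟩, hx' | ⟨k', -, hk'⟩⟩
    · exact absurd (injective_of_injective_uncurry hA _ (hx.trans hx'.symm)) hne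
    · exact hAj hk'
    · exact hAj hk
    · exact hAj hk

lemma range_tangentFrame_injective (hA : Function.Injective (Function.uncurry A))
    (hm : 3 ≤ m) :
    Function.Injective fun j => range (tangentFrame A j) := by
  intro j j' h
  have hfst := fst_eq_of_range_tangentFrame_eq hA hm h
  obtain ⟨c, o⟩ := j
  obtain ⟨c', o'⟩ := j'
  obtain rfl : c = c' := hfst
  have hnotMem {p x} : A c p ∉ range (tangentFrame A ⟨c, some (p, x)⟩) := fun hp => by
    rcases mem_range_update_iff.1 hp with hp | ⟨i, hi, hp⟩
    · exact x.2 ⟨p, hp⟩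
    · exact hi (injective_of_injective_uncurry hA c hp)
  have hmem {p x} : (x : κ) ∈ range (tangentFrame A ⟨c, some (p, x)⟩) :=
    mem_range_update_iff.2 (Or.inl rfl)
  rcases o with _ | ⟨p, x⟩ <;> rcases o' with _ | ⟨p', x'⟩
  · rfl
  · exact absurd (h.ge hmem) x'.2
  · exact absurd (h.le hmem) x.2
  · have hx : x = x' := (mem_range_update_iff.1 (h.le hmem)).elim Subtype.ext
      fun ⟨i, _, hi⟩ => absurd ⟨i, hi⟩ x.2
    have hp : p = p' := by
      by_contra hp
      exact hnotMem (h.ge (mem_range_update_iff.2 (Or.inr ⟨p, hp, rfl⟩)))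
    rw [hx, hp]

lemma card_tangentFrame_index [Finite κ] (hA : Function.Injective (Function.uncurry A)) :
    Nat.card (Σ c : Fin s, Option (Fin m × ↥(range (A c))ᶜ)) =
      s * (m * (Nat.card κ - m) + 1) := by
  have hcompl (c : Fin s) : (range (A c))ᶜ.ncard = Nat.card κ - m := by
    rw [ncard_compl, ncard_range_of_injective (injective_of_injective_uncurry hA c), Nat.card_fin]
  simp only [Nat.card_sigma, Finite.card_option, Nat.card_prod, Nat.card_fin, Nat.card_coe_set_eq,
    hcompl, Finset.sum_const, Finset.card_univ, Fintype.card_fin, smul_eq_mul]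

end TangentSpace

section SecantDimension

variable {K : Type*} [Field K] [Infinite K] {W : Type*} [AddCommGroup W] [Module K W]
  [FiniteDimensional K W] {s m : ℕ}

lemma le_trdeg_coordAlg_gradedSecantMap (hm : 3 ≤ m) (hs : s * m ≤ finrank K W) :
    ((s * (m * (finrank K W - m) + 1) : ℕ) : Cardinal) ≤
      Algebra.trdeg K (coordAlg K (gradedSecantMap K W s m)) := by
  classical
  let b := finBasis K W
  obtain ⟨e⟩ : Nonempty (Fin s × Fin m ↪ Fin (finrank K W)) :=
    Function.Embedding.nonempty_of_card_le (by simpa using hs)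
  let A (c : Fin s) (i : Fin m) := e (c, i)
  have hA : Function.Injective (Function.uncurry A) := e.injective
  let y : Fin s → K × (Fin m → W) := fun c => (1, b ∘ A c)
  let u : (Σ c : Fin s, Option (Fin m × ↥(range (A c))ᶜ)) →
      Fin s → K × (Fin m → W)
    | ⟨c, none⟩ => Pi.single c (1, 0)
    | ⟨c, some (p, x)⟩ => Pi.single c (0, Pi.single p (b x))
  have hu (j) (a : K) : gradedSecantMap K W s m (y + a • u j) =
      gradedSecantMap K W s m y + a • exteriorPower.ιMulti K m (b ∘ tangentFrame A j) := by
    obtain ⟨c, _ | ⟨p, x⟩⟩ := j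
    · exact gradedSecantMap_add_smul_single_one y c a
    · rw [tangentFrame, Function.comp_update]
      exact gradedSecantMap_add_smul_single_single y rfl p _ a
  have hle := card_le_trdeg_coordAlg (hasCoordsIn_polyFun_gradedSecantMap s m) hu
    (linearIndependent_ιMulti_of_injective_range b (tangentFrame_injective hA)
      (range_tangentFrame_injective hA hm))
  rwa [← Nat.card_eq_fintype_card, card_tangentFrame_index hA, Nat.card_fin] at hle

end SecantDimension

section SmallCodimension

variable {K : Type*} [Field K] {V : Type*} [AddCommGroup V] [Module K V]

lemma decomposables_subset_secantCone (s m : ℕ) :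
    decomposables K m V ⊆ secantCone K (s + 1) m V := by
  refine fun w hw => ⟨Pi.single 0 w, fun i => ?_, by simp⟩
  rw [Pi.single_apply]
  split_ifs
  exacts [hw, zero_mem_decomposables m]

lemma decomposables_subset_restrictedCone {s r m k : ℕ} (hk : k = r + m) :
    decomposables K k V ⊆ restrictedCone K (s + 1) r m V := by
  subst hk
  rintro _ ⟨c, v, rfl⟩
  refine ⟨v ∘ Fin.castAdd m, c • ιMulti K m (v ∘ Fin.natAdd r),
    decomposables_subset_secantCone s m ⟨c, _, rfl⟩, ?_⟩
  rw [mul_smul_comm, ExteriorAlgebra.ιMulti_mul_ιMulti]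
  congr 2
  exact Fin.append_castAdd_natAdd.symm

lemma mem_decomposables_of_le_finrank_annihilator [FiniteDimensional K V] {k : ℕ}
    {w : ExteriorAlgebra K V} (hw : w ∈ ⋀[K]^k V) (hann : k ≤ finrank K (annihilator w)) :
    w ∈ decomposables K k V := by
  obtain ⟨e, he, hew⟩ := exists_linearIndependent_mem hann
  obtain ⟨φ, hφ⟩ := exists_dual_family he
  have hscalar : contractMulti k φ w ∈ LinearMap.range (ι K (M := V)) ^ 0 :=
    contractMulti_mem_exteriorPower (add_zero k).symm φ hw
  obtain ⟨c, hc⟩ := Submodule.mem_one.1 (pow_zero (LinearMap.range (ι K (M := V))) ▸ hscalar)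
  refine ⟨c, e, ?_⟩
  rw [eq_ιMulti_mul_contractMulti hφ hew, ← hc, ← Algebra.commutes, ← Algebra.smul_def]

/-- The annihilator of `w` is the kernel of `v ↦ v ∧ w`, whose target `⋀ᵏ⁺¹V` is at most a line,
and vanishes if `dim V = k`. -/
lemma le_finrank_annihilator_of_finrank_le [FiniteDimensional K V] {k : ℕ} (hk : k ≤ finrank K V)
    (hV : finrank K V ≤ k + 1) {w : ExteriorAlgebra K V} (hw : w ∈ ⋀[K]^k V) :
    k ≤ finrank K (annihilator w) := by
  let T : V →ₗ[K] ⋀[K]^(k + 1) V :=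
    (LinearMap.mulRight K w ∘ₗ ι K).codRestrict _ fun v => by
      have h := ιMulti_mul_mem_exteriorPower (add_comm k 1) (fun _ : Fin 1 => v) hw
      rwa [ExteriorAlgebra.ιMulti_succ_apply, ExteriorAlgebra.ιMulti_zero_apply, mul_one] at h
  have hker : LinearMap.ker T = annihilator w := LinearMap.ker_codRestrict _ _ _
  have hadd := LinearMap.finrank_range_add_finrank_ker T
  have hrange : finrank K (LinearMap.range T) ≤ (finrank K V).choose (k + 1) :=
    (Submodule.finrank_le _).trans_eq (exteriorPower.finrank_eq ..)
  rw [← hker]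
  rcases hV.lt_or_eq with h | h
  · rw [Nat.choose_eq_zero_of_lt h] at hrange
    omega
  · rw [h, Nat.choose_self] at hrange
    omega

end SmallCodimension

section FullSecants

universe u

lemma projDim_univ {W : Type u} [AddCommGroup W] [Module ℂ W] [FiniteDimensional ℂ W]
    [Nontrivial W] : projDim (univ : Set (ℙ ℂ W)) = (finrank ℂ W : ℤ) - 1 := by
  obtain ⟨w, hw⟩ := exists_ne (0 : W)
  rw [projDim, trdeg_coordRing_of_dense (S := univ) (φ := (id : W → W)) (x₀ := w)
    (fun _ _ _ => mem_univ _) (fun _ _ => mem_univ _) (fun p _ => subset_closure (mem_univ p.rep))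
    (fun _ => mem_univ _) (fun c x => ⟨c • x, rfl⟩) hw fun f _ h x _ => h x,
    trdeg_coordAlg_of_surjective Function.surjective_id, Cardinal.toNat_natCast]

lemma projDim_restrictedSecant_of_finrank_le {V : Type u} [AddCommGroup V] [Module ℂ V]
    [FiniteDimensional ℂ V] {s r k : ℕ} (hr : r ≤ k) (hk : k ≤ finrank ℂ V)
    (hV : finrank ℂ V ≤ k + 1) :
    projDim (restrictedSecant V (s + 1) r k) = ((finrank ℂ V).choose k : ℤ) - 1 := by
  have huniv : restrictedSecant V (s + 1) r k = univ := by
    have hkm : k = r + (k - r) := by omega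
    rw [restrictedSecant_eq_closure hkm]
    exact eq_univ_of_forall fun p => subset_closure <| decomposables_subset_restrictedCone hkm <|
      mem_decomposables_of_le_finrank_annihilator p.rep.2 <|
        le_finrank_annihilator_of_finrank_le hk hV p.rep.2
  have hfin : finrank ℂ (⋀[ℂ]^k V) = (finrank ℂ V).choose k := exteriorPower.finrank_eq ..
  have : Nontrivial (⋀[ℂ]^k V) :=
    Module.nontrivial_of_finrank_pos (R := ℂ) (hfin ▸ Nat.choose_pos hk)
  rw [huniv, projDim_univ, hfin]

end FullSecants

section SecantDefect

universe u

variable {V : Type u} [AddCommGroup V] [Module ℂ V] [FiniteDimensional ℂ V]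

lemma secantVirtualDim_le_projDim {s m : ℕ} (hm : 3 ≤ m) (hs : (s + 1) * m ≤ finrank ℂ V) :
    secantVirtualDim (s + 1) (grassmannian V m) ≤
      projDim (secantVariety (s + 1) (grassmannian V m)) := by
  have hmV : m ≤ finrank ℂ V := (Nat.le_mul_of_pos_left m s.succ_pos).trans hs
  obtain ⟨v, hv, -⟩ := exists_linearIndependent_mem (S := (⊤ : Submodule ℂ V)) (r := m)
    (by rwa [finrank_top])
  obtain ⟨y, hy⟩ := exists_secantMap_eq
    (decomposables_subset_secantCone s m (ιMulti_mem_decomposables (K := ℂ) v))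
  have hrank := Cardinal.toNat_le_toNat (le_trdeg_coordAlg_gradedSecantMap (K := ℂ) hm hs)
    (trdeg_coordAlg_lt_aleph0 _)
  rw [Cardinal.toNat_natCast, ← trdeg_coordRing_secantVariety (hy ▸ ιMulti_ne_zero hv)] at hrank
  rw [secantVirtualDim, projDim_grassmannian hmV, projDim]
  zify at hrank
  push_cast
  linarith

end SecantDefect

section ChordalVarieties

universe u

variable {V : Type u} [AddCommGroup V] [Module ℂ V] [FiniteDimensional ℂ V] {r m k : ℕ}

lemma exists_secantMap_ne_zero_and_annihilator_eq_bot (hm : 2 ≤ m) (hV : 2 * m ≤ finrank ℂ V) :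
    ∃ y, secantMap ℂ V 2 m y ≠ 0 ∧ annihilator (secantMap ℂ V 2 m y) = ⊥ := by
  have : Nontrivial V := Module.nontrivial_of_finrank_pos (R := ℂ) (by omega)
  obtain ⟨y, hy⟩ := exists_annihilator_secantMap_eq_bot hm hV
  exact ⟨y, ne_zero_of_annihilator_eq_bot hy, hy⟩

/-- Where the annihilator of `p` has dimension `r`, it is the only `E` that occurs in the fiber. -/
lemma exists_isOpen_fiber_finite (hk : k = r + m) (hm : 2 ≤ m) (hV : r + 2 * m ≤ finrank ℂ V) :
    ∃ U : Set (ℙ ℂ (⋀[ℂ]^k V)), IsOpen U ∧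
      restrictedSecant V 2 r k ⊆ closure (U ∩ restrictedSecant V 2 r k) ∧
      ∀ p ∈ U ∩ restrictedSecant V 2 r k,
        (incidenceVariety V 2 r k ∩ Prod.snd ⁻¹' {p}).Finite := by
  obtain ⟨E, hE⟩ : ∃ E : Submodule ℂ V, finrank ℂ E = r := exists_submodule_finrank_eq (by omega)
  have hquot := E.finrank_quotient_add_finrank
  obtain ⟨y, hy0, hy⟩ :=
    exists_secantMap_ne_zero_and_annihilator_eq_bot (m := m) (V := V ⧸ E) hm (by omega)
  obtain ⟨w, hw, hw0, hann⟩ :=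
    exists_mem_restrictedCone_finrank_annihilator_le hE (secantMap_mem_secantCone y) hy0 hy
  refine ⟨_, (isClosed_setOf_le_finrank_annihilator k (r + 1)).isOpen_compl, ?_, fun p hp =>
    finite_incidenceVariety_fiber (by omega) (Nat.lt_succ_iff.1 (not_le.1 hp.1))⟩
  rw [inter_comm, ← sdiff_eq]
  exact restrictedSecant_subset_closure_diff hk hw hw0 hann

lemma projDim_restrictedSecant_two (hk : k = r + m) (hm : 2 ≤ m) (hV : r + 2 * m ≤ finrank ℂ V)
    {E : Submodule ℂ V} (hE : finrank ℂ E = r) :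
    projDim (restrictedSecant V 2 r k) = (r * (finrank ℂ V - r) : ℤ) +
      projDim (secantVariety 2 (grassmannian (V ⧸ E) m)) := by
  have hquot := E.finrank_quotient_add_finrank
  obtain ⟨y, hy0, hy⟩ :=
    exists_secantMap_ne_zero_and_annihilator_eq_bot (V := V ⧸ E) hm (by omega)
  rw [projDim_restrictedSecant hk (by omega) hy hy0, ← hquot, hE]
  push_cast
  ring

lemma restrictedVirtualDim_sub_projDim (hk : k = r + m) (hm : 2 ≤ m)
    (hV : r + 2 * m ≤ finrank ℂ V) {E : Submodule ℂ V} (hE : finrank ℂ E = r) :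
    restrictedVirtualDim 2 r k (finrank ℂ V) - projDim (restrictedSecant V 2 r k) =
      secantVirtualDim 2 (grassmannian (V ⧸ E) m) -
        projDim (secantVariety 2 (grassmannian (V ⧸ E) m)) := by
  have hquot := E.finrank_quotient_add_finrank
  have hmE : m ≤ finrank ℂ (V ⧸ E) := by omega
  rw [projDim_restrictedSecant_two hk hm hV hE, secantVirtualDim, restrictedVirtualDim,
    projDim_grassmannian hmE, ← hquot, hE, hk, Nat.cast_mul, Nat.cast_sub hmE]
  push_cast
  ring

lemma restrictedVirtualDim_le_projDim (hk : k = r + m) (hm : 3 ≤ m)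
    (hV : r + 2 * m ≤ finrank ℂ V) :
    restrictedVirtualDim 2 r k (finrank ℂ V) ≤ projDim (restrictedSecant V 2 r k) := by
  obtain ⟨E, hE⟩ : ∃ E : Submodule ℂ V, finrank ℂ E = r := exists_submodule_finrank_eq (by omega)
  have hquot := E.finrank_quotient_add_finrank
  have hdefect := restrictedVirtualDim_sub_projDim hk (by omega) hV hE
  have hsecant := secantVirtualDim_le_projDim (V := V ⧸ E) (s := 1) hm (by omega)
  linarith

end ChordalVarieties

section Overlap

variable {r k n : ℕ}

lemma eq_overlap_add (hr : r ≤ k) (hk : k ≤ n) : k = overlap r k n + (k - overlap r k n) := by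
  unfold overlap
  omega

lemma le_sub_overlap {m : ℕ} (hr : r + m ≤ k) (hk : k + m ≤ n) : m ≤ k - overlap r k n := by
  unfold overlap
  omega

lemma overlap_add_two_mul_le (hr : r ≤ k) (hk : k ≤ n) :
    overlap r k n + 2 * (k - overlap r k n) ≤ n := by
  unfold overlap
  omega

lemma eq_add_two_or_sub_eq_two_of_projDim_lt {V : Type*} [AddCommGroup V] [Module ℂ V]
    [FiniteDimensional ℂ V] (hr : r + 2 ≤ k) (hk : k + 2 ≤ finrank ℂ V)
    (hlt : projDim (restrictedSecant V 2 r k) <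
      restrictedVirtualDim 2 (overlap r k (finrank ℂ V)) k (finrank ℂ V)) :
    finrank ℂ V = k + 2 ∨ k - r = 2 := by
  by_contra! h
  rw [← restrictedSecant_overlap rfl] at hlt
  exact hlt.not_ge <| restrictedVirtualDim_le_projDim (eq_overlap_add (by omega) (by omega))
    (le_sub_overlap (by omega) (by omega)) (overlap_add_two_mul_le (by omega) (by omega))

lemma eq_add_two_or_sub_eq_two_of_projDim_lt_expectedDim {V : Type*} [AddCommGroup V] [Module ℂ V]
    [FiniteDimensional ℂ V] (hr : r + 2 ≤ k) (hk : k ≤ finrank ℂ V)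
    (hlt : projDim (restrictedSecant V 2 r k) <
      restrictedExpectedDim 2 (overlap r k (finrank ℂ V)) k (finrank ℂ V)) :
    finrank ℂ V = k + 2 ∨ k - r = 2 := by
  obtain ⟨hvirtual, hfull⟩ := lt_min_iff.1 hlt
  rcases lt_or_ge (finrank ℂ V) (k + 2) with hV | hV
  · have hdim := projDim_restrictedSecant_of_finrank_le (s := 1) (r := r) (by omega) hk
      (Nat.lt_succ_iff.1 hV)
    exact absurd hdim hfull.ne
  · exact eq_add_two_or_sub_eq_two_of_projDim_lt hr hV hvirtual

end Overlap

end RestrictedChordal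

end

theorem mainTheorem5 {V : Type*} [AddCommGroup V] [Module ℂ V] [FiniteDimensional ℂ V]
    (n k r : ℕ) (hn : Module.finrank ℂ V = n) (hk : k ≤ n) (hr : r ≤ k) :
    -- the image of the projection is the restricted chordal variety
    Prod.snd '' RestrictedChordal.incidenceVariety V 2 r k =
        RestrictedChordal.restrictedSecant V 2 r k ∧
    -- raising `r` to the size of the general overlap does not change the variety
    RestrictedChordal.restrictedSecant V 2 (RestrictedChordal.overlap r k n) k =
        RestrictedChordal.restrictedSecant V 2 r k ∧
    (r + 2 ≤ k → k + 2 ≤ n →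
      -- the projection has finite fibers over a dense open subset of its image
      (∃ U : Set (Projectivization ℂ (⋀[ℂ]^k V)), IsOpen U ∧
        RestrictedChordal.restrictedSecant V 2 r k ⊆
          closure (U ∩ RestrictedChordal.restrictedSecant V 2 r k) ∧
        ∀ p ∈ U ∩ RestrictedChordal.restrictedSecant V 2 r k,
          (RestrictedChordal.incidenceVariety V 2 (RestrictedChordal.overlap r k n) k ∩
            Prod.snd ⁻¹' {p}).Finite) ∧
      -- the dimension is that of the incidence variety, and the defect is that of the
      -- ordinary secant variety
      (∀ E : Submodule ℂ V, Module.finrank ℂ E = RestrictedChordal.overlap r k n →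
        RestrictedChordal.projDim (RestrictedChordal.restrictedSecant V 2 r k) =
          (RestrictedChordal.overlap r k n : ℤ) * ((n : ℤ) - RestrictedChordal.overlap r k n) +
            RestrictedChordal.projDim (RestrictedChordal.secantVariety 2
              (RestrictedChordal.grassmannian (V ⧸ E)
                (k - RestrictedChordal.overlap r k n))) ∧
        RestrictedChordal.restrictedVirtualDim 2 (RestrictedChordal.overlap r k n) k n -
            RestrictedChordal.projDim (RestrictedChordal.restrictedSecant V 2 r k) =
          RestrictedChordal.secantVirtualDim 2 (RestrictedChordal.grassmannian (V ⧸ E)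
              (k - RestrictedChordal.overlap r k n)) -
            RestrictedChordal.projDim (RestrictedChordal.secantVariety 2
              (RestrictedChordal.grassmannian (V ⧸ E)
                (k - RestrictedChordal.overlap r k n)))) ∧
      -- a positive defect occurs only for `n = k + 2` or `k - r = 2`
      (RestrictedChordal.projDim (RestrictedChordal.restrictedSecant V 2 r k) <
          RestrictedChordal.restrictedVirtualDim 2 (RestrictedChordal.overlap r k n) k n →
        n = k + 2 ∨ k - r = 2)) ∧
    -- the dimension is less than the expected one only for `n = k + 2` or `k - r = 2`
    (r + 2 ≤ k →
      RestrictedChordal.projDim (RestrictedChordal.restrictedSecant V 2 r k) <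
        RestrictedChordal.restrictedExpectedDim 2 (RestrictedChordal.overlap r k n) k n →
      n = k + 2 ∨ k - r = 2) := by
  subst hn
  refine ⟨RestrictedChordal.image_incidenceVariety 2 hr,
    RestrictedChordal.restrictedSecant_overlap rfl r k, fun hrk hkn => ?_,
    fun hrk => RestrictedChordal.eq_add_two_or_sub_eq_two_of_projDim_lt_expectedDim hrk hk⟩
  have hk_eq := RestrictedChordal.eq_overlap_add hr hk
  have hm := RestrictedChordal.le_sub_overlap hrk hkn
  have hV := RestrictedChordal.overlap_add_two_mul_le hr hk
  rw [← RestrictedChordal.restrictedSecant_overlap rfl r k]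
  refine ⟨RestrictedChordal.exists_isOpen_fiber_finite hk_eq hm hV, fun E hE =>
    ⟨RestrictedChordal.projDim_restrictedSecant_two hk_eq hm hV hE,
      RestrictedChordal.restrictedVirtualDim_sub_projDim hk_eq hm hV hE⟩, ?_⟩
  rw [RestrictedChordal.restrictedSecant_overlap rfl r k]
  exact RestrictedChordal.eq_add_two_or_sub_eq_two_of_projDim_lt hrk hkn
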